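/- Let $n\ge 1$, $d=2^n$, and let $\mathbb P_n$ be the $n$-qubit Pauli group modulo phases, each class being represented by the Hermitian tensor product of the matrices $1,X,Y,Z$. A $t$-doped stabilizer state is a vector $|\psi\rangle=U|0\rangle^{\otimes n}$, where $U$ is a product of Clifford unitaries and exactly $t$ single-qubit gates $T=\mathrm{diag}(1,e^{i\pi/4})$; write $\psi=|\psi\rangle\langle\psi|$. Let $G_\psi=\{P\in\mathbb P_n : P|\psi\rangle=\pm|\psi\rangle\}$ and $S_\psi=\{P\in\mathbb P_n:\mathrm{tr}(P\psi)\ne 0\}$. An exact classical description of $\psi$ consists of independent generators $g_1,\dots,g_m$ of $G_\psi$ with the phases $\phi_j=\pm1$ such that $g_j|\psi\rangle=\phi_j|\psi\rangle$, and of Pauli operators $h_1,\dots,h_k$ such that $S_\psi=G_\psi\cup h_1G_\psi\cup\dots\cup h_kG_\psi$ is a disjoint union, with their exact expectation values, given by integers $a_i,b_i$ with $\mathrm{tr}(h_i\psi)=(a_i+b_i\sqrt2)/\sqrt2^{\,t}$; it satisfies $$\psi=\frac1d\Bigl(1+\sum_{i=1}^k \mathrm{tr}(h_i\psi)\,h_i\Bigr)\prod_{j=1}^m(1+\phi_jg_j).$$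 A learner is a fixed program, the same for all $n,t$, for a random access machine that holds integers and $n$-qubit Pauli strings. It is given $n$ and $t$. It has access to the unknown state $\psi$ only (i) through $\tilde\Xi$-samples, that is, Pauli strings $P$ drawn with probability $\tilde\Xi_\psi(P)=|\langle\psi|P|\psi^*\rangle|^2/d$ (the outcome of a Bell measurement on two copies of $\psi$; $\psi^*$ is the complex conjugate in the computational basis), and (ii) through measurement shots, that is, the $\pm1$ outcome of measuring a Pauli string it holds on one copy of $\psi$. A classical step is one elementary operation on integers (constant, addition, subtraction, memory access, comparison, loop round) or on Pauli strings (product, commutation test, access to one qubit). There are a program and an absolute constant $C$ such that for all $n\ge1$, $t\ge0$ and every $t$-doped stabilizer state $\psi$ on $n$ qubits, the program, run on $\psi$, always uses at most $C\,2^{6t}n$ $\tilde\Xi$-samples, at most $C\,2^{9t}n(n+6t)$ measurement shots and, apart from at most $C$ bookkeeping steps per sample or shot that it takes (on average over the run), at most $C n^2$ additional classical steps (in total: steps $\le C\cdot(\text{samples}+\text{shots})+Cn^2$); and, except with probability at most $C\,n\,2^{-n}$, its output is an exact classical description of $\psi$. -/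

import Mathlib

open scoped Matrix ENNReal

noncomputable section

namespace TDoped

/-! ### Qubits, Pauli operators, Clifford and `T` gates -/

/-- Labels of the computational basis of `n` qubits. -/
abbrev Basis (n : ℕ) : Type := Fin n → Fin 2

/-- The Pauli group modulo phases, `𝔽₂^{2n}`: at every qubit a pair `(x, z)` of bits.
The group law, written additively, is the product of Pauli operators up to a phase. -/
abbrev Pauli (n : ℕ) : Type := Fin n → ZMod 2 × ZMod 2

/-- Single-qubit Pauli matrices: `(0,0) ↦ 1`, `(1,0) ↦ X`, `(1,1) ↦ Y`, `(0,1) ↦ Z`. -/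
def sigma (p : ZMod 2 × ZMod 2) : Matrix (Fin 2) (Fin 2) ℂ :=
  if p.1 = 0 then
    (if p.2 = 0 then !![1, 0; 0, 1] else !![1, 0; 0, -1])
  else
    (if p.2 = 0 then !![0, 1; 1, 0] else !![0, -Complex.I; Complex.I, 0])

/-- The Hermitian Pauli operator (tensor product of single-qubit Pauli matrices) of a label. -/
def Pauli.mat {n : ℕ} (P : Pauli n) : Matrix (Basis n) (Basis n) ℂ :=
  Matrix.of fun a b => ∏ i, sigma (P i) (a i) (b i)

/-- Commutation bit of two Pauli operators: `0` if they commute, `1` if they anticommute. -/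
def Pauli.symp {n : ℕ} (P Q : Pauli n) : ZMod 2 :=
  ∑ i, ((P i).1 * (Q i).2 + (P i).2 * (Q i).1)

/-- `C` is a Clifford unitary: conjugation maps Pauli operators to Pauli operators up to a
phase in `{±1, ±i}`. -/
def IsClifford {n : ℕ} (C : Matrix (Basis n) (Basis n) ℂ) : Prop :=
  C ∈ Matrix.unitaryGroup (Basis n) ℂ ∧
    ∀ P : Pauli n, ∃ (Q : Pauli n) (k : Fin 4),
      Cᴴ * P.mat * C = (Complex.I ^ (k : ℕ)) • Q.mat

/-- The gate `T = diag(1, e^{iπ/4})` on qubit `q`. -/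
def tGate {n : ℕ} (q : Fin n) : Matrix (Basis n) (Basis n) ℂ :=
  Matrix.diagonal fun a => if a q = 1 then Complex.exp (Complex.I * (Real.pi / 4)) else 1

/-- Unitaries composed of Clifford unitaries and exactly `t` single-qubit `T` gates. -/
inductive DopedClifford (n : ℕ) : ℕ → Matrix (Basis n) (Basis n) ℂ → Prop
  | clifford (C : Matrix (Basis n) (Basis n) ℂ) (hC : IsClifford C) : DopedClifford n 0 C
  | step (t : ℕ) (U C : Matrix (Basis n) (Basis n) ℂ) (q : Fin n)
      (hU : DopedClifford n t U) (hC : IsClifford C) : DopedClifford n (t + 1) (C * tGate q * U)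

/-- Unit vectors of `(ℂ²)^{⊗ n}`. -/
structure PureState (n : ℕ) where
  vec : Basis n → ℂ
  unit : ∑ a, ‖vec a‖ ^ 2 = 1

/-- `ψ = U |0…0⟩` for a Clifford+`T` unitary `U` with `t` `T` gates. -/
def IsDopedState {n : ℕ} (t : ℕ) (ψ : PureState n) : Prop :=
  ∃ U, DopedClifford n t U ∧ ψ.vec = U *ᵥ Pi.single (fun _ => 0) 1

/-- The density matrix `|ψ⟩⟨ψ|`. -/
def PureState.density {n : ℕ} (ψ : PureState n) : Matrix (Basis n) (Basis n) ℂ :=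
  Matrix.vecMulVec ψ.vec (star ψ.vec)

/-- The expectation value `⟨ψ|P|ψ⟩ = tr(P ψ)`. -/
def PureState.expect {n : ℕ} (ψ : PureState n) (P : Pauli n) : ℝ :=
  (star ψ.vec ⬝ᵥ P.mat *ᵥ ψ.vec).re

/-- The stabilizer group `{P | P|ψ⟩ = ±|ψ⟩}`. -/
def PureState.stab {n : ℕ} (ψ : PureState n) : Set (Pauli n) :=
  {P | P.mat *ᵥ ψ.vec = ψ.vec ∨ P.mat *ᵥ ψ.vec = -ψ.vec}

/-! ### The two kinds of quantum data -/

/-- `Ξ̃_ψ(P) = |⟨ψ|P|ψ^*⟩|² / d`, where `d = 2^n` and `ψ^*` is the entrywise conjugate. -/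
def PureState.xiTilde {n : ℕ} (ψ : PureState n) (P : Pauli n) : ℝ :=
  ‖star ψ.vec ⬝ᵥ P.mat *ᵥ star ψ.vec‖ ^ 2 / 2 ^ n

/-- Amplitude at `|a⟩ ⊗ |b⟩` of the Bell vector `(1 ⊗ P) 2^{-n/2} ∑_c |c⟩ ⊗ |c⟩`. -/
def bellVec {n : ℕ} (P : Pauli n) (ab : Basis n × Basis n) : ℂ :=
  P.mat ab.2 ab.1 / (Real.sqrt (2 ^ n) : ℝ)

/-- The Born probability of the outcome `P` of a Bell measurement on `ψ ⊗ ψ` is `Ξ̃_ψ(P)`. -/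
theorem bell_eq_xiTilde {n : ℕ} (ψ : PureState n) (P : Pauli n) :
    ‖star (bellVec P) ⬝ᵥ (fun ab => ψ.vec ab.1 * ψ.vec ab.2)‖ ^ 2 = ψ.xiTilde P := by
  have h : star (bellVec P) ⬝ᵥ (fun ab => ψ.vec ab.1 * ψ.vec ab.2) =
      star (star ψ.vec ⬝ᵥ P.mat *ᵥ star ψ.vec) / (Real.sqrt (2 ^ n) : ℝ) := by
    simp only [dotProduct, Matrix.mulVec, Fintype.sum_prod_type, bellVec, Pi.star_apply,
      star_sum, star_mul', star_star, Finset.mul_sum, Finset.sum_div, star_div₀]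
    rw [Finset.sum_comm]
    refine Finset.sum_congr rfl fun b _ => Finset.sum_congr rfl fun a _ => ?_
    rw [show star ((Real.sqrt (2 ^ n) : ℝ) : ℂ) = ((Real.sqrt (2 ^ n) : ℝ) : ℂ) from
      Complex.conj_ofReal _]
    ring
  rw [h, norm_div, norm_star, div_pow, PureState.xiTilde, Complex.norm_real, Real.norm_eq_abs,
    sq_abs, Real.sq_sqrt (by positivity)]

theorem sigma_complete (a b c d : Fin 2) :
    ∑ p, star (sigma p a b) * sigma p c d = if a = c ∧ b = d then 2 else 0 := by
  have h2 : ∀ f : ZMod 2 → ℂ, ∑ x, f x = f 0 + f 1 := fun f => Fin.sum_univ_two f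
  have h1 : (1 : ZMod 2) ≠ 0 := by decide
  rw [Fintype.sum_prod_type]
  simp only [h2]
  fin_cases a <;> fin_cases b <;> fin_cases c <;> fin_cases d <;>
    simp [sigma, h1] <;> norm_num

theorem mat_complete {n : ℕ} (a b c d : Basis n) :
    ∑ P : Pauli n, star (P.mat a b) * P.mat c d = if a = c ∧ b = d then 2 ^ n else 0 := by
  have h : ∀ P : Pauli n, star (P.mat a b) * P.mat c d =
      ∏ i, star (sigma (P i) (a i) (b i)) * sigma (P i) (c i) (d i) := by
    intro P
    simp only [Pauli.mat, Matrix.of_apply, star_prod, Finset.prod_mul_distrib]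
  simp only [h]
  rw [← Fintype.prod_sum
    (fun i p => star (sigma p (a i) (b i)) * sigma p (c i) (d i))]
  simp only [sigma_complete]
  split_ifs with hac
  · obtain ⟨rfl, rfl⟩ := hac
    simp
  · have : ∃ i, ¬ (a i = c i ∧ b i = d i) := by
      by_contra hcon
      push Not at hcon
      exact hac ⟨funext fun i => (hcon i).1, funext fun i => (hcon i).2⟩
    obtain ⟨i, hi⟩ := this
    exact Finset.prod_eq_zero (Finset.mem_univ i) (by simp [hi])

theorem PureState.unit' {n : ℕ} (ψ : PureState n) : ∑ a, star (ψ.vec a) * ψ.vec a = 1 := by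
  have h := congrArg (fun x : ℝ => (x : ℂ)) ψ.unit
  simp only [Complex.ofReal_sum, Complex.ofReal_pow, Complex.ofReal_one] at h
  rw [← h]
  exact Finset.sum_congr rfl fun a _ => Complex.conj_mul' _

theorem sum_xiTilde {n : ℕ} (ψ : PureState n) : ∑ P, ψ.xiTilde P = 1 := by
  set w : Basis n × Basis n → ℂ := fun x => star (ψ.vec x.1) * star (ψ.vec x.2) with hw
  have e : ∀ P : Pauli n, star ψ.vec ⬝ᵥ P.mat *ᵥ star ψ.vec = ∑ x, w x * P.mat x.1 x.2 := by
    intro P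
    simp only [dotProduct, Matrix.mulVec, Fintype.sum_prod_type, Finset.mul_sum, hw,
      Pi.star_apply]
    refine Finset.sum_congr rfl fun a _ => Finset.sum_congr rfl fun b _ => ?_
    ring
  have key : ∑ P : Pauli n, star (∑ x, w x * P.mat x.1 x.2) * (∑ x, w x * P.mat x.1 x.2) =
      (2 : ℂ) ^ n := by
    have e1 : ∀ P : Pauli n,
        star (∑ x, w x * P.mat x.1 x.2) * (∑ x, w x * P.mat x.1 x.2) =
        ∑ x, ∑ y, star (w x) * w y * (star (P.mat x.1 x.2) * P.mat y.1 y.2) := by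
      intro P
      rw [star_sum, Finset.sum_mul_sum]
      refine Finset.sum_congr rfl fun a _ => Finset.sum_congr rfl fun b _ => ?_
      rw [star_mul']
      ring
    simp only [e1]
    rw [Finset.sum_comm]
    have e2 : ∀ x : Basis n × Basis n,
        ∑ P : Pauli n, ∑ y, star (w x) * w y * (star (P.mat x.1 x.2) * P.mat y.1 y.2) =
        star (w x) * w x * 2 ^ n := by
      intro x
      rw [Finset.sum_comm]
      simp only [← Finset.mul_sum, mat_complete]
      rw [Finset.sum_eq_single x]
      · simp
      · intro y _ hy
        rw [if_neg, mul_zero]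
        rintro ⟨h1, h2⟩
        exact hy (Prod.ext h1.symm h2.symm)
      · simp
    simp only [e2]
    rw [← Finset.sum_mul]
    have e3 : ∑ x, star (w x) * w x = 1 := by
      have := congrArg₂ (· * ·) ψ.unit' ψ.unit'
      simp only [Finset.sum_mul_sum, mul_one] at this
      rw [Fintype.sum_prod_type, ← this]
      refine Finset.sum_congr rfl fun a _ => Finset.sum_congr rfl fun b _ => ?_
      simp only [hw, star_mul', star_star]
      ring
    rw [e3, one_mul]
  have key' : ∑ P : Pauli n, ‖∑ x, w x * P.mat x.1 x.2‖ ^ 2 = (2 : ℝ) ^ n := by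
    have h : ((∑ P : Pauli n, ‖∑ x, w x * P.mat x.1 x.2‖ ^ 2 : ℝ) : ℂ) = ((2 ^ n : ℝ) : ℂ) := by
      push_cast
      rw [← key]
      exact Finset.sum_congr rfl fun P _ => (Complex.conj_mul' _).symm
    exact_mod_cast h
  simp only [PureState.xiTilde, e]
  rw [← Finset.sum_div, key', div_self (by positivity)]

/-- Result of a Bell measurement on two copies of `ψ`: a sample of `Ξ̃_ψ`. -/
def PureState.bell {n : ℕ} (ψ : PureState n) : PMF (Pauli n) :=
  PMF.ofFintype (fun P => ENNReal.ofReal (ψ.xiTilde P)) (by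
    rw [← ENNReal.ofReal_sum_of_nonneg, sum_xiTilde, ENNReal.ofReal_one]
    intro P _
    unfold PureState.xiTilde
    positivity)

theorem sigma_unitary (p : ZMod 2 × ZMod 2) (a b : Fin 2) :
    ∑ c, star (sigma p c a) * sigma p c b = if a = b then 1 else 0 := by
  unfold sigma
  split_ifs <;> fin_cases a <;> fin_cases b <;> simp_all

theorem mat_unitary {n : ℕ} (P : Pauli n) : (P.mat)ᴴ * P.mat = 1 := by
  ext a b
  have h : ∀ c : Basis n, star (P.mat c a) * P.mat c b =
      ∏ i, star (sigma (P i) (c i) (a i)) * sigma (P i) (c i) (b i) := by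
    intro c
    simp only [Pauli.mat, Matrix.of_apply, star_prod, Finset.prod_mul_distrib]
  rw [Matrix.mul_apply]
  simp only [Matrix.conjTranspose_apply, h]
  rw [← Fintype.prod_sum
    (fun i c => star (sigma (P i) c (a i)) * sigma (P i) c (b i))]
  simp only [sigma_unitary, Matrix.one_apply]
  split_ifs with hab
  · subst hab
    simp
  · obtain ⟨i, hi⟩ := Function.ne_iff.mp hab
    exact Finset.prod_eq_zero (Finset.mem_univ i) (by simp [hi])

theorem abs_expect_le {n : ℕ} (ψ : PureState n) (P : Pauli n) : |ψ.expect P| ≤ 1 := by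
  have h1 : ∑ a, ‖(P.mat *ᵥ ψ.vec) a‖ ^ 2 = 1 := by
    have h : star (P.mat *ᵥ ψ.vec) ⬝ᵥ (P.mat *ᵥ ψ.vec) = 1 := by
      rw [Matrix.star_mulVec, ← Matrix.dotProduct_mulVec, Matrix.mulVec_mulVec, mat_unitary,
        Matrix.one_mulVec]
      exact ψ.unit'
    have h' : ((∑ a, ‖(P.mat *ᵥ ψ.vec) a‖ ^ 2 : ℝ) : ℂ) = ((1 : ℝ) : ℂ) := by
      push_cast
      rw [← h]
      exact Finset.sum_congr rfl fun a _ => (Complex.conj_mul' _).symm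
    exact_mod_cast h'
  calc |ψ.expect P| ≤ ‖star ψ.vec ⬝ᵥ P.mat *ᵥ ψ.vec‖ := Complex.abs_re_le_norm _
    _ ≤ ∑ a, ‖star ψ.vec a * (P.mat *ᵥ ψ.vec) a‖ := norm_sum_le _ _
    _ ≤ ∑ a, (‖ψ.vec a‖ ^ 2 + ‖(P.mat *ᵥ ψ.vec) a‖ ^ 2) / 2 := by
        refine Finset.sum_le_sum fun a _ => ?_
        rw [norm_mul, Pi.star_apply, norm_star]
        nlinarith [sq_nonneg (‖ψ.vec a‖ - ‖(P.mat *ᵥ ψ.vec) a‖)]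
    _ = 1 := by
        rw [← Finset.sum_div, Finset.sum_add_distrib, ψ.unit, h1]
        norm_num

/-- Result of measuring the Pauli observable `P` on one copy of `ψ`: `true` stands for the
outcome `+1`, of probability `(1 + ⟨ψ|P|ψ⟩)/2`, and `false` for the outcome `-1`. -/
def PureState.measure {n : ℕ} (ψ : PureState n) (P : Pauli n) : PMF Bool :=
  PMF.ofFintype
    (fun b => ENNReal.ofReal ((1 + (if b then 1 else -1) * ψ.expect P) / 2)) (by
      have h := abs_le.mp (abs_expect_le ψ P)
      rw [Fintype.sum_bool, ← ENNReal.ofReal_add, ← ENNReal.ofReal_one]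
      · congr 1
        simp only [if_true, Bool.false_eq_true, if_false]
        ring
      · simp only [if_true]
        linarith [h.1]
      · simp only [Bool.false_eq_true, if_false]
        linarith [h.2])

/-! ### The learner: a random access machine that holds Pauli strings

A program is a fixed finite text, the same for all numbers of qubits. It works on integer
registers, an integer array and an array of `n`-qubit Pauli strings. Every instruction, every
test and every round of a loop takes one step; a step is one operation on integers or on
Pauli strings. The unknown state is accessed only by `sample` and `shot`. -/

/-- Deterministic instructions. Lower-case letters name registers; `arr[a]`, `pau[a]` is the
array cell whose address is the content of register `a`. -/
inductive Instr : Type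
  /-- `r := c` for a constant `c` -/
  | const (r : ℕ) (c : ℤ)
  /-- `r := a + b` -/
  | add (r a b : ℕ)
  /-- `r := a - b` -/
  | sub (r a b : ℕ)
  /-- `r := arr[a]` -/
  | load (r a : ℕ)
  /-- `arr[a] := r` -/
  | store (a r : ℕ)
  /-- `pau[a]` becomes the Pauli operator `X` on the qubit in register `q`; the identity if
  there is no such qubit -/
  | setX (a q : ℕ)
  /-- the same with `Z` -/
  | setZ (a q : ℕ)
  /-- `pau[a] := pau[b] · pau[c]`, up to a phase -/
  | mul (a b c : ℕ)
  /-- `r :=` the `x`-bit of `pau[a]` at the qubit in register `q`; `0` if there is no such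
  qubit -/
  | getX (r a q : ℕ)
  /-- `r :=` the `z`-bit, likewise -/
  | getZ (r a q : ℕ)
  /-- `r := 0` if `pau[a]` and `pau[b]` commute, `r := 1` otherwise -/
  | comm (r a b : ℕ)

/-- Programs. -/
inductive Prog : Type
  /-- a deterministic instruction -/
  | instr (i : Instr)
  /-- `pau[a]` := a sample of `Ξ̃_ψ` -/
  | sample (a : ℕ)
  /-- `r := ±1`, the outcome of a measurement of `pau[a]` on a fresh copy of `ψ` -/
  | shot (r a : ℕ)
  /-- first `p`, then `q` -/
  | seq (p q : Prog)
  /-- if `a ≤ b` then `p` else `q` -/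
  | ite (a b : ℕ) (p q : Prog)
  /-- repeat `p`; the number of rounds is the content of register `a` at the start -/
  | loop (a : ℕ) (p : Prog)

/-- Memory and resource counters of the machine. -/
structure Store (n : ℕ) where
  reg : ℕ → ℤ
  arr : ℕ → ℤ
  pau : ℕ → Pauli n
  samples : ℕ
  shots : ℕ
  steps : ℕ

/-- The initial store: register `0` holds `n`, register `1` holds `t`, all else is blank. -/
def Store.init (n t : ℕ) : Store n where
  reg := fun i => if i = 0 then n else if i = 1 then t else 0
  arr := fun _ => 0
  pau := fun _ => 0
  samples := 0
  shots := 0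
  steps := 0

variable {n : ℕ}

/-- The natural number in a register (negative contents are read as `0`). -/
def Store.nat (s : Store n) (a : ℕ) : ℕ := (s.reg a).toNat

def Store.setReg (s : Store n) (r : ℕ) (v : ℤ) : Store n :=
  { s with reg := Function.update s.reg r v }

def Store.setPau (s : Store n) (a : ℕ) (P : Pauli n) : Store n :=
  { s with pau := Function.update s.pau (s.nat a) P }

/-- One step of computation passes. -/
def Store.tick (s : Store n) : Store n := { s with steps := s.steps + 1 }

/-- The Pauli string with bits `p` at qubit number `q` and the identity elsewhere. -/
def Pauli.at (n q : ℕ) (p : ZMod 2 × ZMod 2) : Pauli n :=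
  fun i => if (i : ℕ) = q then p else 0

/-- The bits of a Pauli string at qubit number `q`. -/
def Pauli.bits (P : Pauli n) (q : ℕ) : ZMod 2 × ZMod 2 :=
  if h : q < n then P ⟨q, h⟩ else 0

def Instr.exec (s : Store n) : Instr → Store n
  | .const r c => s.setReg r c
  | .add r a b => s.setReg r (s.reg a + s.reg b)
  | .sub r a b => s.setReg r (s.reg a - s.reg b)
  | .load r a => s.setReg r (s.arr (s.nat a))
  | .store a r => { s with arr := Function.update s.arr (s.nat a) (s.reg r) }
  | .setX a q => s.setPau a (Pauli.at n (s.nat q) (1, 0))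
  | .setZ a q => s.setPau a (Pauli.at n (s.nat q) (0, 1))
  | .mul a b c => s.setPau a (s.pau (s.nat b) + s.pau (s.nat c))
  | .getX r a q => s.setReg r (((s.pau (s.nat a)).bits (s.nat q)).1.val : ℕ)
  | .getZ r a q => s.setReg r (((s.pau (s.nat a)).bits (s.nat q)).2.val : ℕ)
  | .comm r a b => s.setReg r (((s.pau (s.nat a)).symp (s.pau (s.nat b))).val : ℕ)

/-- The law of the final store of a program that runs on the unknown state `ψ`. -/
def Prog.run (ψ : PureState n) : Prog → Store n → PMF (Store n)
  | .instr i, s => PMF.pure (i.exec s).tick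
  | .sample a, s => ψ.bell.map fun P =>
      { (s.setPau a P).tick with samples := s.samples + 1 }
  | .shot r a, s => (ψ.measure (s.pau (s.nat a))).map fun b =>
      { (s.setReg r (if b then 1 else -1)).tick with shots := s.shots + 1 }
  | .seq p q, s => (p.run ψ s).bind (q.run ψ)
  | .ite a b p q, s => if s.reg a ≤ s.reg b then p.run ψ s.tick else q.run ψ s.tick
  | .loop a p, s => (fun μ => μ.bind fun s' => p.run ψ s'.tick)^[s.nat a] (PMF.pure s.tick)

/-! ### The output -/

/-- A classical description: `m` generators with phases `φ`, and `k` bad generators whose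
expectation values are `(num₁ + num₂ √2) / √2^t`. -/
structure Description (n : ℕ) where
  m : ℕ
  g : Fin m → Pauli n
  φ : Fin m → ℤ
  k : ℕ
  h : Fin k → Pauli n
  num₁ : Fin k → ℤ
  num₂ : Fin k → ℤ

/-- The output convention: `m`, `k` in registers `0`, `1`; `g₁,…,g_m,h₁,…,h_k` in the first
cells of the Pauli array; `φ₁,…,φ_m`, then the `k` pairs of numerators in the integer array. -/
def Store.output (s : Store n) : Description n where
  m := s.nat 0
  g := fun j => s.pau j
  φ := fun j => s.arr j
  k := s.nat 1
  h := fun i => s.pau (s.nat 0 + i)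
  num₁ := fun i => s.arr (s.nat 0 + 2 * i)
  num₂ := fun i => s.arr (s.nat 0 + 2 * i + 1)

/-- The expectation value that the description assigns to its `i`-th bad generator. -/
def Description.value (D : Description n) (t : ℕ) (i : Fin D.k) : ℝ :=
  (D.num₁ i + D.num₂ i * Real.sqrt 2) / Real.sqrt 2 ^ t

/-- The matrix `d⁻¹ (1 + ∑ᵢ tr(hᵢψ) hᵢ) ∏ⱼ (1 + φⱼ gⱼ)` that a description stands for. -/
def Description.toMatrix (D : Description n) (t : ℕ) : Matrix (Basis n) (Basis n) ℂ :=
  ((2 : ℂ) ^ n)⁻¹ • ((1 + ∑ i, (D.value t i : ℂ) • (D.h i).mat) *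
    (List.ofFn fun j => 1 + (D.φ j : ℂ) • (D.g j).mat).prod)

/-- `D` is the exact description of `ψ`: its generators are independent generators of the
stabilizer group `G`, with the right phases; the nontrivial cosets of `G` in the set
`{P | tr(Pψ) ≠ 0}` are `h₁G,…,h_kG`, pairwise distinct; the expectation values are exact;
and the density matrix of `ψ` is the matrix of `D`. -/
structure Description.Describes (D : Description n) (t : ℕ) (ψ : PureState n) : Prop where
  gens : (AddSubgroup.closure (Set.range D.g) : Set (Pauli n)) = ψ.stab
  indep : LinearIndependent (ZMod 2) D.g
  phase : ∀ j, (D.φ j = 1 ∨ D.φ j = -1) ∧ (D.g j).mat *ᵥ ψ.vec = (D.φ j : ℂ) • ψ.vec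
  cosets : ∀ P, ψ.expect P ≠ 0 ↔ P ∈ ψ.stab ∨ ∃ i, P - D.h i ∈ ψ.stab
  notMem : ∀ i, D.h i ∉ ψ.stab
  distinct : ∀ i j, D.h i - D.h j ∈ ψ.stab → i = j
  value : ∀ i, ψ.expect (D.h i) = D.value t i
  density : ψ.density = D.toMatrix t

end TDoped

end

open scoped Matrix ENNReal

namespace TDoped

/-! ### Pauli algebra -/

/-! Write G for the stabilizer group, G^⊥ for its commutant under the symplectic form, and ⟨Q⟩ for
an expectation value. The learner finds G by Bell sampling, lists representatives of G^⊥/G, and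
measures each of them.

Why Bell sampling finds G. The symplectic Fourier transform of Ξ̃ at Q is ±⟨Q⟩²
(`PureState.sum_xiTilde_bitSign`). For Q in G it has modulus one, so all samples have the same
commutation bit with Q, and the product of two samples commutes with G. For Q outside G, a sample
shifted by a fixed string commutes with Q with probability at most (1+⟨Q⟩²)/2. For a t-doped state
this stays away from 1: all expectation values have the form (a+b√2)/√2^t with |a|, |b| ≤ 2^t, and
distinct numbers of this form differ by at least 1/(5·4^t), because the norm a²-2b² of a nonzero
element of ℤ[√2] is a nonzero integer (`separation`, `IsDopedState.expect_sq_le`). The pool is a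
space of strings, at first the whole Pauli group, that is cut down to the commutant of each shifted
sample. It always contains G, and the expected number of its elements outside G shrinks by the
factor 1-1/(10·4^t) per sample, from at most 4^n to at most 2^{-n} (`pmfE_excess_le`,
`sampling_rate`). By Markov's inequality the pool is then G except with probability 2^{-n}
(`sampling_failProb`).

Why there are few cosets. Clifford gates do not lower the dimension of G and a T gate lowers it by
at most one, so dim G ≥ n-t and dim G^⊥/G ≤ 2t. A string with nonzero expectation lies in G^⊥, and
inside a coset of G in G^⊥ expectation values differ only by signs. So at most 4^t values matter.
When the pool equals G, the vectors that cut it down span G^⊥; a second elimination, on copies of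
them, selects generators of G^⊥ modulo G (`complement_of_cells`, `Complemented.commutant`).

Why the values are exact. With 2^(14+4t)(n+2t) shots the empirical mean is within 1/(64·4^t) of the
truth except with probability 2·exp(-(n+2t)) (`measureEntry_failProb`), which is finer than the
separation. A search over all numerators in integer arithmetic, with a solution p/q of Pell's
equation in place of √2, then singles out the right pair (`decode`, `search_spec`). A union bound
over the cosets costs 4^t·2·2^{-(n+2t)} = 2·2^{-n}, and 3·2^{-n} in all (`learner_failProb`). The
matrix identity for ψ is algebra (`Description.describes_of`).

Why the running time is small. Every round of every loop takes a sample or a shot, if need be one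
whose outcome is discarded. The number of steps is therefore linear in the amount of data, by
induction on the program text (`Prog.steps_le`).

Memory: Pauli cells 0 to 2n-1 hold the pool followed by the recorded vectors, cells 2n to 4n-1 the
copies for the second elimination, and cell 4n the identity. Cells 4n+1 and 4n+2 hold the current
and the reference sample; later the list of coset representatives starts at 4n. -/

theorem zmod_two_pair_cases (p : ZMod 2 × ZMod 2) :
    p = (0, 0) ∨ p = (1, 0) ∨ p = (0, 1) ∨ p = (1, 1) := by
  revert p; decide

/-- The sign `(-1)^x` of a bit. -/
def bitSign (x : ZMod 2) : ℝ := if x = 0 then 1 else -1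

theorem bitSign_add (x y : ZMod 2) : bitSign (x + y) = bitSign x * bitSign y := by
  have : ∀ z : ZMod 2, z = 0 ∨ z = 1 := by decide
  rcases this x with rfl | rfl <;> rcases this y with rfl | rfl <;>
    simp [bitSign, show (1 : ZMod 2) + 1 = 0 from rfl]

theorem bitSign_zero : bitSign 0 = 1 := by simp [bitSign]

theorem bitSign_mul_self (x : ZMod 2) : bitSign x * bitSign x = 1 := by
  unfold bitSign; split_ifs <;> norm_num

theorem bitSign_sum {ι : Type*} (s : Finset ι) (f : ι → ZMod 2) :
    bitSign (∑ i ∈ s, f i) = ∏ i ∈ s, bitSign (f i) := by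
  classical
  induction s using Finset.induction_on with
  | empty => simp [bitSign]
  | insert i s hi ih => rw [Finset.sum_insert hi, Finset.prod_insert hi, bitSign_add, ih]

variable {n : ℕ}

/-- Tensor product of single-qubit matrices. -/
def tensorMat (M : Fin n → Matrix (Fin 2) (Fin 2) ℂ) : Matrix (Basis n) (Basis n) ℂ :=
  Matrix.of fun a b => ∏ i, M i (a i) (b i)

theorem tensorMat_mul (M N : Fin n → Matrix (Fin 2) (Fin 2) ℂ) :
    tensorMat M * tensorMat N = tensorMat fun i => M i * N i := by
  ext a b
  simp only [tensorMat, Matrix.mul_apply, Matrix.of_apply, ← Finset.prod_mul_distrib]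
  rw [← Fintype.prod_sum (fun i c => M i (a i) c * N i c (b i))]

theorem tensorMat_smul (c : Fin n → ℂ) (M : Fin n → Matrix (Fin 2) (Fin 2) ℂ) :
    tensorMat (fun i => c i • M i) = (∏ i, c i) • tensorMat M := by
  ext a b
  simp [tensorMat, Finset.prod_mul_distrib]

theorem Pauli.mat_eq_tensorMat (P : Pauli n) : P.mat = tensorMat fun i => sigma (P i) := rfl

theorem sigma_conjTranspose (p : ZMod 2 × ZMod 2) : (sigma p)ᴴ = sigma p := by
  ext a b
  rcases zmod_two_pair_cases p with rfl | rfl | rfl | rfl <;> fin_cases a <;> fin_cases b <;>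
    simp [sigma]

theorem Pauli.mat_conjTranspose (P : Pauli n) : (P.mat)ᴴ = P.mat := by
  ext a b
  simp only [Matrix.conjTranspose_apply, Pauli.mat, Matrix.of_apply, star_prod]
  refine Finset.prod_congr rfl fun i _ => ?_
  conv_rhs => rw [← sigma_conjTranspose]
  rfl

theorem Pauli.mat_mul_self (P : Pauli n) : P.mat * P.mat = 1 := by
  have := mat_unitary P
  rwa [Pauli.mat_conjTranspose] at this

theorem sigma_mul (p q : ZMod 2 × ZMod 2) : ∃ c : ℂ, sigma (p + q) = c • (sigma p * sigma q) := by
  have h11 : (1 : ZMod 2) + 1 = 0 := rfl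
  rcases zmod_two_pair_cases p with rfl | rfl | rfl | rfl <;>
  rcases zmod_two_pair_cases q with rfl | rfl | rfl | rfl
  all_goals first
    | (refine ⟨1, ?_⟩; ext a b; fin_cases a <;> fin_cases b <;> simp [sigma, h11]; done)
    | (refine ⟨-1, ?_⟩; ext a b; fin_cases a <;> fin_cases b <;> simp [sigma, h11]; done)
    | (refine ⟨Complex.I, ?_⟩; ext a b; fin_cases a <;> fin_cases b <;> simp [sigma, h11]; done)
    | (refine ⟨-Complex.I, ?_⟩; ext a b; fin_cases a <;> fin_cases b <;> simp [sigma, h11])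

/-- The phase is the product of the one-qubit phases. Its value is never needed: where it matters,
P² = 1 forces it up to sign. -/
theorem Pauli.mat_add (P Q : Pauli n) : ∃ c : ℂ, (P + Q).mat = c • (P.mat * Q.mat) := by
  choose c hc using fun i => sigma_mul (P i) (Q i)
  refine ⟨∏ i, c i, ?_⟩
  rw [Pauli.mat_eq_tensorMat P, Pauli.mat_eq_tensorMat Q, tensorMat_mul, ← tensorMat_smul,
    Pauli.mat_eq_tensorMat]
  congr 1
  funext i
  exact hc i

theorem sigma_comm (p q : ZMod 2 × ZMod 2) :
    sigma p * sigma q = (bitSign (p.1 * q.2 + p.2 * q.1) : ℂ) • (sigma q * sigma p) := by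
  have h11 : (1 : ZMod 2) + 1 = 0 := rfl
  rcases zmod_two_pair_cases p with rfl | rfl | rfl | rfl <;>
  rcases zmod_two_pair_cases q with rfl | rfl | rfl | rfl <;>
  (ext a b; fin_cases a <;> fin_cases b <;> simp [sigma, h11, bitSign])

theorem Pauli.mat_comm (P Q : Pauli n) :
    P.mat * Q.mat = (bitSign (P.symp Q) : ℂ) • (Q.mat * P.mat) := by
  rw [Pauli.mat_eq_tensorMat P, Pauli.mat_eq_tensorMat Q, tensorMat_mul, tensorMat_mul,
    Pauli.symp, bitSign_sum]
  push_cast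
  rw [← tensorMat_smul]
  congr 1
  funext i
  exact sigma_comm _ _

theorem Pauli.mat_conj (P Q : Pauli n) :
    Q.mat * P.mat * Q.mat = (bitSign (P.symp Q) : ℂ) • P.mat := by
  rw [mul_assoc, Pauli.mat_comm P Q, mul_smul_comm, ← mul_assoc, Pauli.mat_mul_self, one_mul]

theorem sigma_transpose (p : ZMod 2 × ZMod 2) : (sigma p)ᵀ =
    (bitSign (p.1 * p.2) : ℂ) • sigma p := by
  ext a b
  rcases zmod_two_pair_cases p with rfl | rfl | rfl | rfl <;> fin_cases a <;> fin_cases b <;>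
    simp [sigma, bitSign]

/-- Only Y is antisymmetric, so the sign counts the Y factors. It enters because Bell sampling pairs
ψ with its complex conjugate. -/
theorem Pauli.mat_transpose (P : Pauli n) :
    (P.mat)ᵀ = (bitSign (∑ i, (P i).1 * (P i).2) : ℂ) • P.mat := by
  rw [bitSign_sum]
  push_cast
  rw [Pauli.mat_eq_tensorMat, ← tensorMat_smul]
  ext a b
  simp only [← sigma_transpose]
  rfl

theorem Pauli.mat_zero : (0 : Pauli n).mat = 1 := by
  ext a b
  have : sigma 0 = 1 := by
    ext a b; fin_cases a <;> fin_cases b <;> simp [sigma]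
  simp only [Pauli.mat, Pi.zero_apply, this, Matrix.of_apply, Matrix.one_apply]
  split_ifs with h
  · simp [h]
  · obtain ⟨i, hi⟩ := Function.ne_iff.mp h
    exact Finset.prod_eq_zero (Finset.mem_univ i) (by simp [hi])

/-! ### The symplectic form -/

theorem Pauli.symp_comm (P Q : Pauli n) : P.symp Q = Q.symp P :=
  Finset.sum_congr rfl fun i _ => by ring

theorem Pauli.symp_add_left (P Q R : Pauli n) : (P + Q).symp R = P.symp R + Q.symp R := by
  simp only [Pauli.symp, ← Finset.sum_add_distrib]
  exact Finset.sum_congr rfl fun i _ => by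
    simp only [Pi.add_apply, Prod.fst_add, Prod.snd_add]; ring

theorem Pauli.symp_smul_left (c : ZMod 2) (P R : Pauli n) : (c • P).symp R = c * P.symp R := by
  simp only [Pauli.symp, Finset.mul_sum]
  exact Finset.sum_congr rfl fun i _ => by
    simp only [Pi.smul_apply, Prod.smul_fst, Prod.smul_snd, smul_eq_mul]; ring

theorem Pauli.symp_add_right (P Q R : Pauli n) : P.symp (Q + R) = P.symp Q + P.symp R := by
  rw [symp_comm, symp_add_left, symp_comm Q, symp_comm R]

/-- The commutation bit as a bilinear form over `𝔽₂`. -/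
def sympForm (n : ℕ) : LinearMap.BilinForm (ZMod 2) (Pauli n) :=
  LinearMap.mk₂ (ZMod 2) Pauli.symp Pauli.symp_add_left Pauli.symp_smul_left
    Pauli.symp_add_right (fun c P Q => by
      rw [Pauli.symp_comm, Pauli.symp_smul_left, Pauli.symp_comm Q]; rfl)

@[simp] theorem sympForm_apply (P Q : Pauli n) : sympForm n P Q = P.symp Q := rfl

theorem Pauli.symp_single (P : Pauli n) (i : Fin n) (b : ZMod 2 × ZMod 2) :
    P.symp (Pi.single i b) = (P i).1 * b.2 + (P i).2 * b.1 := by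
  rw [Pauli.symp, Finset.sum_eq_single i]
  · simp
  · intro j _ hj
    simp [Pi.single_eq_of_ne hj]
  · simp

theorem sympForm_isRefl : (sympForm n).IsRefl := fun P Q h => by
  simpa [Pauli.symp_comm Q P] using h

theorem sympForm_nondegenerate : (sympForm n).Nondegenerate := by
  refine (LinearMap.IsRefl.nondegenerate_iff_separatingLeft sympForm_isRefl).mpr ?_
  intro P hP
  funext i
  -- Commutation with Z at qubit i reads off the x-bit of P there, commutation with X the z-bit.
  have h1 := hP (Pi.single i (0, 1))
  have h2 := hP (Pi.single i (1, 0))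
  simp only [sympForm_apply, Pauli.symp_single] at h1 h2
  exact Prod.ext (by simpa using h1) (by simpa using h2)

theorem finrank_pauli : Module.finrank (ZMod 2) (Pauli n) = 2 * n := by
  rw [Module.finrank_pi_fintype]
  simp [mul_comm]

/-- Pauli strings that commute with all elements of a set. -/
def perp (A : Set (Pauli n)) : Submodule (ZMod 2) (Pauli n) where
  carrier := {y | ∀ a ∈ A, a.symp y = 0}
  add_mem' hx hy a ha := by rw [Pauli.symp_add_right, hx a ha, hy a ha, add_zero]
  zero_mem' a _ := (sympForm n a).map_zero
  smul_mem' c x hx a ha := by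
    rw [Pauli.symp_comm, Pauli.symp_smul_left, Pauli.symp_comm, hx a ha, mul_zero]

theorem mem_perp {A : Set (Pauli n)} {y : Pauli n} : y ∈ perp A ↔ ∀ a ∈ A, a.symp y = 0 := Iff.rfl

theorem perp_span (A : Set (Pauli n)) :
    perp (Submodule.span (ZMod 2) A : Set (Pauli n)) = perp A := by
  refine le_antisymm (fun y hy a ha => hy a (Submodule.subset_span ha)) fun y hy a ha => ?_
  have : Submodule.span (ZMod 2) A ≤ perp {y} := by
    refine Submodule.span_le.mpr fun a ha b hb => ?_
    rw [Set.mem_singleton_iff.mp hb, Pauli.symp_comm]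
    exact hy a ha
  rw [Pauli.symp_comm]
  exact this ha y rfl

theorem perp_eq_orthogonal (W : Submodule (ZMod 2) (Pauli n)) :
    perp (W : Set (Pauli n)) = (sympForm n).orthogonal W := by
  ext y; rfl

/-- Double commutant for a nondegenerate form. It allows the pool to be described both by its
generators and by the vectors it commutes with. -/
theorem perp_perp (W : Submodule (ZMod 2) (Pauli n)) :
    perp (perp (W : Set (Pauli n)) : Set (Pauli n)) = W := by
  rw [perp_eq_orthogonal, perp_eq_orthogonal,
    LinearMap.BilinForm.orthogonal_orthogonal sympForm_nondegenerate sympForm_isRefl]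

theorem finrank_perp_add (W : Submodule (ZMod 2) (Pauli n)) :
    Module.finrank (ZMod 2) (perp (W : Set (Pauli n))) + Module.finrank (ZMod 2) W = 2 * n := by
  have h := Submodule.finrank_le W
  rw [perp_eq_orthogonal, LinearMap.BilinForm.finrank_orthogonal sympForm_nondegenerate,
    finrank_pauli]
  rw [finrank_pauli] at h
  omega

theorem perp_anti {A B : Set (Pauli n)} (h : A ⊆ B) : perp B ≤ perp A :=
  fun _ hy a ha => hy a (h ha)

/-! ### Expectation values and the stabilizer group -/

theorem mulVec_mulVec_self (P : Pauli n) (v : Basis n → ℂ) : P.mat *ᵥ (P.mat *ᵥ v) = v := by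
  rw [Matrix.mulVec_mulVec, Pauli.mat_mul_self, Matrix.one_mulVec]

theorem dotProduct_mulVec_conjTranspose (M : Matrix (Basis n) (Basis n) ℂ) (u v : Basis n → ℂ) :
    star (M *ᵥ u) ⬝ᵥ v = star u ⬝ᵥ Mᴴ *ᵥ v := by
  rw [Matrix.star_mulVec, Matrix.dotProduct_mulVec]

/-- The unnormalized expectation value `⟨v|P|v⟩`. -/
def cexpect (v : Basis n → ℂ) (P : Pauli n) : ℂ := star v ⬝ᵥ P.mat *ᵥ v

theorem star_cexpect (v : Basis n → ℂ) (P : Pauli n) : star (cexpect v P) = cexpect v P := by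
  conv_rhs => rw [cexpect, ← Pauli.mat_conjTranspose, ← dotProduct_mulVec_conjTranspose]
  rw [cexpect, Matrix.star_dotProduct, star_star]

theorem cexpect_ofReal_re (v : Basis n → ℂ) (P : Pauli n) :
    ((cexpect v P).re : ℂ) = cexpect v P :=
  Complex.conj_eq_iff_re.mp (star_cexpect v P)

theorem PureState.ofReal_expect (ψ : PureState n) (P : Pauli n) :
    (ψ.expect P : ℂ) = star ψ.vec ⬝ᵥ P.mat *ᵥ ψ.vec :=
  cexpect_ofReal_re ψ.vec P

theorem eigenvalue_eq_one_or {P : Pauli n} {v : Basis n → ℂ} (hv : v ≠ 0) {c : ℂ}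
    (h : P.mat *ᵥ v = c • v) : c = 1 ∨ c = -1 := by
  have h2 := mulVec_mulVec_self P v
  rw [h, Matrix.mulVec_smul, h, smul_smul] at h2
  have h3 : (c * c - 1) • v = 0 := by rw [sub_smul, h2, one_smul, sub_self]
  rcases smul_eq_zero.mp h3 with h4 | h4
  · exact mul_self_eq_one_iff.mp (sub_eq_zero.mp h4)
  · exact absurd h4 hv

/-- The group of Pauli strings that fix `v` up to a sign, as a subspace. -/
def stabSubmodule (v : Basis n → ℂ) : Submodule (ZMod 2) (Pauli n) where
  carrier := {P | P.mat *ᵥ v = v ∨ P.mat *ᵥ v = -v}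
  zero_mem' := by left; rw [Pauli.mat_zero, Matrix.one_mulVec]
  add_mem' := by
    intro P Q hP hQ
    by_cases hv : v = 0
    · left; simp [hv]
    obtain ⟨c, hc⟩ := Pauli.mat_add P Q
    obtain ⟨p, hp⟩ : ∃ p : ℂ, P.mat *ᵥ v = p • v := by
      rcases hP with h | h
      · exact ⟨1, by simp [h]⟩
      · exact ⟨-1, by simp [h]⟩
    obtain ⟨q, hq⟩ : ∃ q : ℂ, Q.mat *ᵥ v = q • v := by
      rcases hQ with h | h
      · exact ⟨1, by simp [h]⟩
      · exact ⟨-1, by simp [h]⟩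
    have h : (P + Q).mat *ᵥ v = (c * q * p) • v := by
      rw [hc, Matrix.smul_mulVec, ← Matrix.mulVec_mulVec, hq, Matrix.mulVec_smul, hp, smul_smul,
        smul_smul, mul_assoc]
    rcases eigenvalue_eq_one_or hv h with h1 | h1
    · left; rw [h, h1, one_smul]
    · right; rw [h, h1, neg_one_smul]
  smul_mem' := by
    intro c P hP
    have : c = 0 ∨ c = 1 := by revert c; decide
    rcases this with rfl | rfl
    · left; rw [zero_smul, Pauli.mat_zero, Matrix.one_mulVec]
    · rwa [one_smul]

theorem mem_stabSubmodule_of_eigen {P : Pauli n} {v : Basis n → ℂ} (hv : v ≠ 0) {c : ℂ}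
    (h : P.mat *ᵥ v = c • v) : P ∈ stabSubmodule v := by
  rcases eigenvalue_eq_one_or hv h with rfl | rfl
  · left; rw [h, one_smul]
  · right; rw [h, neg_one_smul]

theorem mem_stabSubmodule_iff {P : Pauli n} {ψ : PureState n} :
    P ∈ stabSubmodule ψ.vec ↔ P ∈ ψ.stab := Iff.rfl

theorem PureState.expect_eq_of_eigen (ψ : PureState n) {P : Pauli n} {c : ℝ}
    (h : P.mat *ᵥ ψ.vec = (c : ℂ) • ψ.vec) : ψ.expect P = c := by
  have h1 := ψ.ofReal_expect P
  rw [h, dotProduct_smul, show star ψ.vec ⬝ᵥ ψ.vec = 1 from ψ.unit', smul_eq_mul, mul_one] at h1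
  exact_mod_cast h1

/-- Equality case of Cauchy–Schwarz: P preserves the norm, so ‖Pψ - cψ‖² = 1 - 2c² + c², which
vanishes for c² = 1. -/
theorem PureState.eigen_of_expect (ψ : PureState n) {P : Pauli n} {c : ℝ} (hc : c * c = 1)
    (h : ψ.expect P = c) : P.mat *ᵥ ψ.vec = (c : ℂ) • ψ.vec := by
  have hcc : (c : ℂ) * c = 1 := by exact_mod_cast hc
  have h1 : star ψ.vec ⬝ᵥ P.mat *ᵥ ψ.vec = c := by rw [← ψ.ofReal_expect, h]
  have h2 : star ψ.vec ⬝ᵥ ψ.vec = 1 := ψ.unit'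
  have h3 : star (P.mat *ᵥ ψ.vec - (c : ℂ) • ψ.vec) ⬝ᵥ (P.mat *ᵥ ψ.vec - (c : ℂ) • ψ.vec) = 0 := by
    have e1 : star (P.mat *ᵥ ψ.vec) ⬝ᵥ P.mat *ᵥ ψ.vec = 1 := by
      rw [dotProduct_mulVec_conjTranspose, Pauli.mat_conjTranspose, mulVec_mulVec_self, h2]
    have e2 : star (P.mat *ᵥ ψ.vec) ⬝ᵥ ψ.vec = c := by
      rw [dotProduct_mulVec_conjTranspose, Pauli.mat_conjTranspose, h1]
    have e3 : star ((c : ℂ) • ψ.vec) = (c : ℂ) • star ψ.vec := by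
      rw [star_smul]; congr 1; exact Complex.conj_ofReal c
    rw [star_sub, e3]
    simp only [sub_dotProduct, dotProduct_sub, smul_dotProduct, dotProduct_smul, smul_eq_mul,
      e1, e2, h1, h2]
    linear_combination (-1 : ℂ) * hcc
  have h4 : ∑ a, ‖(P.mat *ᵥ ψ.vec - (c : ℂ) • ψ.vec) a‖ ^ 2 = 0 := by
    have : ((∑ a, ‖(P.mat *ᵥ ψ.vec - (c : ℂ) • ψ.vec) a‖ ^ 2 : ℝ) : ℂ) = ((0 : ℝ) : ℂ) := by
      push_cast
      rw [← h3]
      exact Finset.sum_congr rfl fun a _ => (Complex.conj_mul' _).symm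
    exact_mod_cast this
  funext a
  have h5 := (Finset.sum_eq_zero_iff_of_nonneg (fun a _ => by positivity)).mp h4 a
    (Finset.mem_univ a)
  simpa [sub_eq_zero] using h5

theorem PureState.mem_stab_iff (ψ : PureState n) (P : Pauli n) :
    P ∈ ψ.stab ↔ ψ.expect P = 1 ∨ ψ.expect P = -1 := by
  constructor
  · rintro (h | h)
    · left; exact ψ.expect_eq_of_eigen (by simp [h])
    · right; exact ψ.expect_eq_of_eigen (by simp [h])
  · rintro (h | h)
    · left; simpa using ψ.eigen_of_expect (by norm_num) h
    · right; simpa using ψ.eigen_of_expect (by norm_num) h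

theorem PureState.eigen_of_mem_stab (ψ : PureState n) {P : Pauli n} (h : P ∈ ψ.stab) :
    P.mat *ᵥ ψ.vec = (ψ.expect P : ℂ) • ψ.vec :=
  ψ.eigen_of_expect (by rcases (ψ.mem_stab_iff P).mp h with h | h <;> rw [h] <;> norm_num) rfl

theorem PureState.expect_sq_of_mem_stab (ψ : PureState n) {P : Pauli n} (h : P ∈ ψ.stab) :
    ψ.expect P ^ 2 = 1 := by
  rcases (ψ.mem_stab_iff P).mp h with h | h <;> rw [h] <;> norm_num

theorem bitSign_eq_one_iff (x : ZMod 2) : bitSign x = 1 ↔ x = 0 := by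
  unfold bitSign; split_ifs with h <;> simp [h]; norm_num

/-- A Pauli string with nonzero expectation commutes with the stabilizer group. -/
theorem PureState.symp_eq_zero (ψ : PureState n) {P g : Pauli n} (hP : ψ.expect P ≠ 0)
    (hg : g ∈ ψ.stab) : g.symp P = 0 := by
  -- The expectation of gPg is evaluated twice: the eigenvector equation of g gives ⟨P⟩, the
  -- commutation relation gives ±⟨P⟩. As ⟨P⟩ ≠ 0, the sign is +1.
  have h : star ψ.vec ⬝ᵥ (g.mat * P.mat * g.mat) *ᵥ ψ.vec = ψ.expect P := by
    have e := ψ.eigen_of_mem_stab hg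
    have e2 : (ψ.expect g : ℂ) ^ 2 = 1 := by exact_mod_cast ψ.expect_sq_of_mem_stab hg
    rw [← Matrix.mulVec_mulVec, e, Matrix.mulVec_smul, ← Matrix.mulVec_mulVec, dotProduct_smul]
    have e3 : star ψ.vec ⬝ᵥ g.mat *ᵥ (P.mat *ᵥ ψ.vec) = ψ.expect g * ψ.expect P := by
      rw [← Pauli.mat_conjTranspose, ← dotProduct_mulVec_conjTranspose, e, star_smul,
        smul_dotProduct, ← ψ.ofReal_expect]
      congr 1
      exact Complex.conj_ofReal _
    rw [e3, smul_eq_mul]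
    linear_combination (ψ.expect P : ℂ) * e2
  rw [Pauli.mat_conj, Matrix.smul_mulVec, dotProduct_smul, ← ψ.ofReal_expect, smul_eq_mul] at h
  have h1 : bitSign (P.symp g) * ψ.expect P = 1 * ψ.expect P := by
    rw [one_mul]; exact_mod_cast h
  rw [Pauli.symp_comm, ← bitSign_eq_one_iff]
  exact mul_right_cancel₀ hP h1

/-- The stabilizer group is isotropic, since its elements have expectation ±1 and so commute with
one another. -/
theorem PureState.stab_le_perp (ψ : PureState n) : stabSubmodule ψ.vec ≤ perp ψ.stab :=
  fun P hP g hg => ψ.symp_eq_zero (by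
    have := ψ.expect_sq_of_mem_stab hP
    intro h; norm_num [h] at this) hg

/-! ### Bell samples -/

/-- Parseval's identity: up to the factor 2^n the Pauli matrices are an orthonormal basis, and
`mat_complete` collapses the double sum to its diagonal. -/
theorem sum_star_dotProduct_mul (u v u' v' : Basis n → ℂ) :
    ∑ P : Pauli n, star (star u ⬝ᵥ P.mat *ᵥ v) * (star u' ⬝ᵥ P.mat *ᵥ v') =
      2 ^ n * ((star u' ⬝ᵥ u) * (star v ⬝ᵥ v')) := by
  have e : ∀ (P : Pauli n) (u v : Basis n → ℂ), star u ⬝ᵥ P.mat *ᵥ v =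
      ∑ x : Basis n × Basis n, star (u x.1) * v x.2 * P.mat x.1 x.2 := by
    intro P u v
    simp only [dotProduct, Matrix.mulVec, Fintype.sum_prod_type, Finset.mul_sum, Pi.star_apply]
    refine Finset.sum_congr rfl fun a _ => Finset.sum_congr rfl fun b _ => ?_
    ring
  have e1 : ∀ P : Pauli n, star (star u ⬝ᵥ P.mat *ᵥ v) * (star u' ⬝ᵥ P.mat *ᵥ v') =
      ∑ x : Basis n × Basis n, ∑ y : Basis n × Basis n,
        (u x.1 * star (v x.2)) * (star (u' y.1) * v' y.2) *
        (star (P.mat x.1 x.2) * P.mat y.1 y.2) := by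
    intro P
    rw [e, e, star_sum, Finset.sum_mul_sum]
    refine Finset.sum_congr rfl fun a _ => Finset.sum_congr rfl fun b _ => ?_
    simp only [star_mul', star_star]
    ring
  simp only [e1]
  rw [Finset.sum_comm]
  have e2 : ∀ x : Basis n × Basis n, ∑ P : Pauli n, ∑ y : Basis n × Basis n,
      (u x.1 * star (v x.2)) * (star (u' y.1) * v' y.2) * (star (P.mat x.1 x.2) * P.mat y.1 y.2) =
      (u x.1 * star (v x.2)) * (star (u' x.1) * v' x.2) * 2 ^ n := by
    intro x
    rw [Finset.sum_comm]
    simp only [← Finset.mul_sum, mat_complete]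
    rw [Finset.sum_eq_single x]
    · simp
    · intro y _ hy
      rw [if_neg, mul_zero]
      rintro ⟨h1, h2⟩
      exact hy (Prod.ext h1.symm h2.symm)
    · simp
  simp only [e2, ← Finset.sum_mul]
  rw [mul_comm, dotProduct, dotProduct, Finset.sum_mul_sum, Fintype.sum_prod_type]
  congr 1
  refine Finset.sum_congr rfl fun a _ => Finset.sum_congr rfl fun b _ => ?_
  simp only [Pi.star_apply]
  ring

/-- The symplectic Fourier transform of the Bell distribution. -/
theorem PureState.sum_xiTilde_bitSign (ψ : PureState n) (Q : Pauli n) :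
    ∑ P, ψ.xiTilde P * bitSign (P.symp Q) =
      bitSign (∑ i, (Q i).1 * (Q i).2) * ψ.expect Q ^ 2 := by
  -- The sign is absorbed by conjugating P with Q, so the sum becomes a Parseval sum for the pairs
  -- (ψ, ψ*) and (Qψ, Qψ*).
  have key : ∀ P : Pauli n, ((ψ.xiTilde P * bitSign (P.symp Q) : ℝ) : ℂ) =
      (2 ^ n)⁻¹ * (star (star ψ.vec ⬝ᵥ P.mat *ᵥ star ψ.vec) *
        (star (Q.mat *ᵥ ψ.vec) ⬝ᵥ P.mat *ᵥ (Q.mat *ᵥ star ψ.vec))) := by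
    intro P
    have h1 : star (Q.mat *ᵥ ψ.vec) ⬝ᵥ P.mat *ᵥ (Q.mat *ᵥ star ψ.vec) =
        bitSign (P.symp Q) * (star ψ.vec ⬝ᵥ P.mat *ᵥ star ψ.vec) := by
      rw [dotProduct_mulVec_conjTranspose, Pauli.mat_conjTranspose, Matrix.mulVec_mulVec,
        Matrix.mulVec_mulVec, Pauli.mat_conj, Matrix.smul_mulVec, dotProduct_smul, smul_eq_mul]
    rw [h1, PureState.xiTilde]
    have h2 : star (star ψ.vec ⬝ᵥ P.mat *ᵥ star ψ.vec) * (star ψ.vec ⬝ᵥ P.mat *ᵥ star ψ.vec) =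
        (‖star ψ.vec ⬝ᵥ P.mat *ᵥ star ψ.vec‖ : ℂ) ^ 2 := Complex.conj_mul' _
    push_cast
    rw [← h2]
    ring
  have h3 : star (Q.mat *ᵥ ψ.vec) ⬝ᵥ ψ.vec = ψ.expect Q := by
    rw [dotProduct_mulVec_conjTranspose, Pauli.mat_conjTranspose, ψ.ofReal_expect]
  -- The expectation in ψ* is that of the transpose in ψ; this is where the sign of the transform
  -- comes from.
  have h4 : star (star ψ.vec) ⬝ᵥ Q.mat *ᵥ star ψ.vec =
      bitSign (∑ i, (Q i).1 * (Q i).2) * ψ.expect Q := by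
    rw [star_star, Matrix.dotProduct_mulVec, ← Matrix.mulVec_transpose, Pauli.mat_transpose,
      dotProduct_comm, Matrix.smul_mulVec, dotProduct_smul, ← ψ.ofReal_expect, smul_eq_mul]
  have h5 : ((∑ P, ψ.xiTilde P * bitSign (P.symp Q) : ℝ) : ℂ) =
      ((bitSign (∑ i, (Q i).1 * (Q i).2) * ψ.expect Q ^ 2 : ℝ) : ℂ) := by
    rw [Complex.ofReal_sum]
    simp only [key]
    rw [← Finset.mul_sum, sum_star_dotProduct_mul, h3, h4]
    push_cast
    field_simp
  exact_mod_cast h5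

theorem PureState.xiTilde_nonneg (ψ : PureState n) (P : Pauli n) : 0 ≤ ψ.xiTilde P := by
  unfold PureState.xiTilde; positivity

theorem PureState.bell_apply (ψ : PureState n) (P : Pauli n) :
    ψ.bell P = ENNReal.ofReal (ψ.xiTilde P) := rfl

theorem bitSign_le_one (x : ZMod 2) : bitSign x ≤ 1 := by
  unfold bitSign; split_ifs <;> norm_num

/-- Two Bell samples have the same commutation bit with a stabilizer element. -/
theorem PureState.symp_eq_of_mem_bell_support (ψ : PureState n) {P P' Q : Pauli n}
    (hP : P ∈ ψ.bell.support) (hP' : P' ∈ ψ.bell.support) (hQ : Q ∈ ψ.stab) :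
    P.symp Q = P'.symp Q := by
  set τ := bitSign (∑ i, (Q i).1 * (Q i).2) with hτ
  have hττ : τ * τ = 1 := bitSign_mul_self _
  -- A nonnegative quantity with mean zero vanishes on the support, so every sample has the
  -- commutation sign τ with Q.
  have h0 : ∑ R, ψ.xiTilde R * (1 - τ * bitSign (R.symp Q)) = 0 := by
    have h1 := ψ.sum_xiTilde_bitSign Q
    rw [ψ.expect_sq_of_mem_stab hQ, mul_one, ← hτ] at h1
    have : ∑ R, ψ.xiTilde R * (1 - τ * bitSign (R.symp Q)) =
        ∑ R, ψ.xiTilde R - τ * ∑ R, ψ.xiTilde R * bitSign (R.symp Q) := by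
      rw [Finset.mul_sum, ← Finset.sum_sub_distrib]
      exact Finset.sum_congr rfl fun R _ => by ring
    rw [this, h1, sum_xiTilde, hττ, sub_self]
  have h2 : ∀ R ∈ ψ.bell.support, bitSign (R.symp Q) = τ := by
    intro R hR
    have h3 := (Finset.sum_eq_zero_iff_of_nonneg (fun R _ => mul_nonneg (ψ.xiTilde_nonneg R) (by
      have : τ * bitSign (R.symp Q) ≤ 1 := by
        rw [hτ, ← bitSign_add]; exact bitSign_le_one _
      linarith))).mp h0 R (Finset.mem_univ R)
    have h4 : ψ.xiTilde R ≠ 0 := fun h => by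
      rw [PMF.mem_support_iff, ψ.bell_apply, h, ENNReal.ofReal_zero] at hR
      exact hR rfl
    have h5 := (mul_eq_zero.mp h3).resolve_left h4
    linear_combination (-τ) * h5 + (-bitSign (R.symp Q)) * hττ
  have h6 : bitSign (P.symp Q + P'.symp Q) = 1 := by
    rw [bitSign_add, h2 P hP, h2 P' hP', hττ]
  exact CharTwo.add_eq_zero.mp ((bitSign_eq_one_iff _).mp h6)

/-- The probability that a Bell sample, shifted by `R`, commutes with `Q`. -/
theorem PureState.sum_xiTilde_commuting_le (ψ : PureState n) (R Q : Pauli n) :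
    ∑ P, ψ.xiTilde P * (if (P + R).symp Q = 0 then 1 else 0) ≤ (1 + ψ.expect Q ^ 2) / 2 := by
  -- The indicator of commutation is (1 + sign)/2, and the sign splits into the part of R, which is
  -- constant, and the part of P.
  have h : ∀ P : Pauli n, (if (P + R).symp Q = 0 then (1 : ℝ) else 0) =
      (1 + bitSign (R.symp Q) * bitSign (P.symp Q)) / 2 := by
    intro P
    rw [mul_comm, ← bitSign_add, ← Pauli.symp_add_left]
    unfold bitSign
    split_ifs <;> norm_num
  simp only [h]
  have e : ∑ P, ψ.xiTilde P * ((1 + bitSign (R.symp Q) * bitSign (P.symp Q)) / 2) =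
      (∑ P, ψ.xiTilde P + bitSign (R.symp Q) * ∑ P, ψ.xiTilde P * bitSign (P.symp Q)) / 2 := by
    rw [Finset.mul_sum, ← Finset.sum_add_distrib, Finset.sum_div]
    exact Finset.sum_congr rfl fun R _ => by ring
  rw [e, sum_xiTilde, ψ.sum_xiTilde_bitSign, ← mul_assoc, ← bitSign_add]
  have := mul_le_mul_of_nonneg_right
    (bitSign_le_one (R.symp Q + ∑ i, (Q i).1 * (Q i).2)) (sq_nonneg (ψ.expect Q))
  linarith

/-! ### Expectation values and stabilizer dimension of doped states -/

/-- All expectation values are `(a + b√2)/√2^t` with integers `a`, `b` of size at most `2^t`. -/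
def HasSqrtTwoValues (t : ℕ) (v : Basis n → ℂ) : Prop :=
  ∀ P : Pauli n, ∃ a b : ℤ, |a| ≤ 2 ^ t ∧ |b| ≤ 2 ^ t ∧
    (cexpect v P).re = (a + b * Real.sqrt 2) / Real.sqrt 2 ^ t

theorem cexpect_mulVec (M : Matrix (Basis n) (Basis n) ℂ) (v : Basis n → ℂ) (P : Pauli n) :
    cexpect (M *ᵥ v) P = star v ⬝ᵥ (Mᴴ * P.mat * M) *ᵥ v := by
  rw [cexpect, dotProduct_mulVec_conjTranspose, Matrix.mulVec_mulVec, Matrix.mulVec_mulVec,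
    mul_assoc]

/-- A Clifford gate carries the value at P to i^k times the value at another string. For odd k the
real part is zero and the numerators are 0, 0; for k = 2 they change sign. -/
theorem HasSqrtTwoValues.clifford {t : ℕ} {v : Basis n → ℂ} (hv : HasSqrtTwoValues t v)
    {C : Matrix (Basis n) (Basis n) ℂ} (hC : IsClifford C) : HasSqrtTwoValues t (C *ᵥ v) := by
  intro P
  obtain ⟨Q, k, hQ⟩ := hC.2 P
  obtain ⟨a, b, ha, hb, hab⟩ := hv Q
  have h : cexpect (C *ᵥ v) P = Complex.I ^ (k : ℕ) * ((cexpect v Q).re : ℂ) := by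
    rw [cexpect_mulVec, hQ, Matrix.smul_mulVec, dotProduct_smul, cexpect_ofReal_re, smul_eq_mul,
      cexpect]
  rw [hab] at h
  rw [h]
  fin_cases k
  · refine ⟨a, b, ha, hb, ?_⟩
    simp only [pow_zero, one_mul, Complex.ofReal_re]
  · refine ⟨0, 0, by simp, by simp, ?_⟩
    simp only [pow_one, Complex.re_mul_ofReal, Complex.I_re]
    simp
  · refine ⟨-a, -b, by rwa [abs_neg], by rwa [abs_neg], ?_⟩
    simp only [Complex.I_sq, Complex.re_mul_ofReal]
    simp
    ring
  · refine ⟨0, 0, by simp, by simp, ?_⟩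
    simp only [Complex.I_pow_three, Complex.re_mul_ofReal]
    simp

/-! ### Conjugation of Pauli matrices by the T gate -/

/-- The phase of the gate `T` on a basis label. -/
noncomputable def tPhase (x : Fin 2) : ℂ :=
  if x = 1 then Complex.exp (Complex.I * (Real.pi / 4)) else 1

theorem exp_I_pi_div_four : Complex.exp (Complex.I * (Real.pi / 4)) =
    ((Real.sqrt 2 / 2 : ℝ) : ℂ) + ((Real.sqrt 2 / 2 : ℝ) : ℂ) * Complex.I := by
  rw [mul_comm, show ((Real.pi : ℂ) / 4) = ((Real.pi / 4 : ℝ) : ℂ) by push_cast; rfl,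
    Complex.exp_mul_I, ← Complex.ofReal_cos, ← Complex.ofReal_sin, Real.cos_pi_div_four,
    Real.sin_pi_div_four]

theorem star_exp_I_pi_div_four : (starRingEnd ℂ) (Complex.exp (Complex.I * (Real.pi / 4))) =
    ((Real.sqrt 2 / 2 : ℝ) : ℂ) - ((Real.sqrt 2 / 2 : ℝ) : ℂ) * Complex.I := by
  rw [exp_I_pi_div_four]
  simp only [map_add, map_mul, Complex.conj_ofReal, Complex.conj_I]
  ring

theorem half_sqrt_two_sq : ((Real.sqrt 2 / 2 : ℝ) : ℂ) * ((Real.sqrt 2 / 2 : ℝ) : ℂ) = 1 / 2 := by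
  rw [← Complex.ofReal_mul, div_mul_div_comm, Real.mul_self_sqrt (by norm_num)]
  norm_num

theorem star_tPhase_mul (x : Fin 2) : star (tPhase x) * tPhase x = 1 := by
  unfold tPhase
  split_ifs
  · rw [Complex.star_def, star_exp_I_pi_div_four, exp_I_pi_div_four]
    linear_combination (1 - Complex.I * Complex.I) * half_sqrt_two_sq - 1 / 2 * Complex.I_mul_I
  · simp

theorem tPhase_conj_diag (z : ZMod 2) (a b : Fin 2) :
    star (tPhase a) * sigma (0, z) a b * tPhase b = sigma (0, z) a b := by
  by_cases h : a = b
  · subst h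
    linear_combination sigma (0, z) a a * star_tPhase_mul a
  · have : sigma (0, z) a b = 0 := by
      have hz : z = 0 ∨ z = 1 := by revert z; decide
      rcases hz with rfl | rfl <;> fin_cases a <;> fin_cases b <;> simp_all [sigma]
    rw [this, mul_zero, zero_mul]

/-- T is a rotation by 45 degrees about the Z axis: T†XT = (X-Y)/√2 and T†YT = (X+Y)/√2. -/
theorem tPhase_conj_offdiag (z : ZMod 2) (a b : Fin 2) :
    star (tPhase a) * sigma (1, z) a b * tPhase b =
      ((Real.sqrt 2 / 2 : ℝ) : ℂ) * (sigma (1, z) a b - bitSign z * sigma (1, z + 1) a b) := by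
  have h11 : (1 : ZMod 2) + 1 = 0 := rfl
  have hz : z = 0 ∨ z = 1 := by revert z; decide
  rcases hz with rfl | rfl <;> fin_cases a <;> fin_cases b <;>
    simp [sigma, tPhase, bitSign, h11, exp_I_pi_div_four] <;>
    first
    | ring1
    | linear_combination (Real.sqrt 2 / 2 : ℂ) * Complex.I_mul_I
    | linear_combination (-Real.sqrt 2 / 2 : ℂ) * Complex.I_mul_I

theorem tGate_eq (q : Fin n) : tGate q = Matrix.diagonal fun a : Basis n => tPhase (a q) := rfl

theorem tGate_conj_apply (q : Fin n) (P : Pauli n) (a b : Basis n) :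
    ((tGate q)ᴴ * P.mat * tGate q) a b =
      star (tPhase (a q)) * sigma (P q) (a q) (b q) * tPhase (b q) *
        ∏ i ∈ Finset.univ.erase q, sigma (P i) (a i) (b i) := by
  rw [tGate_eq, Matrix.mul_diagonal, Matrix.diagonal_conjTranspose, Matrix.diagonal_mul,
    Pauli.mat, Matrix.of_apply, ← Finset.mul_prod_erase _ _ (Finset.mem_univ q), Pi.star_apply]
  ring

theorem Pauli.mat_apply_erase (q : Fin n) (P : Pauli n) (a b : Basis n) :
    P.mat a b = sigma (P q) (a q) (b q) *
        ∏ i ∈ Finset.univ.erase q, sigma (P i) (a i) (b i) := by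
  rw [Pauli.mat, Matrix.of_apply, ← Finset.mul_prod_erase _ _ (Finset.mem_univ q)]

theorem tGate_conj_of_fst_eq_zero {q : Fin n} {P : Pauli n} (h : (P q).1 = 0) :
    (tGate q)ᴴ * P.mat * tGate q = P.mat := by
  ext a b
  have hP : P q = (0, (P q).2) := Prod.ext h rfl
  rw [tGate_conj_apply, P.mat_apply_erase q, hP, tPhase_conj_diag]

theorem tGate_conj_of_fst_eq_one {q : Fin n} {P : Pauli n} (h : (P q).1 = 1) :
    (tGate q)ᴴ * P.mat * tGate q = ((Real.sqrt 2 / 2 : ℝ) : ℂ) •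
      (P.mat - (bitSign (P q).2 : ℂ) • (P + Pi.single q (0, 1)).mat) := by
  ext a b
  have hP : P q = (1, (P q).2) := Prod.ext h rfl
  have h1 : ∏ i ∈ Finset.univ.erase q, sigma ((P + Pi.single q (0, 1) : Pauli n) i) (a i) (b i) =
      ∏ i ∈ Finset.univ.erase q, sigma (P i) (a i) (b i) := by
    refine Finset.prod_congr rfl fun i hi => ?_
    rw [Pi.add_apply, Pi.single_eq_of_ne (Finset.ne_of_mem_erase hi), add_zero]
  have h2 : (P + Pi.single q (0, 1) : Pauli n) q = (1, (P q).2 + 1) := by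
    rw [Pi.add_apply, Pi.single_eq_same, hP]
    simp
  generalize (P + Pi.single q (0, 1) : Pauli n) = P' at h1 h2
  rw [tGate_conj_apply, Matrix.smul_apply, Matrix.sub_apply, Matrix.smul_apply,
    P.mat_apply_erase q, P'.mat_apply_erase q, h1, h2, hP,
    tPhase_conj_offdiag]
  simp only [smul_eq_mul]
  ring

/-- If P has no x-bit at q its value is unchanged and merely rewritten over the larger denominator.
Otherwise the rotation gives a sum or difference of two old values over √2, which at most doubles
the numerators. -/
theorem HasSqrtTwoValues.tGate {t : ℕ} {v : Basis n → ℂ} (hv : HasSqrtTwoValues t v)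
    (q : Fin n) : HasSqrtTwoValues (t + 1) (TDoped.tGate q *ᵥ v) := by
  intro P
  have hs : Real.sqrt 2 * Real.sqrt 2 = 2 := Real.mul_self_sqrt (by norm_num)
  have hs0 : Real.sqrt 2 ≠ 0 := by positivity
  obtain ⟨a, b, ha, hb, hab⟩ := hv P
  have hx : (P q).1 = 0 ∨ (P q).1 = 1 := by
    generalize (P q).1 = x; revert x; decide
  rcases hx with hx | hx
  -- (a + b√2)·√2 = 2b + a√2.
  · refine ⟨2 * b, a, ?_, ?_, ?_⟩
    · rw [abs_mul, pow_succ]; norm_num; linarith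
    · rw [pow_succ]; linarith [abs_nonneg a]
    · rw [cexpect_mulVec, tGate_conj_of_fst_eq_zero hx, ← cexpect, hab, pow_succ]
      push_cast
      field_simp
      linear_combination (b : ℝ) * hs
  · obtain ⟨a', b', ha', hb', hab'⟩ := hv (P + Pi.single q (0, 1))
    have hval : (cexpect (TDoped.tGate q *ᵥ v) P).re = Real.sqrt 2 / 2 * ((cexpect v P).re -
        bitSign (P q).2 * (cexpect v (P + Pi.single q (0, 1))).re) := by
      rw [cexpect_mulVec, tGate_conj_of_fst_eq_one hx, Matrix.smul_mulVec, Matrix.sub_mulVec,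
        Matrix.smul_mulVec, dotProduct_smul, dotProduct_sub, dotProduct_smul, ← cexpect, ← cexpect,
        smul_eq_mul, smul_eq_mul, Complex.re_ofReal_mul, Complex.sub_re, Complex.re_ofReal_mul]
    obtain ⟨e, he, hee⟩ : ∃ e : ℤ, (e = 1 ∨ e = -1) ∧ (e : ℝ) = bitSign (P q).2 := by
      unfold bitSign
      split_ifs
      · exact ⟨1, by simp⟩
      · exact ⟨-1, by simp⟩
    refine ⟨a - e * a', b - e * b', ?_, ?_, ?_⟩
    · rw [pow_succ]
      rw [abs_le] at *
      rcases he with rfl | rfl <;> constructor <;> linarith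
    · rw [pow_succ]
      rw [abs_le] at *
      rcases he with rfl | rfl <;> constructor <;> linarith
    · rw [hval, hab, hab', ← hee, pow_succ]
      push_cast
      field_simp
      linear_combination ((a : ℝ) + b * Real.sqrt 2 - e * (a' + b' * Real.sqrt 2)) * hs

/-! ### The initial state and the stabilizer dimension along a circuit -/

/-- The all-zero basis vector. -/
def zeroVec (n : ℕ) : Basis n → ℂ := Pi.single (fun _ => 0) 1

theorem mulVec_zeroVec (P : Pauli n) (a : Basis n) :
    (P.mat *ᵥ zeroVec n) a = ∏ i, sigma (P i) (a i) 0 := by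
  rw [zeroVec, Matrix.mulVec_single_one]
  rfl

theorem hasSqrtTwoValues_zeroVec : HasSqrtTwoValues 0 (zeroVec n) := by
  intro P
  have h : cexpect (zeroVec n) P = ∏ i, sigma (P i) 0 0 := by
    have hs : star (zeroVec n) = Pi.single (fun _ => 0) 1 := by
      rw [zeroVec, ← Pi.single_star, star_one]
    rw [cexpect, hs, single_dotProduct, one_mul, mulVec_zeroVec]
  have h1 : (∏ i, sigma (P i) 0 0 = 0) ∨ (∏ i, sigma (P i) 0 0 = 1) := by
    have h2 : ∀ p : ZMod 2 × ZMod 2, sigma p 0 0 = 0 ∨ sigma p 0 0 = 1 := by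
      intro p
      unfold sigma
      split_ifs <;> simp
    by_cases h3 : ∃ i, sigma (P i) 0 0 = 0
    · obtain ⟨i, hi⟩ := h3
      exact Or.inl (Finset.prod_eq_zero (Finset.mem_univ i) hi)
    · push Not at h3
      exact Or.inr (Finset.prod_eq_one fun i _ => (h2 _).resolve_left (h3 i))
  rw [h]
  rcases h1 with h1 | h1
  · exact ⟨0, 0, by simp, by simp, by simp [h1]⟩
  · exact ⟨1, 0, by simp, by simp, by simp [h1]⟩

/-- Products of Z matrices fix the all-zero vector. They form the commutant of the n single-qubit
Z's, so by duality their dimension is at least 2n - n. -/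
theorem finrank_stab_zeroVec : n ≤ Module.finrank (ZMod 2) (stabSubmodule (zeroVec n)) := by
  set W : Submodule (ZMod 2) (Pauli n) := Submodule.span (ZMod 2)
    (Set.range fun i : Fin n => (Pi.single i (0, 1) : Pauli n)) with hW
  have h1 : Module.finrank (ZMod 2) W ≤ n := by
    have := finrank_range_le_card (R := ZMod 2) fun i : Fin n => (Pi.single i (0, 1) : Pauli n)
    simpa [Set.finrank] using this
  have h2 := finrank_perp_add W
  have h3 : perp (W : Set (Pauli n)) ≤ stabSubmodule (zeroVec n) := by
    intro P hP
    have h4 : ∀ i, (P i).1 = 0 := by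
      intro i
      have := hP _ (Submodule.subset_span ⟨i, rfl⟩)
      rw [Pauli.symp_comm, Pauli.symp_single] at this
      simpa using this
    left
    funext a
    rw [mulVec_zeroVec]
    have h5 : ∀ i, sigma (P i) (a i) 0 = if a i = 0 then 1 else 0 := by
      intro i
      rw [sigma, if_pos (h4 i)]
      generalize a i = x
      split_ifs with h6 h7 h7 <;> fin_cases x <;> simp_all
    simp only [h5, zeroVec, Pi.single_apply]
    split_ifs with h6
    · exact Finset.prod_eq_one fun i _ => by simp [h6]
    · obtain ⟨i, hi⟩ := Function.ne_iff.mp h6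
      exact Finset.prod_eq_zero (Finset.mem_univ i) (by simpa using hi)
  have h5 := Submodule.finrank_mono h3
  omega

/-- Stabilizer elements without x-bit at q commute with the gate and survive. That is one linear
condition, namely commutation with Z at q, so at most one dimension is lost. -/
theorem finrank_stab_tGate (q : Fin n) (v : Basis n → ℂ) :
    Module.finrank (ZMod 2) (stabSubmodule v) ≤
      Module.finrank (ZMod 2) (stabSubmodule (tGate q *ᵥ v)) + 1 := by
  set W : Submodule (ZMod 2) (Pauli n) :=
    Submodule.span (ZMod 2) {(Pi.single q (0, 1) : Pauli n)} with hW
  have h1 : Module.finrank (ZMod 2) W ≤ 1 := (finrank_span_le_card _).trans (by simp)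
  have h2 := finrank_perp_add W
  have h3 : stabSubmodule v ⊓ perp (W : Set (Pauli n)) ≤ stabSubmodule (tGate q *ᵥ v) := by
    rintro P ⟨hP, hPW⟩
    have h4 : (P q).1 = 0 := by
      have := hPW _ (Submodule.subset_span rfl)
      rw [Pauli.symp_comm, Pauli.symp_single] at this
      simpa using this
    have hT : tGate q * (tGate q)ᴴ = (1 : Matrix (Basis n) (Basis n) ℂ) := by
      rw [tGate_eq, Matrix.diagonal_conjTranspose, Matrix.diagonal_mul_diagonal,
        ← Matrix.diagonal_one]
      congr 1
      funext a
      rw [Pi.star_apply, mul_comm, star_tPhase_mul]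
    have h5 : P.mat * tGate q = tGate q * P.mat := by
      conv_rhs => rw [← tGate_conj_of_fst_eq_zero h4]
      rw [← mul_assoc, ← mul_assoc, hT, one_mul]
    have h6 : P.mat *ᵥ (tGate q *ᵥ v) = tGate q *ᵥ (P.mat *ᵥ v) := by
      rw [Matrix.mulVec_mulVec, h5, Matrix.mulVec_mulVec]
    rcases hP with hP | hP
    · left; rw [h6, hP]
    · right; rw [h6, hP, Matrix.mulVec_neg]
  have h5 := Submodule.finrank_mono h3
  have h6 := Submodule.finrank_sup_add_finrank_inf_eq (stabSubmodule v) (perp (W : Set (Pauli n)))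
  have h7 := Submodule.finrank_le (stabSubmodule v ⊔ perp (W : Set (Pauli n)))
  rw [finrank_pauli] at h7
  omega

/-- The commutation signs do not see scalar factors, and they determine the label because the
symplectic form is nondegenerate. -/
theorem Pauli.eq_of_mat_eq_smul {P Q : Pauli n} {c : ℂ} (h : P.mat = c • Q.mat) : P = Q := by
  have hmul : ∀ R : Pauli n, P.symp R = Q.symp R := by
    intro R
    have h1 := Pauli.mat_conj P R
    have h2 := Pauli.mat_conj Q R
    rw [h, mul_smul_comm, smul_mul_assoc, h2, smul_comm] at h1
    have h3 : ((bitSign (Q.symp R) : ℂ) - bitSign (P.symp R)) • P.mat = 0 := by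
      rw [h, sub_smul, h1, sub_self]
    have h4 : P.mat ≠ 0 := fun h0 => by
      have := Pauli.mat_mul_self P
      rw [h0, zero_mul] at this
      exact one_ne_zero this.symm
    have h5 := sub_eq_zero.mp ((smul_eq_zero.mp h3).resolve_right h4)
    have h6 : bitSign (Q.symp R) = bitSign (P.symp R) := by exact_mod_cast h5
    have h7 : bitSign (P.symp R + Q.symp R) = 1 := by rw [bitSign_add, h6, bitSign_mul_self]
    exact CharTwo.add_eq_zero.mp ((bitSign_eq_one_iff _).mp h7)
  funext i
  have h1 := hmul (Pi.single i (0, 1))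
  have h2 := hmul (Pi.single i (1, 0))
  simp only [Pauli.symp_single] at h1 h2
  exact Prod.ext (by simpa using h1) (by simpa using h2)

/-- Conjugation permutes the labels: it is injective on a finite set. Its inverse maps one
stabilizer group injectively into the other. Counting elements instead of comparing bases makes
linearity of the permutation unnecessary. -/
theorem finrank_stab_clifford {C : Matrix (Basis n) (Basis n) ℂ} (hC : IsClifford C)
    {v : Basis n → ℂ} (hv : v ≠ 0) :
    Module.finrank (ZMod 2) (stabSubmodule v) ≤
      Module.finrank (ZMod 2) (stabSubmodule (C *ᵥ v)) := by
  have hCC : C * Cᴴ = 1 := Matrix.mem_unitaryGroup_iff.mp hC.1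
  have hCC' : Cᴴ * C = 1 := Matrix.mem_unitaryGroup_iff'.mp hC.1
  choose f k hf using hC.2
  have hmat : ∀ P, P.mat = (Complex.I ^ (k P : ℕ)) • (C * (f P).mat * Cᴴ) := by
    intro P
    have : C * (Cᴴ * P.mat * C) * Cᴴ = P.mat := by
      calc C * (Cᴴ * P.mat * C) * Cᴴ = (C * Cᴴ) * P.mat * (C * Cᴴ) := by simp only [mul_assoc]
        _ = P.mat := by rw [hCC, one_mul, mul_one]
    rw [← this, hf, mul_smul_comm, smul_mul_assoc]
  have hinj : Function.Injective f := by
    intro P Q hPQ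
    apply Pauli.eq_of_mat_eq_smul (c := Complex.I ^ (k P : ℕ) * (Complex.I ^ (k Q : ℕ))⁻¹)
    conv_lhs => rw [hmat P, hPQ]
    conv_rhs => rw [hmat Q]
    rw [smul_smul, inv_mul_cancel_right₀ (pow_ne_zero _ Complex.I_ne_zero)]
  have hsurj : Function.Surjective f := Finite.injective_iff_surjective.mp hinj
  have hCv : C *ᵥ v ≠ 0 := fun h => hv (by
    rw [← Matrix.one_mulVec v, ← hCC', ← Matrix.mulVec_mulVec, h, Matrix.mulVec_zero])
  choose g hg using hsurj
  have hmem : ∀ Q ∈ stabSubmodule v, g Q ∈ stabSubmodule (C *ᵥ v) := by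
    intro Q hQ
    obtain ⟨c, hc⟩ : ∃ c : ℂ, Q.mat *ᵥ v = c • v := by
      rcases hQ with h | h
      · exact ⟨1, by simp [h]⟩
      · exact ⟨-1, by simp [h]⟩
    apply mem_stabSubmodule_of_eigen hCv (c := Complex.I ^ (k (g Q) : ℕ) * c)
    rw [hmat (g Q), hg, Matrix.smul_mulVec, Matrix.mulVec_mulVec, mul_assoc, hCC', mul_one,
      ← Matrix.mulVec_mulVec, hc, Matrix.mulVec_smul, smul_smul]
  have hcard : Nat.card (stabSubmodule v) ≤ Nat.card (stabSubmodule (C *ᵥ v)) := by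
    refine Nat.card_le_card_of_injective
      (fun Q : stabSubmodule v => (⟨g Q, hmem Q Q.2⟩ : stabSubmodule (C *ᵥ v))) ?_
    intro Q Q' h
    have h1 : g Q = g Q' := congrArg Subtype.val h
    exact Subtype.ext (by rw [← hg Q, ← hg Q', h1])
  rw [Module.natCard_eq_pow_finrank (K := ZMod 2) (V := stabSubmodule v),
    Module.natCard_eq_pow_finrank (K := ZMod 2) (V := stabSubmodule (C *ᵥ v)),
    Nat.card_zmod] at hcard
  exact (Nat.pow_le_pow_iff_right (by norm_num)).mp hcard

/-- Induction on the circuit. That the vector is nonzero is carried along because eigenvalues of the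
zero vector mean nothing, and the Clifford step for the dimension relies on them. -/
theorem DopedClifford.properties {t : ℕ} {U : Matrix (Basis n) (Basis n) ℂ}
    (h : DopedClifford n t U) :
    U *ᵥ zeroVec n ≠ 0 ∧ HasSqrtTwoValues t (U *ᵥ zeroVec n) ∧
      n ≤ Module.finrank (ZMod 2) (stabSubmodule (U *ᵥ zeroVec n)) + t := by
  have hne : ∀ {C : Matrix (Basis n) (Basis n) ℂ} {v : Basis n → ℂ}, Cᴴ * C = 1 → v ≠ 0 →
      C *ᵥ v ≠ 0 := fun {_ v} hC hv h => hv (by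
    rw [← Matrix.one_mulVec v, ← hC, ← Matrix.mulVec_mulVec, h,
      Matrix.mulVec_zero])
  induction h with
  | clifford C hC =>
    have h0 : zeroVec n ≠ 0 := fun h => by
      have := congrFun h (fun _ => 0)
      simp [zeroVec] at this
    exact ⟨hne (Matrix.mem_unitaryGroup_iff'.mp hC.1) h0, hasSqrtTwoValues_zeroVec.clifford hC,
      finrank_stab_zeroVec.trans (finrank_stab_clifford hC h0)⟩
  | step t U C q hU hC ih =>
    obtain ⟨h1, h2, h3⟩ := ih
    have hT : (tGate q)ᴴ * tGate q = (1 : Matrix (Basis n) (Basis n) ℂ) := by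
      have := tGate_conj_of_fst_eq_zero (q := q) (P := 0) rfl
      rwa [Pauli.mat_zero, mul_one] at this
    have h4 := hne hT h1
    rw [← Matrix.mulVec_mulVec, ← Matrix.mulVec_mulVec]
    refine ⟨hne (Matrix.mem_unitaryGroup_iff'.mp hC.1) h4, (h2.tGate q).clifford hC, ?_⟩
    have h5 := finrank_stab_tGate q (U *ᵥ zeroVec n)
    have h6 := finrank_stab_clifford hC h4
    omega

theorem IsDopedState.expect_eq {t : ℕ} {ψ : PureState n} (h : IsDopedState t ψ) (P : Pauli n) :
    ∃ a b : ℤ, |a| ≤ 2 ^ t ∧ |b| ≤ 2 ^ t ∧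
      ψ.expect P = (a + b * Real.sqrt 2) / Real.sqrt 2 ^ t := by
  obtain ⟨U, hU, hψ⟩ := h
  have := hU.properties.2.1 P
  rwa [zeroVec, ← hψ] at this

theorem IsDopedState.le_finrank_stab {t : ℕ} {ψ : PureState n} (h : IsDopedState t ψ) :
    n ≤ Module.finrank (ZMod 2) (stabSubmodule ψ.vec) + t := by
  obtain ⟨U, hU, hψ⟩ := h
  have := hU.properties.2.2
  rwa [zeroVec, ← hψ] at this

/-! ### The density matrix of a state in terms of its description -/

theorem PureState.density_eq_sum (ψ : PureState n) :
    ψ.density = ((2 : ℂ) ^ n)⁻¹ • ∑ P : Pauli n, (ψ.expect P : ℂ) • P.mat := by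
  ext a b
  have h : ∀ P : Pauli n, (ψ.expect P : ℂ) * P.mat a b =
      ∑ x : Basis n × Basis n, ψ.vec x.1 * star (ψ.vec x.2) *
        (star (P.mat x.1 x.2) * P.mat a b) := by
    intro P
    have h1 : (ψ.expect P : ℂ) = star (ψ.expect P : ℂ) := (Complex.conj_ofReal _).symm
    rw [h1, ψ.ofReal_expect]
    simp only [dotProduct, Matrix.mulVec, Fintype.sum_prod_type, Finset.mul_sum, star_sum,
      Finset.sum_mul, star_mul', Pi.star_apply, star_star]
    refine Finset.sum_congr rfl fun a _ => Finset.sum_congr rfl fun b _ => ?_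
    ring
  rw [Matrix.smul_apply, Matrix.sum_apply]
  simp only [Matrix.smul_apply, smul_eq_mul, h]
  rw [Finset.sum_comm]
  simp only [← Finset.mul_sum, mat_complete]
  rw [Finset.sum_eq_single (a, b)]
  · simp only [and_self, if_true, PureState.density, Matrix.vecMulVec_apply, Pi.star_apply]
    field_simp
  · intro y _ hy
    rw [if_neg, mul_zero]
    rintro ⟨h1, h2⟩
    exact hy (Prod.ext h1 h2)
  · simp

theorem PureState.density_conjTranspose (ψ : PureState n) : (ψ.density)ᴴ = ψ.density := by
  rw [PureState.density, Matrix.conjTranspose_vecMulVec, star_star]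

/-- The adjoint of g|ψ⟩ = ±|ψ⟩, as ψ and g are Hermitian. Hence multiplication of ψ by a factor 1+φg
doubles it. -/
theorem PureState.density_mul_of_mem_stab (ψ : PureState n) {g : Pauli n} (hg : g ∈ ψ.stab) :
    ψ.density * ((ψ.expect g : ℂ) • g.mat) = ψ.density := by
  have h2 : (ψ.expect g : ℂ) * ψ.expect g = 1 := by
    have := ψ.expect_sq_of_mem_stab hg
    rw [pow_two] at this
    exact_mod_cast this
  have h : g.mat * ψ.density = (ψ.expect g : ℂ) • ψ.density := by
    rw [PureState.density, Matrix.mul_vecMulVec, ψ.eigen_of_mem_stab hg, Matrix.smul_vecMulVec]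
  have h3 := congrArg Matrix.conjTranspose h
  rw [Matrix.conjTranspose_mul, ψ.density_conjTranspose, Pauli.mat_conjTranspose,
    Matrix.conjTranspose_smul, ψ.density_conjTranspose,
    show star (ψ.expect g : ℂ) = ψ.expect g from Complex.conj_ofReal _] at h3
  rw [mul_smul_comm, h3, smul_smul, h2, one_smul]

theorem mul_list_prod_eq_smul {R : Type*} [Semiring R] (ρ : R) (l : List R)
    (h : ∀ y ∈ l, ρ * y = 2 * ρ) : ρ * l.prod = 2 ^ l.length * ρ := by
  induction l with
  | nil => simp
  | cons y l ih =>
    rw [List.prod_cons, ← mul_assoc, h y (by simp), mul_assoc,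
      ih fun z hz => h z (List.mem_cons_of_mem _ hz), List.length_cons, pow_succ', mul_assoc]

/-- From x² = 1 follows x(1+x) = 1+x; the commutation hypothesis lets x travel to that factor. -/
theorem mul_list_prod_eq_self {R : Type*} [Ring R] {x : R} (hx : x * x = 1) (l : List R)
    (hc : ∀ y ∈ l, Commute x y) (hl : 1 + x ∈ l) : x * l.prod = l.prod := by
  induction l with
  | nil => simp at hl
  | cons y l ih =>
    rw [List.prod_cons, ← mul_assoc]
    rcases List.mem_cons.mp hl with h | h
    · rw [← h, mul_add, hx, mul_one, add_comm]
    · rw [(hc y (by simp)).eq, mul_assoc, ih (fun z hz => hc z (List.mem_cons_of_mem _ hz)) h]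

theorem Pauli.commute_of_symp {P Q : Pauli n} (h : P.symp Q = 0) : Commute P.mat Q.mat := by
  have := Pauli.mat_comm P Q
  rw [h, bitSign_zero, Complex.ofReal_one, one_smul] at this
  exact this

theorem Pauli.mat_add_of_symp {P Q : Pauli n} (h : P.symp Q = 0) :
    ∃ c : ℂ, c * c = 1 ∧ (P + Q).mat = c • (P.mat * Q.mat) := by
  obtain ⟨c, hc⟩ := Pauli.mat_add P Q
  refine ⟨c, ?_, hc⟩
  have h1 := Pauli.mat_mul_self (P + Q)
  have h2 := (Pauli.commute_of_symp h).eq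
  have h3 : P.mat * Q.mat * (P.mat * Q.mat) = 1 := by
    rw [mul_assoc, ← mul_assoc Q.mat, ← h2, mul_assoc, Pauli.mat_mul_self, mul_one,
      Pauli.mat_mul_self]
  rw [hc, smul_mul_smul_comm, h3] at h1
  have h4 := congrFun (congrFun h1 fun _ => 0) fun _ => 0
  simpa using h4

theorem PureState.expect_add_of_mem_stab (ψ : PureState n) {h g : Pauli n} {c : ℂ}
    (hc : (h + g).mat = c • (h.mat * g.mat)) (hg : g ∈ ψ.stab) :
    (ψ.expect (h + g) : ℂ) = c * ψ.expect g * ψ.expect h := by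
  rw [ψ.ofReal_expect (h + g), hc, Matrix.smul_mulVec, ← Matrix.mulVec_mulVec,
    ψ.eigen_of_mem_stab hg, Matrix.mulVec_smul, dotProduct_smul, dotProduct_smul,
    ← ψ.ofReal_expect, smul_eq_mul, smul_eq_mul, mul_assoc]

theorem PureState.expect_add_ne_zero (ψ : PureState n) {h g : Pauli n} (hg : g ∈ ψ.stab)
    (hh : ψ.expect (h + g) ≠ 0) : ψ.expect h ≠ 0 := by
  obtain ⟨c, hc⟩ := Pauli.mat_add h g
  have := ψ.expect_add_of_mem_stab hc hg
  intro h0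
  rw [h0, Complex.ofReal_zero, mul_zero] at this
  exact hh (by exact_mod_cast this)

/-- The density identity is what needs an argument. Let L be the product of the factors 1+φg. On the
one hand ψL = 2^m ψ. On the other hand ψ is expanded in Pauli strings, which are grouped by cosets
of G; since gL = ⟨g⟩L, all 2^m strings of a coset contribute the same term, that of the
representative. The factors 2^m cancel. -/
theorem Description.describes_of {ψ : PureState n} {D : Description n} {t : ℕ}
    (hspan : Submodule.span (ZMod 2) (Set.range D.g) = stabSubmodule ψ.vec)
    (hindep : LinearIndependent (ZMod 2) D.g)
    (hφ : ∀ j, ψ.expect (D.g j) = D.φ j)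
    (hcosets : ∀ P, ψ.expect P ≠ 0 ↔ P ∈ ψ.stab ∨ ∃ i, P - D.h i ∈ ψ.stab)
    (hnot : ∀ i, D.h i ∉ ψ.stab)
    (hdist : ∀ i j, D.h i - D.h j ∈ ψ.stab → i = j)
    (hval : ∀ i, ψ.expect (D.h i) = D.value t i) : D.Describes t ψ := by
  have hmem : ∀ j, D.g j ∈ ψ.stab := fun j => by
    rw [← mem_stabSubmodule_iff, ← hspan]
    exact Submodule.subset_span ⟨j, rfl⟩
  have hφc : ∀ j, (D.φ j : ℂ) = ψ.expect (D.g j) := fun j => by rw [hφ]; simp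
  refine ⟨?_, hindep, fun j => ⟨?_, ?_⟩, hcosets, hnot, hdist, hval, ?_⟩
  · have h1 : AddSubgroup.closure (Set.range D.g) =
        (Submodule.span (ZMod 2) (Set.range D.g)).toAddSubgroup := by
      refine le_antisymm ((AddSubgroup.closure_le _).mpr Submodule.subset_span) fun x hx => ?_
      induction hx using Submodule.span_induction with
      | mem x h => exact AddSubgroup.subset_closure h
      | zero => exact zero_mem _
      | add x y _ _ hx hy => exact add_mem hx hy
      | smul c x _ hx =>
        have : c = 0 ∨ c = 1 := by revert c; decide
        rcases this with rfl | rfl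
        · rw [zero_smul]; exact zero_mem _
        · rwa [one_smul]
    rw [h1, hspan]
    rfl
  · rcases (ψ.mem_stab_iff _).mp (hmem j) with h | h <;> rw [hφ] at h
    · left; exact_mod_cast h
    · right; exact_mod_cast h
  · rw [hφc]; exact ψ.eigen_of_mem_stab (hmem j)
  · set L := List.ofFn fun j => 1 + (D.φ j : ℂ) • (D.g j).mat with hL
    have hLmem : ∀ y ∈ L, ∃ j, y = 1 + (D.φ j : ℂ) • (D.g j).mat := by
      intro y hy
      obtain ⟨j, hj⟩ := (List.mem_ofFn' _ _).mp hy
      exact ⟨j, hj.symm⟩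
    have hright : ψ.density * L.prod = 2 ^ D.m * ψ.density := by
      rw [mul_list_prod_eq_smul _ _ (fun y hy => ?_), hL, List.length_ofFn]
      obtain ⟨j, rfl⟩ := hLmem y hy
      rw [mul_add, mul_one, hφc, ψ.density_mul_of_mem_stab (hmem j), two_mul]
    have hcomm : ∀ i j, (D.g i).symp (D.g j) = 0 := fun i j =>
      ψ.stab_le_perp (hmem j) _ (hmem i)
    -- For a generator the matching factor of L absorbs it; the relation then passes to products,
    -- where the phase of the product appears in both the matrix and the expectation.
    have hleft : ∀ g ∈ Submodule.span (ZMod 2) (Set.range D.g),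
        g.mat * L.prod = (ψ.expect g : ℂ) • L.prod := by
      intro g hg
      induction hg using Submodule.span_induction with
      | mem x h =>
        obtain ⟨j, rfl⟩ := h
        have hsq : (ψ.expect (D.g j) : ℂ) * ψ.expect (D.g j) = 1 := by
          have := ψ.expect_sq_of_mem_stab (hmem j)
          rw [pow_two] at this
          exact_mod_cast this
        have h1 : ((ψ.expect (D.g j) : ℂ) • (D.g j).mat) * L.prod = L.prod := by
          apply mul_list_prod_eq_self
          · rw [smul_mul_smul_comm, hsq, Pauli.mat_mul_self, one_smul]
          · intro y hy
            obtain ⟨i, rfl⟩ := hLmem y hy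
            exact (Commute.one_right _).add_right
              (((Pauli.commute_of_symp (hcomm j i)).smul_right _).smul_left _)
          · rw [← hφc]
            exact (List.mem_ofFn' _ _).mpr ⟨j, rfl⟩
        conv_rhs => rw [← h1]
        rw [smul_mul_assoc, smul_smul, hsq, one_smul]
      | zero =>
        rw [Pauli.mat_zero, one_mul, ψ.expect_eq_of_eigen (c := 1) (by
          rw [Pauli.mat_zero, Matrix.one_mulVec]; simp)]
        simp
      | add x y hx hy ihx ihy =>
        rw [hspan] at hy
        obtain ⟨c, hc⟩ := Pauli.mat_add x y
        rw [ψ.expect_add_of_mem_stab hc hy, hc, smul_mul_assoc, mul_assoc, ihy, mul_smul_comm, ihx,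
          smul_smul, smul_smul, mul_assoc]
      | smul c x _ hx =>
        have : c = 0 ∨ c = 1 := by revert c; decide
        rcases this with rfl | rfl
        · rw [zero_smul, Pauli.mat_zero, one_mul, ψ.expect_eq_of_eigen (c := 1) (by
            rw [Pauli.mat_zero, Matrix.one_mulVec]; simp)]
          simp
        · rwa [one_smul]
    rw [hspan] at hleft
    classical
    -- The value `none` stands for G itself, with the identity as representative.
    let H : Option (Fin D.k) → Pauli n := fun o => o.elim 0 D.h
    have hHexp : ∀ o, ψ.expect (H o) ≠ 0 := by
      rintro (_ | i)
      · refine (hcosets _).mpr (Or.inl ?_)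
        exact (stabSubmodule ψ.vec).zero_mem
      · refine (hcosets _).mpr (Or.inr ⟨i, ?_⟩)
        rw [show H (some i) = D.h i from rfl, sub_self]
        exact (stabSubmodule ψ.vec).zero_mem
    have hHinj : ∀ o o', H o - H o' ∈ stabSubmodule ψ.vec → o = o' := by
      rintro (_ | i) (_ | j) h
      · rfl
      · refine absurd (mem_stabSubmodule_iff.mp ?_) (hnot j)
        have := (stabSubmodule ψ.vec).neg_mem h
        simpa [H] using this
      · refine absurd (mem_stabSubmodule_iff.mp ?_) (hnot i)
        simpa [H] using h
      · rw [hdist i j h]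
    -- The phase and the sign of g each enter twice, once through the expectation value and once
    -- through the matrix, and square to one.
    have hterm : ∀ (o : Option (Fin D.k)) (g : stabSubmodule ψ.vec),
        (ψ.expect (H o + g) : ℂ) • ((H o + g.1).mat * L.prod) =
          (ψ.expect (H o) : ℂ) • ((H o).mat * L.prod) := by
      intro o g
      have hs : (H o).symp g.1 = 0 := by
        rw [Pauli.symp_comm]; exact ψ.symp_eq_zero (hHexp o) g.2
      obtain ⟨c, hcc, hc⟩ := Pauli.mat_add_of_symp hs
      have hsq : (ψ.expect g.1 : ℂ) * ψ.expect g.1 = 1 := by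
        have := ψ.expect_sq_of_mem_stab g.2
        rw [pow_two] at this
        exact_mod_cast this
      rw [ψ.expect_add_of_mem_stab hc g.2, hc, smul_mul_assoc, mul_assoc (H o).mat, hleft _ g.2,
        mul_smul_comm, smul_smul, smul_smul]
      congr 1
      linear_combination (ψ.expect g.1 : ℂ) * ψ.expect g.1 * ψ.expect (H o) * hcc +
        ψ.expect (H o) * hsq
    -- Strings with expectation zero drop out, and each remaining one is a representative times a
    -- stabilizer element in exactly one way.
    have hsum : ∑ P : Pauli n, (ψ.expect P : ℂ) • (P.mat * L.prod) =
        ∑ x : Option (Fin D.k) × stabSubmodule ψ.vec,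
          (ψ.expect (H x.1 + x.2) : ℂ) • ((H x.1 + x.2.1).mat * L.prod) := by
      symm
      refine Finset.sum_bij_ne_zero (fun x _ _ => H x.1 + x.2.1) (fun _ _ _ => Finset.mem_univ _)
        ?_ ?_ (fun _ _ _ => rfl)
      · rintro ⟨o, g⟩ _ _ ⟨o', g'⟩ _ _ h
        have h1 : H o - H o' = (g'.1 - g.1) := by
          rw [sub_eq_sub_iff_add_eq_add, h, add_comm]
        have h2 : o = o' := hHinj o o' (by rw [h1]; exact sub_mem g'.2 g.2)
        subst h2
        rw [Prod.mk.injEq]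
        exact ⟨rfl, Subtype.ext (add_left_cancel h)⟩
      · intro P _ hP
        have hP0 : ψ.expect P ≠ 0 := fun h => hP (by rw [h, Complex.ofReal_zero, zero_smul])
        have : ∃ (o : Option (Fin D.k)) (g : stabSubmodule ψ.vec), H o + g.1 = P := by
          rcases (hcosets P).mp hP0 with h | ⟨i, h⟩
          · exact ⟨none, ⟨P, h⟩, zero_add _⟩
          · exact ⟨some i, ⟨_, h⟩, add_sub_cancel _ _⟩
        obtain ⟨o, g, rfl⟩ := this
        exact ⟨(o, g), Finset.mem_univ _, hP, rfl⟩
    have hcard : Fintype.card (stabSubmodule ψ.vec) = 2 ^ D.m := by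
      have h1 : Module.finrank (ZMod 2) (stabSubmodule ψ.vec) = D.m := by
        rw [← hspan, finrank_span_eq_card hindep, Fintype.card_fin]
      have h2 := Module.natCard_eq_pow_finrank (K := ZMod 2) (V := stabSubmodule ψ.vec)
      rw [h1, Nat.card_zmod] at h2
      rw [← Nat.card_eq_fintype_card, h2]
    have hfin : (2 : ℂ) ^ D.m • ψ.density = (2 : ℂ) ^ D.m • D.toMatrix t := by
      have e1 : (2 : ℂ) ^ D.m • ψ.density = ψ.density * L.prod := by
        rw [hright, Algebra.smul_def, map_pow, map_ofNat]
      have hz : ψ.expect (0 : Pauli n) = 1 := ψ.expect_eq_of_eigen (c := 1) (by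
            rw [Pauli.mat_zero, Matrix.one_mulVec]; simp)
      rw [e1, ψ.density_eq_sum, smul_mul_assoc, Finset.sum_mul]
      simp only [smul_mul_assoc]
      rw [hsum]
      simp only [hterm]
      rw [Fintype.sum_prod_type]
      simp only [Finset.sum_const, Finset.card_univ, hcard]
      rw [← Finset.smul_sum, Fintype.sum_option, Description.toMatrix, ← hL, add_mul, one_mul,
        Finset.sum_mul, smul_comm]
      simp only [H, Option.elim_none, Option.elim_some, hz, Pauli.mat_zero, one_mul,
        Complex.ofReal_one, one_smul, hval, smul_mul_assoc]
      rw [← Nat.cast_smul_eq_nsmul ℂ]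
      push_cast
      rfl
    exact smul_right_injective _ (pow_ne_zero _ two_ne_zero) hfin

/-! ### Subspaces spanned by consecutive cells of the Pauli array -/

/-- The contents of the `k` cells from address `b` on. -/
def cells (f : ℕ → Pauli n) (b k : ℕ) : Set (Pauli n) := f '' Set.Ico b (b + k)

/-- The subspace spanned by the `k` cells from address `b` on. -/
def cellSpan (f : ℕ → Pauli n) (b k : ℕ) : Submodule (ZMod 2) (Pauli n) :=
  Submodule.span (ZMod 2) (cells f b k)

theorem mem_cells {f : ℕ → Pauli n} {b k i : ℕ} (h1 : b ≤ i) (h2 : i < b + k) : f i ∈ cells f b k :=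
  ⟨i, ⟨h1, h2⟩, rfl⟩

theorem cells_congr {f g : ℕ → Pauli n} {b k : ℕ} (h : ∀ i, b ≤ i → i < b + k → f i = g i) :
    cells f b k = cells g b k :=
  Set.image_congr fun i hi => h i hi.1 hi.2

theorem cells_shift {f g : ℕ → Pauli n} {b c k : ℕ} (h : ∀ i < k, f (b + i) = g (c + i)) :
    cells f b k = cells g c k := by
  ext x
  constructor
  · rintro ⟨i, ⟨h1, h2⟩, rfl⟩
    refine ⟨c + (i - b), ⟨by omega, by omega⟩, ?_⟩
    rw [← h (i - b) (by omega)]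
    congr 1; omega
  · rintro ⟨i, ⟨h1, h2⟩, rfl⟩
    refine ⟨b + (i - c), ⟨by omega, by omega⟩, ?_⟩
    rw [h (i - c) (by omega)]
    congr 1; omega

theorem cells_succ_left (f : ℕ → Pauli n) (b k : ℕ) :
    cells f b (k + 1) = insert (f b) (cells f (b + 1) k) := by
  ext x
  constructor
  · rintro ⟨i, ⟨h1, h2⟩, rfl⟩
    rcases Nat.eq_or_lt_of_le h1 with rfl | h
    · exact Or.inl rfl
    · exact Or.inr ⟨i, ⟨h, by omega⟩, rfl⟩
  · rintro (rfl | ⟨i, ⟨h1, h2⟩, rfl⟩)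
    · exact ⟨b, ⟨le_rfl, by omega⟩, rfl⟩
    · exact ⟨i, ⟨by omega, by omega⟩, rfl⟩

theorem cells_eq_range (f : ℕ → Pauli n) (b k : ℕ) :
    cells f b k = Set.range fun i : Fin k => f (b + i) := by
  ext x
  constructor
  · rintro ⟨i, ⟨h1, h2⟩, rfl⟩
    refine ⟨⟨i - b, by omega⟩, ?_⟩
    change f (b + (i - b)) = f i
    congr 1; omega
  · rintro ⟨i, rfl⟩
    exact ⟨b + i, ⟨by omega, by omega⟩, rfl⟩

theorem finrank_cellSpan_le (f : ℕ → Pauli n) (b k : ℕ) :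
    Module.finrank (ZMod 2) (cellSpan f b k) ≤ k := by
  have h := finrank_range_le_card (R := ZMod 2) fun i : Fin k => f (b + i)
  rw [Fintype.card_fin, Set.finrank, ← cells_eq_range] at h
  exact h

theorem cellSpan_update_add (f : ℕ → Pauli n) {b k i p : ℕ} (hp : b ≤ p ∧ p < b + k)
    (hi : b ≤ i ∧ i < b + k) (hip : i ≠ p) :
    cellSpan (Function.update f i (f i + f p)) b k = cellSpan f b k := by
  set g := Function.update f i (f i + f p) with hg
  have gi : g i = f i + f p := Function.update_self ..
  have gj : ∀ j, j ≠ i → g j = f j := fun j hj => Function.update_of_ne hj ..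
  apply le_antisymm
  · refine Submodule.span_le.mpr ?_
    rintro _ ⟨j, hj, rfl⟩
    by_cases h : j = i
    · rw [h, gi]
      exact add_mem (Submodule.subset_span (mem_cells hi.1 hi.2))
        (Submodule.subset_span (mem_cells hp.1 hp.2))
    · rw [gj j h]
      exact Submodule.subset_span (mem_cells hj.1 hj.2)
  · refine Submodule.span_le.mpr ?_
    rintro _ ⟨j, hj, rfl⟩
    by_cases h : j = i
    · have : f j = g i - g p := by rw [gi, gj p hip.symm, h, add_sub_cancel_right]
      rw [this]
      exact sub_mem (Submodule.subset_span (mem_cells hi.1 hi.2))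
        (Submodule.subset_span (mem_cells hp.1 hp.2))
    · rw [← gj j h]
      exact Submodule.subset_span (mem_cells hj.1 hj.2)

/-- Removing the only cell that anticommutes with `x` (its place is taken by the last cell)
leaves the part of the span that commutes with `x`. -/
theorem cellSpan_remove {f g : ℕ → Pauli n} {b k p : ℕ} {x : Pauli n} (hp : b ≤ p ∧ p < b + (k + 1))
    (hpx : x.symp (f p) ≠ 0) (hcomm : ∀ i, b ≤ i → i < b + (k + 1) → i ≠ p → x.symp (f i) = 0)
    (hgp : p ≠ b + k → g p = f (b + k)) (hg : ∀ i, b ≤ i → i < b + k → i ≠ p → g i = f i) :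
    cellSpan g b k = cellSpan f b (k + 1) ⊓ perp {x} := by
  set S := f '' (Set.Ico b (b + (k + 1)) \ {p}) with hS
  have h1 : cells g b k = S := by
    ext y
    constructor
    · rintro ⟨i, ⟨hi1, hi2⟩, rfl⟩
      by_cases h : i = p
      · subst h
        rw [hgp (by omega)]
        refine ⟨b + k, ⟨⟨by omega, by omega⟩, ?_⟩, rfl⟩
        simp only [Set.mem_singleton_iff]; omega
      · rw [hg i hi1 hi2 h]
        exact ⟨i, ⟨⟨hi1, by omega⟩, h⟩, rfl⟩
    · rintro ⟨i, ⟨⟨hi1, hi2⟩, hip⟩, rfl⟩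
      simp only [Set.mem_singleton_iff] at hip
      by_cases h : i = b + k
      · subst h
        rw [← hgp (Ne.symm hip)]
        exact mem_cells hp.1 (by omega)
      · rw [← hg i hi1 (by omega) hip]
        exact mem_cells hi1 (by omega)
  have h2 : cells f b (k + 1) = insert (f p) S := by
    ext y
    constructor
    · rintro ⟨i, hi, rfl⟩
      by_cases h : i = p
      · exact Or.inl (by rw [h])
      · exact Or.inr ⟨i, ⟨hi, h⟩, rfl⟩
    · rintro (rfl | ⟨i, ⟨hi, _⟩, rfl⟩)
      · exact mem_cells hp.1 hp.2
      · exact mem_cells hi.1 hi.2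
  have h3 : Submodule.span (ZMod 2) S ≤ perp {x} := by
    refine Submodule.span_le.mpr ?_
    rintro _ ⟨i, ⟨⟨hi1, hi2⟩, hip⟩, rfl⟩ a rfl
    exact hcomm i hi1 hi2 hip
  rw [cellSpan, cellSpan, h1, h2]
  apply le_antisymm
  · exact le_inf (Submodule.span_mono (Set.subset_insert _ _)) h3
  · rintro y ⟨hy, hyx⟩
    obtain ⟨a, z, hz, rfl⟩ := Submodule.mem_span_insert.mp hy
    have h4 := hyx x rfl
    rw [Pauli.symp_add_right, h3 hz x rfl, add_zero, Pauli.symp_comm, Pauli.symp_smul_left,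
      Pauli.symp_comm] at h4
    rw [(mul_eq_zero.mp h4).resolve_right hpx, zero_smul, zero_add]
    exact hz

theorem perp_insert (x : Pauli n) (A : Set (Pauli n)) : perp (insert x A) = perp A ⊓ perp {x} := by
  ext y
  simp only [mem_perp, Submodule.mem_inf, Set.mem_insert_iff, forall_eq_or_imp,
    Set.mem_singleton_iff, forall_eq]
  exact and_comm

/-- Generators of a subspace that is the commutant of the remaining cells are independent. -/
theorem finrank_eq_of_cellSpan_eq_perp {f : ℕ → Pauli n} {m r : ℕ} (hmr : m + r = 2 * n)
    (h : cellSpan f 0 m = perp (cells f m r)) :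
    Module.finrank (ZMod 2) (cellSpan f 0 m) = m := by
  -- The two spans have dimensions that add up to 2n and are bounded by m and r; as m + r = 2n, both
  -- bounds are attained.
  have h1 := finrank_perp_add (cellSpan f m r)
  rw [cellSpan, perp_span, ← cellSpan, ← h] at h1
  have h2 := finrank_cellSpan_le f m r
  have h3 := finrank_cellSpan_le f 0 m
  omega

theorem linearIndependent_cells {f : ℕ → Pauli n} {m r : ℕ} (hmr : m + r = 2 * n)
    (h : cellSpan f 0 m = perp (cells f m r)) :
    LinearIndependent (ZMod 2) fun i : Fin m => f i := by
  rw [linearIndependent_iff_card_eq_finrank_span, Fintype.card_fin]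
  have h1 := finrank_eq_of_cellSpan_eq_perp hmr h
  have h2 : cells f 0 m = Set.range fun i : Fin m => f i := by
    rw [cells_eq_range]; simp
  rw [Set.finrank, ← h2]
  exact h1.symm

/-- The second elimination finds a complement of an isotropic subspace `G` in its commutant. -/
theorem complement_of_cells {G : Submodule (ZMod 2) (Pauli n)} (hG : G ≤ perp (G : Set (Pauli n)))
    {R C : Set (Pauli n)} (hR : perp R = G) (hCR : C ⊆ Submodule.span (ZMod 2) R)
    {W : Submodule (ZMod 2) (Pauli n)} (hW : W = Submodule.span (ZMod 2) R ⊓ perp C)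
    (hWR : W ≤ perp R) :
    W = G ∧ perp (G : Set (Pauli n)) = G ⊔ Submodule.span (ZMod 2) C := by
  have hU : Submodule.span (ZMod 2) R = perp (G : Set (Pauli n)) := by
    rw [← hR, ← perp_span R, perp_perp]
  have hC : (G : Set (Pauli n)) ⊆ perp C := by
    intro y hy
    rw [← hR, ← perp_span R] at hy
    exact perp_anti hCR hy
  have hWG : W = G := by
    apply le_antisymm
    · rwa [hR] at hWR
    · rw [hW, hU]
      exact le_inf hG hC
  refine ⟨hWG, ?_⟩
  -- Both sides are commutants of G together with C. The left one is W, which equals G, and taking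
  -- commutants once more gives G^⊥ = G ⊔ span C.
  have h1 : perp (G : Set (Pauli n)) ⊓ perp C =
      perp ((G ⊔ Submodule.span (ZMod 2) C : Submodule (ZMod 2) (Pauli n)) : Set (Pauli n)) := by
    apply le_antisymm
    · rintro y ⟨hy1, hy2⟩ a ha
      obtain ⟨u, hu, w, hw, rfl⟩ := Submodule.mem_sup.mp ha
      rw [Pauli.symp_add_left, hy1 u hu]
      rw [← perp_span C] at hy2
      rw [hy2 w hw, add_zero]
    · refine le_inf (perp_anti fun a ha => Submodule.mem_sup_left ha) (perp_anti fun a ha =>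
        Submodule.mem_sup_right (Submodule.subset_span ha))
  rw [← hU, ← perp_perp (G ⊔ Submodule.span (ZMod 2) C), ← h1, ← hU, ← hW, hWG, hU]

/-- A list of `2^c` elements that covers `U` modulo `G` has no two entries in the same class. -/
theorem eq_of_sub_mem_of_cover {G U : Submodule (ZMod 2) (Pauli n)} {c : ℕ}
    (hdim : Module.finrank (ZMod 2) U = Module.finrank (ZMod 2) G + c) {E : ℕ → Pauli n}
    (hcov : ∀ P ∈ U, ∃ i < 2 ^ c, P - E i ∈ G) {i j : ℕ} (hi : i < 2 ^ c) (hj : j < 2 ^ c)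
    (hij : E i - E j ∈ G) : i = j := by
  choose! a ha1 ha2 using hcov
  -- Sending P to an index of its class and the remainder in G is injective between sets of equal
  -- size, hence surjective.
  let F : U → Fin (2 ^ c) × G := fun P => (⟨a P, ha1 P P.2⟩, ⟨P - E (a P), ha2 P P.2⟩)
  have hF : Function.Injective F := by
    intro P Q h
    have h1 : a P = a Q := congrArg (fun x => (x.1 : ℕ)) h
    have h2 : P.1 - E (a P) = Q.1 - E (a Q) := congrArg (fun x => (x.2 : Pauli n)) h
    rw [h1] at h2
    exact Subtype.ext (sub_left_injective h2)
  have hcard : Nat.card U = Nat.card (Fin (2 ^ c) × G) := by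
    rw [Nat.card_prod, Module.natCard_eq_pow_finrank (K := ZMod 2) (V := U),
      Module.natCard_eq_pow_finrank (K := ZMod 2) (V := G), hdim]
    simp [pow_add, mul_comm]
  have hsurj := (hF.bijective_of_nat_card_le hcard.ge).2
  -- If `E i` and `E j` were in one class, the pairs (i, 0) and (j, E i - E j) would both come from
  -- the element `E i`.
  obtain ⟨P, hP⟩ := hsurj (⟨i, hi⟩, 0)
  obtain ⟨Q, hQ⟩ := hsurj (⟨j, hj⟩, ⟨E i - E j, hij⟩)
  have p1 : a P = i := congrArg (fun x => (x.1 : ℕ)) hP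
  have p2 : P.1 - E (a P) = 0 := congrArg (fun x => (x.2 : Pauli n)) hP
  have q1 : a Q = j := congrArg (fun x => (x.1 : ℕ)) hQ
  have q2 : Q.1 - E (a Q) = E i - E j := congrArg (fun x => (x.2 : Pauli n)) hQ
  rw [p1] at p2
  rw [q1] at q2
  have hPQ : P = Q := Subtype.ext ((sub_eq_zero.mp p2).trans (sub_left_injective q2).symm)
  rw [← p1, ← q1, hPQ]

/-! ### Arithmetic in `ℤ[√2]` -/

theorem sqrt_two_lt : Real.sqrt 2 < 3 / 2 := by
  rw [Real.sqrt_lt' (by norm_num)]; norm_num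

theorem one_lt_sqrt_two : 1 < Real.sqrt 2 := by
  rw [Real.lt_sqrt (by norm_num)]; norm_num

theorem sq_ne_two_mul_sq {a b : ℤ} (h : ¬ (a = 0 ∧ b = 0)) : a ^ 2 - 2 * b ^ 2 ≠ 0 := by
  intro h0
  have hb : b ≠ 0 := by
    rintro rfl
    apply h
    simpa using h0
  have h1 : ((a : ℝ) / b) ^ 2 = 2 := by
    have hb' : (b : ℝ) ≠ 0 := by exact_mod_cast hb
    have h2 : (a : ℝ) ^ 2 - 2 * (b : ℝ) ^ 2 = 0 := by exact_mod_cast h0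
    rw [div_pow, div_eq_iff (by positivity)]
    linarith
  have h3 : Real.sqrt 2 = |(a : ℝ) / b| := by rw [← h1, Real.sqrt_sq_eq_abs]
  apply irrational_sqrt_two
  refine ⟨|(a : ℚ) / b|, ?_⟩
  rw [h3]
  push_cast
  rfl

/-- Elements of `ℤ[√2]` with bounded coefficients are not close to zero. -/
theorem one_le_abs_add_mul_sqrt_two {a b : ℤ} {t : ℕ} (h : ¬ (a = 0 ∧ b = 0))
    (ha : |a| ≤ 2 * 2 ^ t) (hb : |b| ≤ 2 * 2 ^ t) :
    1 ≤ |(a : ℝ) + b * Real.sqrt 2| * (5 * 2 ^ t) := by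
  have hs : Real.sqrt 2 * Real.sqrt 2 = 2 := Real.mul_self_sqrt (by norm_num)
  -- The norm is a nonzero integer, so the number times its conjugate has absolute value at least 1.
  -- The conjugate is at most 2·2^t·(1 + 3/2) = 5·2^t.
  have h1 : (1 : ℝ) ≤ |(a : ℝ) + b * Real.sqrt 2| * |(a : ℝ) - b * Real.sqrt 2| := by
    rw [← abs_mul]
    have e : ((a : ℝ) + b * Real.sqrt 2) * (a - b * Real.sqrt 2) =
        ((a ^ 2 - 2 * b ^ 2 : ℤ) : ℝ) := by
      push_cast
      linear_combination (-(b : ℝ) ^ 2) * hs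
    rw [e]
    exact_mod_cast Int.one_le_abs (sq_ne_two_mul_sq h)
  have h2 : |(a : ℝ) - b * Real.sqrt 2| ≤ 5 * 2 ^ t := by
    have ha' : |(a : ℝ)| ≤ 2 * 2 ^ t := by exact_mod_cast ha
    have hb' : |(b : ℝ)| ≤ 2 * 2 ^ t := by exact_mod_cast hb
    calc |(a : ℝ) - b * Real.sqrt 2| ≤ |(a : ℝ)| + |b * Real.sqrt 2| := abs_sub _ _
      _ = |(a : ℝ)| + |(b : ℝ)| * Real.sqrt 2 := by
        rw [abs_mul, abs_of_nonneg (Real.sqrt_nonneg 2)]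
      _ ≤ 2 * 2 ^ t + (2 * 2 ^ t) * (3 / 2) := by
        gcongr
        exact sqrt_two_lt.le
      _ = 5 * 2 ^ t := by ring
  exact h1.trans (mul_le_mul_of_nonneg_left h2 (abs_nonneg _))

/-- Writes 1 = √2^t/√2^t in the shape of an admissible expectation value, so that `separation`
applies to the value ±1. The same coefficients give the integer weights of the search. -/
theorem exists_sqrt_two_pow (t : ℕ) : ∃ a b : ℤ, 0 ≤ a ∧ a ≤ 2 ^ t ∧ 0 ≤ b ∧ b ≤ 2 ^ t ∧
    Real.sqrt 2 ^ t = a + b * Real.sqrt 2 := by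
  have hs : Real.sqrt 2 * Real.sqrt 2 = 2 := Real.mul_self_sqrt (by norm_num)
  induction t with
  | zero => exact ⟨1, 0, by simp⟩
  | succ t ih =>
    obtain ⟨a, b, h1, h2, h3, h4, h5⟩ := ih
    refine ⟨2 * b, a, by omega, by rw [pow_succ]; omega, h1, by rw [pow_succ]; omega, ?_⟩
    rw [pow_succ, h5]
    push_cast
    linear_combination (b : ℝ) * hs

theorem sqrt_two_pow_le (t : ℕ) : Real.sqrt 2 ^ t ≤ 2 ^ t :=
  pow_le_pow_left₀ (Real.sqrt_nonneg 2) (by linarith [sqrt_two_lt]) t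

theorem sqrt_two_pow_mul_self (t : ℕ) : Real.sqrt 2 ^ t * Real.sqrt 2 ^ t = 2 ^ t := by
  rw [← mul_pow, Real.mul_self_sqrt (by norm_num)]

/-- Distinct values `(a + b√2)/√2^t` with bounded coefficients are well separated. -/
theorem separation {a b a' b' : ℤ} {t : ℕ} (h : ¬ (a = a' ∧ b = b'))
    (ha : |a| ≤ 2 ^ t) (hb : |b| ≤ 2 ^ t) (ha' : |a'| ≤ 2 ^ t) (hb' : |b'| ≤ 2 ^ t) :
    1 ≤ |(a + b * Real.sqrt 2) / Real.sqrt 2 ^ t - (a' + b' * Real.sqrt 2) / Real.sqrt 2 ^ t| *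
      (5 * 4 ^ t) := by
  have h1 := one_le_abs_add_mul_sqrt_two (a := a - a') (b := b - b') (t := t) (by omega)
    (by rw [abs_le] at *; omega) (by rw [abs_le] at *; omega)
  have hs : 0 < Real.sqrt 2 ^ t := by positivity
  have e : (a + b * Real.sqrt 2) / Real.sqrt 2 ^ t - (a' + b' * Real.sqrt 2) / Real.sqrt 2 ^ t =
      (((a - a' : ℤ) : ℝ) + ((b - b' : ℤ) : ℝ) * Real.sqrt 2) / Real.sqrt 2 ^ t := by
    push_cast; ring
  rw [e, abs_div, abs_of_pos hs]
  refine h1.trans ?_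
  have h4 : (4 : ℝ) ^ t = 2 ^ t * 2 ^ t := by rw [← mul_pow]; norm_num
  rw [h4, div_mul_eq_mul_div, le_div_iff₀ hs]
  have h5 := sqrt_two_pow_le t
  have h6 : 0 ≤ |((a - a' : ℤ) : ℝ) + ((b - b' : ℤ) : ℝ) * Real.sqrt 2| * (5 * 2 ^ t) := by
    positivity
  calc _ ≤ |((a - a' : ℤ) : ℝ) + ((b - b' : ℤ) : ℝ) * Real.sqrt 2| * (5 * 2 ^ t) * 2 ^ t :=
        mul_le_mul_of_nonneg_left h5 h6
    _ = _ := by ring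

/-- Outside the stabilizer group the expectation values are bounded away from `±1`. -/
theorem IsDopedState.expect_sq_le {t : ℕ} {ψ : PureState n} (h : IsDopedState t ψ) {Q : Pauli n}
    (hQ : Q ∉ ψ.stab) : ψ.expect Q ^ 2 ≤ 1 - 1 / (5 * 4 ^ t) := by
  obtain ⟨a, b, ha, hb, hab⟩ := h.expect_eq Q
  obtain ⟨α, β, h1, h2, h3, h4, h5⟩ := exists_sqrt_two_pow t
  have hs : 0 < Real.sqrt 2 ^ t := by positivity
  rw [ψ.mem_stab_iff] at hQ
  push Not at hQ
  -- The values 1 and -1 have numerators (α, β) and (-α, -β) within the bounds; outside the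
  -- stabilizer group both differ from ⟨Q⟩.
  have e1 : ((α : ℝ) + β * Real.sqrt 2) / Real.sqrt 2 ^ t = 1 := by rw [← h5, div_self hs.ne']
  have e2 : (((-α : ℤ) : ℝ) + ((-β : ℤ) : ℝ) * Real.sqrt 2) / Real.sqrt 2 ^ t = -1 := by
    rw [← e1]; push_cast; ring
  have s1 := separation (a := a) (b := b) (a' := α) (b' := β) (t := t) (by
    rintro ⟨rfl, rfl⟩; exact hQ.1 (hab.trans e1)) ha hb (by rwa [abs_of_nonneg h1])
    (by rwa [abs_of_nonneg h3])
  have s2 := separation (a := a) (b := b) (a' := -α) (b' := -β) (t := t) (by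
    rintro ⟨rfl, rfl⟩; exact hQ.2 (hab.trans e2)) ha hb (by rwa [abs_neg, abs_of_nonneg h1])
    (by rwa [abs_neg, abs_of_nonneg h3])
  rw [← hab, e1] at s1
  rw [← hab, e2] at s2
  have hx := abs_le.mp (abs_expect_le ψ Q)
  have hpos : (0 : ℝ) < 5 * 4 ^ t := by positivity
  rw [← div_le_iff₀ hpos, abs_of_nonpos (by linarith)] at s1
  rw [← div_le_iff₀ hpos, abs_of_nonneg (by linarith)] at s2
  -- ⟨Q⟩² ≤ |⟨Q⟩|, as |⟨Q⟩| ≤ 1.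
  rcases le_total 0 (ψ.expect Q) with h | h <;> nlinarith

/-- Decoding of an expectation value from an estimate, in integer arithmetic: `p/q` approximates
`√2`, and `A`, `B`, `D` are the integer counterparts of `1/√2^t`, `√2/√2^t` and `1`. -/
theorem decode {t : ℕ} {q p A B D M acc α β a₀ b₀ : ℤ} {x : ℝ}
    (hq : 0 < q) (hp : 0 < p) (hM : 0 < M) (hpell : |p ^ 2 - 2 * q ^ 2| = 1)
    (hqt : 128 * 8 ^ t ≤ q ^ 2) (hα0 : 0 ≤ α) (hα : α ≤ 2 ^ t) (hβ0 : 0 ≤ β) (hβ : β ≤ 2 ^ t)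
    (hαβ : Real.sqrt 2 ^ t = α + β * Real.sqrt 2)
    (hA : A = 32 * 2 ^ t * (α * q + β * p)) (hB : B = 32 * 2 ^ t * (2 * β * q + α * p))
    (hD : D = 32 * 4 ^ t * q)
    (ha₀ : |a₀| ≤ 2 ^ t) (hb₀ : |b₀| ≤ 2 ^ t)
    (hx : x = (a₀ + b₀ * Real.sqrt 2) / Real.sqrt 2 ^ t)
    (hacc : |(acc : ℝ) / D - M * x| ≤ M / (64 * 4 ^ t)) {a b : ℤ} (ha : |a| ≤ 2 ^ t)
    (hb : |b| ≤ 2 ^ t) :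
    |a * (M * A) + b * (M * B) - acc| ≤ M * q ↔ a = a₀ ∧ b = b₀ := by
  have hs2 : Real.sqrt 2 * Real.sqrt 2 = 2 := Real.mul_self_sqrt (by norm_num)
  have hs0 : 0 < Real.sqrt 2 ^ t := by positivity
  have h4 : (4 : ℝ) ^ t = 2 ^ t * 2 ^ t := by rw [← mul_pow]; norm_num
  have h8 : (8 : ℝ) ^ t = 2 ^ t * (2 ^ t * 2 ^ t) := by rw [← mul_pow, ← mul_pow]; norm_num
  have hq' : (0 : ℝ) < q := by exact_mod_cast hq
  have hp' : (0 : ℝ) < p := by exact_mod_cast hp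
  have hM' : (0 : ℝ) < M := by exact_mod_cast hM
  have hT : (0 : ℝ) < 2 ^ t := by positivity
  have hDr : (D : ℝ) = 32 * 4 ^ t * q := by rw [hD]; push_cast; ring
  have hD0 : (0 : ℝ) < D := by rw [hDr]; positivity
  set ε : ℝ := p - Real.sqrt 2 * q with hε
  -- By Pell's equation |p - √2q| = 1/(p + √2q) ≤ 1/q.
  have hεq : |ε| * q ≤ 1 := by
    have e1 : |ε| * (p + Real.sqrt 2 * q) = 1 := by
      have e2 : ε * (p + Real.sqrt 2 * q) = ((p ^ 2 - 2 * q ^ 2 : ℤ) : ℝ) := by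
        rw [hε]; push_cast; linear_combination (-(q : ℝ) ^ 2) * hs2
      have e3 : |ε * (p + Real.sqrt 2 * q)| = 1 := by
        rw [e2]; exact_mod_cast hpell
      rwa [abs_mul, abs_of_pos (a := (p + Real.sqrt 2 * q : ℝ)) (by positivity)] at e3
    rw [← e1]
    refine mul_le_mul_of_nonneg_left ?_ (abs_nonneg _)
    nlinarith [one_lt_sqrt_two]
  have hεs : 64 * 8 ^ t * |ε| ≤ q / 2 := by
    have hqt' : (128 : ℝ) * 8 ^ t ≤ q ^ 2 := by exact_mod_cast hqt
    have e1 : 128 * 8 ^ t * |ε| ≤ q := by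
      calc 128 * 8 ^ t * |ε| ≤ (q : ℝ) ^ 2 * |ε| :=
            mul_le_mul_of_nonneg_right hqt' (abs_nonneg _)
        _ = q * (|ε| * q) := by ring
        _ ≤ q * 1 := mul_le_mul_of_nonneg_left hεq hq'.le
        _ = q := mul_one _
    linarith
  -- A and B arise from D/√2^t and D√2/√2^t when √2·q is replaced by p, since 1/√2^t = (α +
  -- β√2)/2^t. The error is 32·2^t·ε·(aβ + bα), and the lower bound on q² makes it at most q/2.
  have happrox : ∀ {a b : ℤ}, |a| ≤ 2 ^ t → |b| ≤ 2 ^ t →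
      |(a * A + b * B : ℝ) - D * ((a + b * Real.sqrt 2) / Real.sqrt 2 ^ t)| ≤ q / 2 := by
    intro a b ha hb
    have ha' : |(a : ℝ)| ≤ 2 ^ t := by exact_mod_cast ha
    have hb' : |(b : ℝ)| ≤ 2 ^ t := by exact_mod_cast hb
    have hα' : |(α : ℝ)| ≤ 2 ^ t := by
      rw [abs_of_nonneg (by exact_mod_cast hα0)]; exact_mod_cast hα
    have hβ' : |(β : ℝ)| ≤ 2 ^ t := by
      rw [abs_of_nonneg (by exact_mod_cast hβ0)]; exact_mod_cast hβ
    have e0 : D * ((a + b * Real.sqrt 2) / Real.sqrt 2 ^ t) =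
        32 * 2 ^ t * q * (Real.sqrt 2 ^ t * (a + b * Real.sqrt 2)) := by
      rw [hDr, h4]
      conv_lhs => rw [← sqrt_two_pow_mul_self t]
      rw [← sqrt_two_pow_mul_self t]
      field_simp
    have e1 : (a * A + b * B : ℝ) - D * ((a + b * Real.sqrt 2) / Real.sqrt 2 ^ t) =
        32 * 2 ^ t * (ε * (a * β + b * α)) := by
      rw [e0, hαβ, hA, hB, hε]
      push_cast
      linear_combination (-32 * 2 ^ t * (q : ℝ) * b * β) * hs2
    rw [e1, abs_mul, abs_of_pos (by positivity : (0 : ℝ) < 32 * 2 ^ t), abs_mul]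
    have e2 : |(a * β + b * α : ℝ)| ≤ 2 ^ t * 2 ^ t + 2 ^ t * 2 ^ t := by
      refine (abs_add_le _ _).trans ?_
      rw [abs_mul, abs_mul]
      gcongr
    calc 32 * 2 ^ t * (|ε| * |(a * β + b * α : ℝ)|)
        ≤ 32 * 2 ^ t * (|ε| * (2 ^ t * 2 ^ t + 2 ^ t * 2 ^ t)) := by gcongr
      _ = 64 * 8 ^ t * |ε| := by rw [h8]; ring
      _ ≤ q / 2 := hεs
  have hest : |M * (D * x) - acc| ≤ M * (q / 2) := by
    have e1 : |M * (D * x) - acc| = D * |(acc : ℝ) / D - M * x| := by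
      rw [← abs_of_pos hD0, ← abs_mul, abs_of_pos hD0, abs_sub_comm]
      congr 1
      field_simp
    rw [e1]
    calc D * |(acc : ℝ) / D - M * x| ≤ D * (M / (64 * 4 ^ t)) :=
          mul_le_mul_of_nonneg_left hacc hD0.le
      _ = M * (q / 2) := by rw [hDr]; field_simp; norm_num
  have hcast : (|a * (M * A) + b * (M * B) - acc| ≤ M * q) ↔
      |M * (a * A + b * B : ℝ) - acc| ≤ M * q := by
    rw [← Int.cast_le (R := ℝ)]
    push_cast
    rw [show (a : ℝ) * (M * A) + b * (M * B) - acc = M * (a * A + b * B : ℝ) - acc by ring]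
  rw [hcast]
  constructor
  · intro hle
    by_contra hne
    have s := separation hne ha hb ha₀ hb₀
    rw [← hx] at s
    set y := ((a : ℝ) + b * Real.sqrt 2) / Real.sqrt 2 ^ t with hy
    have e1 := happrox ha hb
    rw [← hy] at e1
    have e2 : |M * (a * A + b * B : ℝ) - M * (D * y)| ≤ M * (q / 2) := by
      rw [← mul_sub, abs_mul, abs_of_pos hM']
      exact mul_le_mul_of_nonneg_left e1 hM'.le
    have e3 : |(M : ℝ) * (D * y) - M * (D * x)| ≤ M * (q / 2) + M * q + M * (q / 2) := by
      have : (M : ℝ) * (D * y) - M * (D * x) = -(M * (a * A + b * B : ℝ) - M * (D * y)) +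
          (M * (a * A + b * B : ℝ) - acc) - (M * (D * x) - acc) := by ring
      rw [this]
      refine (abs_sub _ _).trans ?_
      refine add_le_add ((abs_add_le _ _).trans ?_) hest
      rw [abs_neg]
      exact add_le_add e2 hle
    have e4 : |(M : ℝ) * (D * y) - M * (D * x)| = M * (D * |y - x|) := by
      rw [← mul_sub, ← mul_sub, abs_mul, abs_mul, abs_of_pos hM', abs_of_pos hD0]
    -- By separation a wrong value lies at least 32q/5 away (per unit of M), while passing the test
    -- leaves room only for q/2 + q + q/2 = 2q.
    have e5 : M * (D * |y - x|) ≥ M * (32 * q / 5) := by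
      refine mul_le_mul_of_nonneg_left ?_ hM'.le
      rw [hDr]
      have : (32 * q / 5 : ℝ) * 1 ≤ 32 * q / 5 * (|y - x| * (5 * 4 ^ t)) :=
        mul_le_mul_of_nonneg_left s (by positivity)
      calc (32 * q / 5 : ℝ) ≤ 32 * q / 5 * (|y - x| * (5 * 4 ^ t)) := by linarith
        _ = _ := by ring
    have : 0 < (M : ℝ) * q := by positivity
    nlinarith
  · rintro ⟨rfl, rfl⟩
    have e1 := happrox ha hb
    rw [← hx] at e1
    have e2 : |M * (a * A + b * B : ℝ) - M * (D * x)| ≤ M * (q / 2) := by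
      rw [← mul_sub, abs_mul, abs_of_pos hM']
      exact mul_le_mul_of_nonneg_left e1 hM'.le
    have : M * (a * A + b * B : ℝ) - acc = (M * (a * A + b * B : ℝ) - M * (D * x)) +
        (M * (D * x) - acc) := by ring
    rw [this]
    refine (abs_add_le _ _).trans ((add_le_add e2 hest).trans (le_of_eq (by ring)))

/-! ### Expectations with respect to probability mass functions -/

/-- The expectation of a nonnegative function. -/
noncomputable def pmfE {α : Type*} (μ : PMF α) (f : α → ℝ≥0∞) : ℝ≥0∞ := ∑' a, μ a * f a

theorem pmfE_pure {α : Type*} (a : α) (f : α → ℝ≥0∞) : pmfE (PMF.pure a) f = f a := by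
  rw [pmfE, tsum_eq_single a]
  · simp
  · intro b hb
    simp [hb]

theorem pmfE_bind {α β : Type*} (μ : PMF α) (κ : α → PMF β) (f : β → ℝ≥0∞) :
    pmfE (μ.bind κ) f = pmfE μ fun a => pmfE (κ a) f := by
  simp only [pmfE, PMF.bind_apply, ← ENNReal.tsum_mul_left, ← ENNReal.tsum_mul_right]
  rw [ENNReal.tsum_comm]
  simp only [mul_assoc]

theorem pmfE_map {α β : Type*} (μ : PMF α) (g : α → β) (f : β → ℝ≥0∞) :
    pmfE (μ.map g) f = pmfE μ fun a => f (g a) := by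
  rw [← PMF.bind_pure_comp, pmfE_bind]
  simp only [Function.comp_apply, pmfE_pure]

theorem pmfE_mono {α : Type*} {μ : PMF α} {f g : α → ℝ≥0∞} (h : ∀ a ∈ μ.support, f a ≤ g a) :
    pmfE μ f ≤ pmfE μ g := by
  refine ENNReal.tsum_le_tsum fun a => ?_
  by_cases ha : μ a = 0
  · simp [ha]
  · gcongr
    exact h a ((PMF.mem_support_iff _ _).mpr ha)

theorem pmfE_const {α : Type*} (μ : PMF α) (c : ℝ≥0∞) : pmfE μ (fun _ => c) = c := by
  rw [pmfE, ENNReal.tsum_mul_right, PMF.tsum_coe, one_mul]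

theorem pmfE_add {α : Type*} (μ : PMF α) (f g : α → ℝ≥0∞) :
    pmfE μ (fun a => f a + g a) = pmfE μ f + pmfE μ g := by
  simp only [pmfE, mul_add, ENNReal.tsum_add]

theorem pmfE_mul_left {α : Type*} (μ : PMF α) (c : ℝ≥0∞) (f : α → ℝ≥0∞) :
    pmfE μ (fun a => c * f a) = c * pmfE μ f := by
  simp only [pmfE, ← ENNReal.tsum_mul_left]
  exact tsum_congr fun a => by ring

theorem pmfE_fintype {α : Type*} [Fintype α] (μ : PMF α) (f : α → ℝ≥0∞) :
    pmfE μ f = ∑ a, μ a * f a := tsum_fintype _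

open Classical in
/-- The probability that a predicate fails. -/
noncomputable def failProb {α : Type*} (μ : PMF α) (Q : α → Prop) : ℝ≥0∞ :=
  pmfE μ fun a => if Q a then 0 else 1

theorem failProb_eq_toOuterMeasure {α : Type*} (μ : PMF α) (Q : α → Prop) :
    failProb μ Q = μ.toOuterMeasure {a | ¬ Q a} := by
  rw [PMF.toOuterMeasure_apply, failProb, pmfE]
  refine tsum_congr fun a => ?_
  by_cases h : Q a <;> simp [h]

theorem failProb_le_pmfE {α : Type*} {μ : PMF α} {Q : α → Prop} {f : α → ℝ≥0∞}
    (h : ∀ a ∈ μ.support, ¬ Q a → 1 ≤ f a) : failProb μ Q ≤ pmfE μ f := by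
  refine pmfE_mono fun a ha => ?_
  split_ifs with hQ
  · exact zero_le
  · exact h a ha hQ

theorem failProb_mono {α : Type*} {μ : PMF α} {Q R : α → Prop}
    (h : ∀ a ∈ μ.support, Q a → R a) : failProb μ R ≤ failProb μ Q := by
  refine failProb_le_pmfE fun a ha hR => ?_
  rw [if_neg fun hQ => hR (h a ha hQ)]

theorem failProb_eq_zero {α : Type*} {μ : PMF α} {Q : α → Prop} (h : ∀ a ∈ μ.support, Q a) :
    failProb μ Q = 0 := by
  refine le_antisymm ((failProb_le_pmfE (f := fun _ => 0) fun a ha hQ => ?_).trans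
    (pmfE_const _ _).le) zero_le
  exact absurd (h a ha) hQ

theorem failProb_le_one {α : Type*} (μ : PMF α) (Q : α → Prop) : failProb μ Q ≤ 1 :=
  (failProb_le_pmfE (f := fun _ => 1) fun _ _ _ => le_rfl).trans (pmfE_const _ _).le

/-- Union bound for two stages: if the first stage misses R, the whole run is counted as failed. -/
theorem failProb_bind_le {α β : Type*} {μ : PMF α} {κ : α → PMF β} {R : α → Prop} {Q : β → Prop}
    {δ : ℝ≥0∞} (h : ∀ a ∈ μ.support, R a → failProb (κ a) Q ≤ δ) :
    failProb (μ.bind κ) Q ≤ failProb μ R + δ := by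
  rw [failProb, pmfE_bind, failProb]
  rw [← pmfE_const μ δ, ← pmfE_add]
  refine pmfE_mono fun a ha => ?_
  split_ifs with hR
  · rw [zero_add]
    exact h a ha hR
  · exact (failProb_le_one _ _).trans le_self_add

/-! ### Program logic -/

variable {ψ : PureState n}

/-- Every possible final store of `p`, started in `s`, satisfies `Q`. -/
def Prog.Spec (ψ : PureState n) (p : Prog) (s : Store n) (Q : Store n → Prop) : Prop :=
  ∀ s' ∈ (p.run ψ s).support, Q s'

theorem Prog.Spec.mono {p : Prog} {s : Store n} {Q R : Store n → Prop} (h : p.Spec ψ s Q)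
    (hQR : ∀ s', Q s' → R s') : p.Spec ψ s R := fun s' hs' => hQR s' (h s' hs')

theorem Prog.Spec.and {p : Prog} {s : Store n} {Q R : Store n → Prop} (h : p.Spec ψ s Q)
    (h' : p.Spec ψ s R) : p.Spec ψ s fun s' => Q s' ∧ R s' := fun s' hs' => ⟨h s' hs', h' s' hs'⟩

theorem Prog.spec_instr {i : Instr} {s : Store n} {Q : Store n → Prop} :
    (Prog.instr i).Spec ψ s Q ↔ Q (i.exec s).tick := by
  simp [Prog.Spec, Prog.run]

theorem Prog.spec_seq {p q : Prog} {s : Store n} {Q : Store n → Prop} :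
    (Prog.seq p q).Spec ψ s Q ↔ p.Spec ψ s fun s' => q.Spec ψ s' Q := by
  simp only [Prog.Spec, Prog.run, PMF.mem_support_bind_iff]
  exact ⟨fun h s' hs' s'' hs'' => h s'' ⟨s', hs', hs''⟩, fun h s'' ⟨s', hs', hs''⟩ =>
    h s' hs' s'' hs''⟩

theorem Prog.spec_ite {a b : ℕ} {p q : Prog} {s : Store n} {Q : Store n → Prop} :
    (Prog.ite a b p q).Spec ψ s Q ↔
      if s.reg a ≤ s.reg b then p.Spec ψ s.tick Q else q.Spec ψ s.tick Q := by
  simp only [Prog.Spec, Prog.run]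
  split_ifs <;> rfl

theorem Prog.spec_shot {r a : ℕ} {s : Store n} {Q : Store n → Prop} :
    (Prog.shot r a).Spec ψ s Q ↔ ∀ b ∈ (ψ.measure (s.pau (s.nat a))).support,
      Q { (s.setReg r (if b then 1 else -1)).tick with shots := s.shots + 1 } := by
  simp only [Prog.Spec, Prog.run, PMF.mem_support_map_iff]
  exact ⟨fun h b hb => h _ ⟨b, hb, rfl⟩, fun h s' ⟨b, hb, e⟩ => e ▸ h b hb⟩

theorem Prog.spec_sample {a : ℕ} {s : Store n} {Q : Store n → Prop} :
    (Prog.sample a).Spec ψ s Q ↔ ∀ P ∈ ψ.bell.support,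
      Q { (s.setPau a P).tick with samples := s.samples + 1 } := by
  simp only [Prog.Spec, Prog.run, PMF.mem_support_map_iff]
  exact ⟨fun h b hb => h _ ⟨b, hb, rfl⟩, fun h s' ⟨b, hb, e⟩ => e ▸ h b hb⟩

/-- The law after `k` rounds of a loop with body `p`. -/
noncomputable def Prog.rounds (ψ : PureState n) (p : Prog) (k : ℕ) (s : Store n) : PMF (Store n) :=
  (fun μ => μ.bind fun s' => p.run ψ s'.tick)^[k] (PMF.pure s)

theorem Prog.run_loop (a : ℕ) (p : Prog) (s : Store n) :
    (Prog.loop a p).run ψ s = p.rounds ψ (s.nat a) s.tick := rfl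

theorem Prog.rounds_zero (p : Prog) (s : Store n) : p.rounds ψ 0 s = PMF.pure s := rfl

theorem Prog.rounds_succ (p : Prog) (k : ℕ) (s : Store n) :
    p.rounds ψ (k + 1) s = (p.rounds ψ k s).bind fun s' => p.run ψ s'.tick := by
  rw [Prog.rounds, Function.iterate_succ_apply']
  rfl

theorem Prog.rounds_support {p : Prog} {k : ℕ} {s : Store n} (I : ℕ → Store n → Prop) (h0 : I 0 s)
    (hstep : ∀ j < k, ∀ s', I j s' → p.Spec ψ s'.tick (I (j + 1))) :
    ∀ s' ∈ (p.rounds ψ k s).support, I k s' := by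
  induction k with
  | zero =>
    intro s' hs'
    rw [Prog.rounds_zero, PMF.support_pure, Set.mem_singleton_iff] at hs'
    rwa [hs']
  | succ k ih =>
    intro s' hs'
    rw [Prog.rounds_succ, PMF.mem_support_bind_iff] at hs'
    obtain ⟨s'', h1, h2⟩ := hs'
    exact hstep k k.lt_succ_self s'' (ih (fun j hj => hstep j (hj.trans k.lt_succ_self)) s'' h1)
      s' h2

theorem Prog.spec_loop_basic {a : ℕ} {p : Prog} {s : Store n} {Q : Store n → Prop}
    (I : ℕ → Store n → Prop) (h0 : I 0 s.tick)
    (hstep : ∀ j < s.nat a, ∀ s', I j s' → p.Spec ψ s'.tick (I (j + 1)))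
    (hQ : ∀ s', I (s.nat a) s' → Q s') : (Prog.loop a p).Spec ψ s Q :=
  fun s' hs' => hQ s' (Prog.rounds_support I h0 hstep s' hs')

/-! ### What a program leaves unchanged -/

/-- Whether an instruction writes register `r`. -/
def Instr.writes (r : ℕ) : Instr → Bool
  | .const r' _ => r' == r
  | .add r' _ _ => r' == r
  | .sub r' _ _ => r' == r
  | .load r' _ => r' == r
  | .store _ _ => false
  | .setX _ _ => false
  | .setZ _ _ => false
  | .mul _ _ _ => false
  | .getX r' _ _ => r' == r
  | .getZ r' _ _ => r' == r
  | .comm r' _ _ => r' == r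

/-- Whether a program may write register `r`. -/
def Prog.writes (r : ℕ) : Prog → Bool
  | .instr i => i.writes r
  | .sample _ => false
  | .shot r' _ => r' == r
  | .seq p q => p.writes r || q.writes r
  | .ite _ _ p q => p.writes r || q.writes r
  | .loop _ p => p.writes r

/-- Whether an instruction writes the integer array. -/
def Instr.writesArr : Instr → Bool
  | .store _ _ => true
  | _ => false

/-- Whether a program may write the integer array. -/
def Prog.writesArr : Prog → Bool
  | .instr i => i.writesArr
  | .sample _ => false
  | .shot _ _ => false
  | .seq p q => p.writesArr || q.writesArr
  | .ite _ _ p q => p.writesArr || q.writesArr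
  | .loop _ p => p.writesArr

/-- Whether an instruction writes the Pauli array. -/
def Instr.writesPau : Instr → Bool
  | .setX _ _ => true
  | .setZ _ _ => true
  | .mul _ _ _ => true
  | _ => false

/-- Whether a program may write the Pauli array. -/
def Prog.writesPau : Prog → Bool
  | .instr i => i.writesPau
  | .sample _ => true
  | .shot _ _ => false
  | .seq p q => p.writesPau || q.writesPau
  | .ite _ _ p q => p.writesPau || q.writesPau
  | .loop _ p => p.writesPau

/-- Whether a program may take samples. -/
def Prog.samples : Prog → Bool
  | .instr _ => false
  | .sample _ => true
  | .shot _ _ => false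
  | .seq p q => p.samples || q.samples
  | .ite _ _ p q => p.samples || q.samples
  | .loop _ p => p.samples

/-- The part of the store that `p` leaves alone is the same in `s` and `s'`. -/
structure Prog.Frame (p : Prog) (s s' : Store n) : Prop where
  reg : ∀ r, p.writes r = false → s'.reg r = s.reg r
  arr : p.writesArr = false → s'.arr = s.arr
  pau : p.writesPau = false → s'.pau = s.pau
  samples : p.samples = false → s'.samples = s.samples

theorem Instr.frame (i : Instr) (s : Store n) : (Prog.instr i).Frame s (i.exec s).tick := by
  constructor
  · intro r h
    have h' : i.writes r = false := h
    cases i <;> first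
      | rfl
      | exact Function.update_of_ne (fun e => by simp [Instr.writes, e] at h') _ _
  · intro h
    cases i <;>
      simp_all [Prog.writesArr, Instr.writesArr, Instr.exec, Store.tick, Store.setReg, Store.setPau]
  · intro h
    cases i <;>
      simp_all [Prog.writesPau, Instr.writesPau, Instr.exec, Store.tick, Store.setReg]
  · intro _
    cases i <;> simp [Instr.exec, Store.tick, Store.setReg, Store.setPau]

/-- What a program may change is read off its text. Questions whether a register, an array or the
sample counter survives thus become computations with Booleans, settled by `rfl` or `decide`. -/
theorem Prog.spec_frame (ψ : PureState n) (p : Prog) (s : Store n) : p.Spec ψ s (p.Frame s) := by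
  induction p generalizing s with
  | instr i => exact Prog.spec_instr.mpr (i.frame s)
  | sample a =>
    refine Prog.spec_sample.mpr fun P _ => ⟨fun _ _ => rfl, fun _ => rfl, fun h => ?_, fun h => ?_⟩
    · simp [Prog.writesPau] at h
    · simp [Prog.samples] at h
  | shot r a =>
    refine Prog.spec_shot.mpr fun P _ => ⟨fun r' h => ?_, fun _ => rfl, fun _ => rfl, fun _ => rfl⟩
    have : r ≠ r' := by simpa [Prog.writes] using h
    exact Function.update_of_ne this.symm _ _
  | seq p q hp hq =>
    refine Prog.spec_seq.mpr ((hp s).mono fun s' h => (hq s').mono fun s'' h' => ?_)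
    constructor
    · intro r hr
      simp only [Prog.writes, Bool.or_eq_false_iff] at hr
      rw [h'.reg r hr.2, h.reg r hr.1]
    · intro hr
      simp only [Prog.writesArr, Bool.or_eq_false_iff] at hr
      rw [h'.arr hr.2, h.arr hr.1]
    · intro hr
      simp only [Prog.writesPau, Bool.or_eq_false_iff] at hr
      rw [h'.pau hr.2, h.pau hr.1]
    · intro hr
      simp only [Prog.samples, Bool.or_eq_false_iff] at hr
      rw [h'.samples hr.2, h.samples hr.1]
  | ite a b p q hp hq =>
    rw [Prog.spec_ite]
    split_ifs
    · refine (hp s.tick).mono fun s' h => ⟨fun r hr => ?_, fun hr => ?_, fun hr => ?_, fun hr => ?_⟩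
      · simp only [Prog.writes, Bool.or_eq_false_iff] at hr
        exact h.reg r hr.1
      · simp only [Prog.writesArr, Bool.or_eq_false_iff] at hr
        exact h.arr hr.1
      · simp only [Prog.writesPau, Bool.or_eq_false_iff] at hr
        exact h.pau hr.1
      · simp only [Prog.samples, Bool.or_eq_false_iff] at hr
        exact h.samples hr.1
    · refine (hq s.tick).mono fun s' h => ⟨fun r hr => ?_, fun hr => ?_, fun hr => ?_, fun hr => ?_⟩
      · simp only [Prog.writes, Bool.or_eq_false_iff] at hr
        exact h.reg r hr.2
      · simp only [Prog.writesArr, Bool.or_eq_false_iff] at hr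
        exact h.arr hr.2
      · simp only [Prog.writesPau, Bool.or_eq_false_iff] at hr
        exact h.pau hr.2
      · simp only [Prog.samples, Bool.or_eq_false_iff] at hr
        exact h.samples hr.2
  | loop a p hp =>
    refine Prog.spec_loop_basic (fun _ => p.Frame s) ⟨fun _ _ => rfl, fun _ => rfl, fun _ => rfl,
      fun _ => rfl⟩ (fun _ _ s' h => (hp s'.tick).mono fun s'' h' => ?_) fun s' h => ?_
    · constructor
      · intro r hr
        exact (h'.reg r hr).trans (h.reg r hr)
      · intro hr
        exact (h'.arr hr).trans (h.arr hr)
      · intro hr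
        exact (h'.pau hr).trans (h.pau hr)
      · intro hr
        exact (h'.samples hr).trans (h.samples hr)
    · exact ⟨h.reg, h.arr, h.pau, h.samples⟩

theorem Prog.Frame.trans_tick {p : Prog} {s s' s'' : Store n} (h : p.Frame s s')
    (h' : p.Frame s'.tick s'') : p.Frame s s'' :=
  ⟨fun r hr => (h'.reg r hr).trans (h.reg r hr), fun hr => (h'.arr hr).trans (h.arr hr),
    fun hr => (h'.pau hr).trans (h.pau hr), fun hr => (h'.samples hr).trans (h.samples hr)⟩

theorem Prog.Frame.refl_tick (p : Prog) (s : Store n) : p.Frame s s.tick :=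
  ⟨fun _ _ => rfl, fun _ => rfl, fun _ => rfl, fun _ => rfl⟩

/-- The loop rule: an invariant may be combined with the frame of the body. -/
theorem Prog.spec_loop {a : ℕ} {p : Prog} {s : Store n} {Q : Store n → Prop}
    (I : ℕ → Store n → Prop) (h0 : I 0 s.tick)
    (hstep : ∀ j < s.nat a, ∀ s', I j s' → p.Frame s s' → p.Spec ψ s'.tick (I (j + 1)))
    (hQ : ∀ s', I (s.nat a) s' → p.Frame s s' → Q s') : (Prog.loop a p).Spec ψ s Q :=
  Prog.spec_loop_basic (fun j s' => I j s' ∧ p.Frame s s') ⟨h0, Prog.Frame.refl_tick p s⟩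
    (fun j hj s' h => (hstep j hj s' h.1 h.2).and
      ((p.spec_frame ψ s'.tick).mono fun _ h' => h.2.trans_tick h'))
    fun s' h => hQ s' h.1 h.2

/-- Sequencing, with the frame of the first part at hand. -/
theorem Prog.spec_seq_frame {p q : Prog} {s : Store n} {Q R : Store n → Prop} (h : p.Spec ψ s R)
    (hq : ∀ s', R s' → p.Frame s s' → q.Spec ψ s' Q) : (Prog.seq p q).Spec ψ s Q :=
  Prog.spec_seq.mpr ((h.and (p.spec_frame ψ s)).mono fun s' h' => hq s' h'.1 h'.2)

/-! ### Failure probabilities of programs -/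

theorem Prog.failProb_seq_le {p q : Prog} {s : Store n} {Q R : Store n → Prop} {δ δ' : ℝ≥0∞}
    (hp : failProb (p.run ψ s) R ≤ δ)
    (hq : ∀ s' ∈ (p.run ψ s).support, R s' → failProb (q.run ψ s') Q ≤ δ') :
    failProb ((Prog.seq p q).run ψ s) Q ≤ δ + δ' :=
  (failProb_bind_le hq).trans (add_le_add_left hp δ')

/-- Sequencing after a part that never fails. -/
theorem Prog.failProb_seq_of_spec {p q : Prog} {s : Store n} {Q R : Store n → Prop} {δ : ℝ≥0∞}
    (hp : p.Spec ψ s R) (hq : ∀ s', R s' → p.Frame s s' → failProb (q.run ψ s') Q ≤ δ) :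
    failProb ((Prog.seq p q).run ψ s) Q ≤ δ := by
  have := Prog.failProb_seq_le (δ := 0) (failProb_eq_zero (hp.and (p.spec_frame ψ s))).le
    fun s' _ h => hq s' h.1 h.2
  rwa [zero_add] at this

theorem Prog.failProb_rounds_le {p : Prog} {k : ℕ} {s : Store n} {δ : ℝ≥0∞}
    (I : ℕ → Store n → Prop) (h0 : I 0 s)
    (hstep : ∀ j < k, ∀ s', I j s' → failProb (p.run ψ s'.tick) (I (j + 1)) ≤ δ) :
    failProb (p.rounds ψ k s) (I k) ≤ k * δ := by
  induction k with
  | zero =>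
    rw [Prog.rounds_zero, failProb, pmfE_pure, if_pos h0]
    exact zero_le
  | succ k ih =>
    rw [Prog.rounds_succ]
    refine (failProb_bind_le (R := I k) fun s' _ h => hstep k k.lt_succ_self s' h).trans ?_
    rw [Nat.cast_succ, add_mul, one_mul]
    exact add_le_add_left (ih fun j hj => hstep j (hj.trans k.lt_succ_self)) δ

theorem Prog.failProb_loop_le {a : ℕ} {p : Prog} {s : Store n} {δ : ℝ≥0∞}
    (I : ℕ → Store n → Prop) (h0 : I 0 s.tick)
    (hstep : ∀ j < s.nat a, ∀ s', I j s' → p.Frame s s' →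
      failProb (p.run ψ s'.tick) (I (j + 1)) ≤ δ) :
    failProb ((Prog.loop a p).run ψ s) (fun s' => I (s.nat a) s' ∧ p.Frame s s') ≤
      s.nat a * δ := by
  refine Prog.failProb_rounds_le (fun j s' => I j s' ∧ p.Frame s s') ⟨h0, Prog.Frame.refl_tick p s⟩
    fun j hj s' h => ?_
  refine (failProb_mono fun s'' hs'' h' => ?_).trans (hstep j hj s' h.1 h.2)
  exact ⟨h', h.2.trans_tick (p.spec_frame ψ s'.tick s'' hs'')⟩

/-- Growth of an expectation over the rounds of a loop. -/
theorem Prog.pmfE_rounds_le {p : Prog} {k : ℕ} {s : Store n} {ρ : ℝ≥0∞}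
    (I : ℕ → Store n → Prop) (Φ : ℕ → Store n → ℝ≥0∞) (h0 : I 0 s)
    (hI : ∀ j < k, ∀ s', I j s' → p.Spec ψ s'.tick (I (j + 1)))
    (hΦ : ∀ j < k, ∀ s', I j s' → pmfE (p.run ψ s'.tick) (Φ (j + 1)) ≤ ρ * Φ j s') :
    pmfE (p.rounds ψ k s) (Φ k) ≤ ρ ^ k * Φ 0 s := by
  induction k with
  | zero => rw [Prog.rounds_zero, pmfE_pure, pow_zero, one_mul]
  | succ k ih =>
    rw [Prog.rounds_succ, pmfE_bind]
    have hs := Prog.rounds_support I h0 fun j hj => hI j (hj.trans k.lt_succ_self)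
    refine (pmfE_mono fun s' hs' => hΦ k k.lt_succ_self s' (hs s' hs')).trans ?_
    rw [pmfE_mul_left, pow_succ', mul_assoc]
    exact mul_le_mul_right (ih (fun j hj => hI j (hj.trans k.lt_succ_self)) fun j hj =>
      hΦ j (hj.trans k.lt_succ_self)) ρ

/-! ### Running time -/

/-- The program is certain to take a sample or a shot. -/
def Prog.takes : Prog → Bool
  | .instr _ => false
  | .sample _ => true
  | .shot _ _ => true
  | .seq p q => p.takes || q.takes
  | .ite _ _ p q => p.takes && q.takes
  | .loop _ _ => false

/-- Every round of every loop takes a sample or a shot. -/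
def Prog.paid : Prog → Bool
  | .instr _ => true
  | .sample _ => true
  | .shot _ _ => true
  | .seq p q => p.paid && q.paid
  | .ite _ _ p q => p.paid && q.paid
  | .loop _ p => p.paid && p.takes

/-- The number of samples and shots taken so far. -/
def Store.data (s : Store n) : ℕ := s.samples + s.shots

theorem Instr.data_exec (i : Instr) (s : Store n) :
    (i.exec s).tick.data = s.data ∧ (i.exec s).tick.steps = s.steps + 1 := by
  cases i <;> exact ⟨rfl, rfl⟩

/-- Amortized analysis by induction on the text. A loop adds no cost of its own, since each round
takes at least one sample or shot and its fixed overhead is charged to that. The constants depend on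
the program alone, not on n, ψ or the store. -/
theorem Prog.steps_le (p : Prog) (hp : p.paid = true) :
    ∃ C c : ℕ, ∀ (n : ℕ) (ψ : PureState n) (s : Store n), p.Spec ψ s fun s' =>
      s.data ≤ s'.data ∧ (p.takes = true → s.data < s'.data) ∧
      s'.steps + C * s.data ≤ s.steps + C * s'.data + c := by
  induction p with
  | instr i =>
    refine ⟨0, 1, fun n ψ s => Prog.spec_instr.mpr ?_⟩
    obtain ⟨h1, h2⟩ := i.data_exec s
    simp [h1, h2, Prog.takes]
  | sample a =>
    refine ⟨0, 1, fun n ψ s => Prog.spec_sample.mpr fun P _ => ?_⟩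
    simp only [Store.data, Store.tick, Store.setPau]
    omega
  | shot r a =>
    refine ⟨0, 1, fun n ψ s => Prog.spec_shot.mpr fun P _ => ?_⟩
    simp only [Store.data, Store.tick, Store.setReg]
    omega
  | seq p q ihp ihq =>
    simp only [Prog.paid, Bool.and_eq_true] at hp
    obtain ⟨C₁, c₁, h₁⟩ := ihp hp.1
    obtain ⟨C₂, c₂, h₂⟩ := ihq hp.2
    refine ⟨C₁ + C₂, c₁ + c₂, fun n ψ s => Prog.spec_seq.mpr ((h₁ n ψ s).mono
      fun s' h' => (h₂ n ψ s').mono fun s'' h'' => ⟨h'.1.trans h''.1, ?_, ?_⟩)⟩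
    · intro ht
      simp only [Prog.takes, Bool.or_eq_true] at ht
      rcases ht with ht | ht
      · exact (h'.2.1 ht).trans_le h''.1
      · exact h'.1.trans_lt (h''.2.1 ht)
    · have e1 := Nat.mul_le_mul_left C₁ h''.1
      have e2 := Nat.mul_le_mul_left C₂ h'.1
      have e3 := h'.2.2
      have e4 := h''.2.2
      simp only [add_mul]
      omega
  | ite a b p q ihp ihq =>
    simp only [Prog.paid, Bool.and_eq_true] at hp
    obtain ⟨C₁, c₁, h₁⟩ := ihp hp.1
    obtain ⟨C₂, c₂, h₂⟩ := ihq hp.2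
    refine ⟨C₁ + C₂, c₁ + c₂ + 1, fun n ψ s => ?_⟩
    rw [Prog.spec_ite]
    split_ifs
    · refine (h₁ n ψ s.tick).mono fun s' h' => ⟨h'.1, fun ht => ?_, ?_⟩
      · simp only [Prog.takes, Bool.and_eq_true] at ht
        exact h'.2.1 ht.1
      · have e1 := Nat.mul_le_mul_left C₂ h'.1
        have e3 := h'.2.2
        simp only [add_mul, Store.tick, Store.data] at *
        omega
    · refine (h₂ n ψ s.tick).mono fun s' h' => ⟨h'.1, fun ht => ?_, ?_⟩
      · simp only [Prog.takes, Bool.and_eq_true] at ht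
        exact h'.2.1 ht.2
      · have e1 := Nat.mul_le_mul_left C₁ h'.1
        have e3 := h'.2.2
        simp only [add_mul, Store.tick, Store.data] at *
        omega
  | loop a p ih =>
    simp only [Prog.paid, Bool.and_eq_true] at hp
    obtain ⟨C, c, h⟩ := ih hp.1
    -- Each round pays the overhead c of the body and one step for the round itself; the additive 1
    -- is the start of the loop.
    refine ⟨C + c + 1, 1, fun n ψ s => ?_⟩
    refine Prog.spec_loop_basic (fun _ s' => s.data ≤ s'.data ∧
      s'.steps + (C + c + 1) * s.data ≤ s.steps + (C + c + 1) * s'.data + 1)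
      ⟨le_rfl, by simp only [Store.tick, Store.data]; omega⟩ (fun _ _ s' h' =>
        (h n ψ s'.tick).mono fun s'' h'' => ?_) fun s' h' => ⟨h'.1, fun ht => ?_, h'.2⟩
    · have e1 : s'.data < s''.data := h''.2.1 hp.2
      have e2 := Nat.mul_le_mul_left (c + 1) (Nat.succ_le_of_lt e1)
      have e3 : s''.steps + C * s'.data ≤ s'.steps + 1 + C * s''.data + c := h''.2.2
      have e4 := h'.2
      refine ⟨h'.1.trans e1.le, ?_⟩
      rw [Nat.succ_eq_add_one, mul_add, mul_one] at e2
      simp only [add_assoc C c 1] at e4 ⊢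
      simp only [add_mul C] at e4 ⊢
      omega
    · simp [Prog.takes] at ht

/-! ### Registers of the learner -/

infixr:60 "⨾" => Prog.seq

notation "rN" => (0 : ℕ)
notation "rT" => (1 : ℕ)
notation "rOne" => (2 : ℕ)
notation "rZero" => (3 : ℕ)
notation "rTwoN" => (4 : ℕ)
notation "rId" => (5 : ℕ)
notation "rVec" => (6 : ℕ)
notation "rRef" => (7 : ℕ)
notation "rBase" => (8 : ℕ)
notation "rSize" => (9 : ℕ)
notation "rM" => (10 : ℕ)
notation "rPiv" => (11 : ℕ)
notation "rIdx" => (12 : ℕ)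
notation "rBit" => (13 : ℕ)
notation "rI" => (14 : ℕ)
notation "rJ" => (15 : ℕ)
notation "rJunk" => (16 : ℕ)
notation "rCnt" => (17 : ℕ)

/-! ### Elimination

The pool is the segment of `rSize` cells from `rBase` on. A vector is processed by multiplying
one of the pool elements that anticommute with it (the pivot) onto the others. The pivot is
then removed and the vector is put into the cell that becomes free. -/

/-- One round of the elimination. Every round of every loop of the learner measures once. -/
def elimBody : Prog :=
  .shot rJunk rId ⨾ .instr (.comm rBit rIdx rVec) ⨾
  .ite rOne rBit
    (.ite rZero rPiv (.instr (.mul rIdx rIdx rPiv)) (.instr (.add rPiv rIdx rZero)))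
    (.instr (.const rJunk 0)) ⨾
  .instr (.add rIdx rIdx rOne)

/-- Restriction of the pool to the commutant of the vector at `rVec`. -/
def elim : Prog :=
  .instr (.sub rPiv rZero rOne) ⨾ .instr (.add rIdx rBase rZero) ⨾ .loop rSize elimBody ⨾
  .ite rZero rPiv
    (.instr (.sub rSize rSize rOne) ⨾ .instr (.add rIdx rBase rSize) ⨾
      .instr (.mul rPiv rIdx rId) ⨾ .instr (.mul rIdx rVec rId))
    (.instr (.const rJunk 0))

/-- Invariant of the elimination loop after `j` rounds. -/
structure ElimInv (s : Store n) (b k : ℕ) (x : Pauli n) (j : ℕ) (s' : Store n) : Prop where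
  idx : s'.reg rIdx = ((b + j : ℕ) : ℤ)
  shots : s'.shots = s.shots + j
  span : cellSpan s'.pau b k = cellSpan s.pau b k
  out : ∀ i, ¬ (b ≤ i ∧ i < b + k) → s'.pau i = s.pau i
  piv : (s'.reg rPiv = -1 ∧ ∀ i, b ≤ i → i < b + j → (s'.pau i).symp x = 0) ∨
    ∃ p : ℕ, b ≤ p ∧ p < b + j ∧ s'.reg rPiv = p ∧ (s'.pau p).symp x ≠ 0 ∧
      ∀ i, b ≤ i → i < b + j → i ≠ p → (s'.pau i).symp x = 0

theorem zmod_two_val_ge_one {x : ZMod 2} : (1 : ℤ) ≤ (x.val : ℤ) ↔ x ≠ 0 := by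
  revert x; decide

/-- The content -1 of `rPiv` means that no pivot has been found. The first cell that anticommutes
with x becomes the pivot; every later one is multiplied by the pivot, after which it commutes with x
because two anticommutations cancel. The span does not change. -/
theorem elimBody_spec {s s' : Store n} {b k j v : ℕ} (hj : j < k) (h1 : s'.reg rOne = 1)
    (h0 : s'.reg rZero = 0) (hv : s'.reg rVec = v)
    (hvo : ¬ (b ≤ v ∧ v < b + k)) (h : ElimInv s b k (s.pau v) j s') :
    elimBody.Spec ψ s'.tick (ElimInv s b k (s.pau v) (j + 1)) := by
  obtain ⟨hidx, hshots, hspan, hout, hpiv⟩ := h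
  have hx : s'.pau v = s.pau v := hout v hvo
  simp only [elimBody, Prog.spec_seq, Prog.spec_shot, Prog.spec_instr, Prog.spec_ite]
  intro o _
  simp only [Instr.exec, Store.setReg, Store.setPau, Store.tick, Store.nat, Function.update_apply,
    Nat.reduceEqDiff, if_true, if_false, h1, h0, hv, hidx, hx, Int.toNat_natCast,
    zmod_two_val_ge_one]
  have hb : (b : ℕ) ≤ b + j ∧ b + j < b + k := ⟨by omega, by omega⟩
  generalize (if o = true then (1 : ℤ) else -1) = w
  split_ifs with hc hp
  · rcases hpiv with ⟨hp1, _⟩ | ⟨p, hp1, hp2, hp3, hp4, hp5⟩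
    · rw [hp1] at hp
      exact absurd hp (by norm_num)
    · rw [hp3, Int.toNat_natCast]
      refine ⟨by simp [add_assoc], by simp [hshots, add_assoc], ?_, ?_, Or.inr ⟨p, hp1, by omega,
        by simpa using hp3, ?_, ?_⟩⟩
      · rw [← hspan]
        exact cellSpan_update_add _ ⟨hp1, by omega⟩ hb (by omega)
      · intro i hi
        rw [← hout i hi]
        exact Function.update_of_ne (by rintro rfl; exact hi hb) _ _
      · simpa [Function.update_of_ne (show p ≠ b + j by omega)] using hp4
      · intro i hi1 hi2 hip
        by_cases hij : i = b + j
        · subst hij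
          simp only [Function.update_self, Pauli.symp_add_left]
          have e : ∀ y z : ZMod 2, y ≠ 0 → z ≠ 0 → y + z = 0 := by decide
          exact e _ _ hc hp4
        · simp only [Function.update_of_ne hij]
          exact hp5 i hi1 (by omega) hip
  · rcases hpiv with ⟨hp1, hp2⟩ | ⟨p, hp1, hp2, hp3, hp4, hp5⟩
    · refine ⟨by simp [add_assoc], by simp [hshots, add_assoc], hspan, hout, Or.inr ⟨b + j, hb.1,
        by omega, by simp, hc, ?_⟩⟩
      intro i hi1 hi2 hip
      exact hp2 i hi1 (by omega)
    · rw [hp3] at hp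
      exact absurd (Int.natCast_nonneg p) hp
  · refine ⟨by simp [add_assoc], by simp [hshots, add_assoc], hspan, hout, ?_⟩
    have hc' : (s'.pau (b + j)).symp (s.pau v) = 0 := not_not.mp hc
    rcases hpiv with ⟨hp1, hp2⟩ | ⟨p, hp1, hp2, hp3, hp4, hp5⟩
    · refine Or.inl ⟨by simpa using hp1, fun i hi1 hi2 => ?_⟩
      by_cases hij : i = b + j
      · rw [hij]; exact hc'
      · exact hp2 i hi1 (by omega)
    · refine Or.inr ⟨p, hp1, by omega, by simpa using hp3, hp4, fun i hi1 hi2 hip => ?_⟩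
      by_cases hij : i = b + j
      · rw [hij]; exact hc'
      · exact hp5 i hi1 (by omega) hip

/-- Result of an elimination: the pool of `k` cells from `b` on is cut down to the commutant of
`x`, and `x` is recorded if the pool has changed. -/
structure ElimPost (s : Store n) (b k : ℕ) (x : Pauli n) (s' : Store n) : Prop where
  shots : s'.shots = s.shots + k
  out : ∀ i, ¬ (b ≤ i ∧ i < b + k) → s'.pau i = s.pau i
  size : ∃ k' : ℕ, s'.reg rSize = k' ∧ cellSpan s'.pau b k' = cellSpan s.pau b k ⊓ perp {x} ∧
    (k' = k ∧ cellSpan s.pau b k ≤ perp {x} ∨ k = k' + 1 ∧ s'.pau (b + k') = x)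

/-- After the loop at most the pivot anticommutes with x, so dropping it leaves the part of the span
that commutes with x. The last cell moves into the gap and x takes its place, which lets pool and
records share one segment. Copying is multiplication by the identity cell z, so x and that cell must
lie outside the pool. -/
theorem elim_spec {s : Store n} {b k v z : ℕ} (h1 : s.reg rOne = 1) (h0 : s.reg rZero = 0)
    (hb : s.reg rBase = b) (hk : s.reg rSize = k) (hv : s.reg rVec = v) (hz : s.reg rId = z)
    (hvo : ¬ (b ≤ v ∧ v < b + k)) (hzo : ¬ (b ≤ z ∧ z < b + k)) (hz0 : s.pau z = 0) :
    elim.Spec ψ s (ElimPost s b k (s.pau v)) := by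
  rw [elim, Prog.spec_seq, Prog.spec_instr, Prog.spec_seq, Prog.spec_instr]
  simp only [Instr.exec, Store.setReg, Store.tick, Function.update_apply,
    Nat.reduceEqDiff, if_false, h1, h0, hb]
  refine Prog.spec_seq.mpr (Prog.spec_loop (ElimInv s b k (s.pau v)) ?_ ?_ ?_)
  · exact ⟨by simp [Store.tick], rfl, rfl, fun _ _ => rfl, Or.inl ⟨by simp [Store.tick],
      fun i hi1 hi2 => absurd hi2 (by omega)⟩⟩
  · intro j hj s' hI hF
    refine elimBody_spec ?_ ?_ ?_ ?_ hvo hI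
    · simpa [Store.nat, hk] using hj
    · rw [hF.reg rOne rfl]; simpa using h1
    · rw [hF.reg rZero rfl]; simpa using h0
    · rw [hF.reg rVec rfl]; simpa using hv
  · intro s' hI hF
    have hkk : (s.reg rSize).toNat = k := by rw [hk]; rfl
    simp only [Store.nat, Function.update_apply, Nat.reduceEqDiff, if_false, hkk] at hI
    have f1 : s'.reg rOne = 1 := by rw [hF.reg rOne rfl]; simpa using h1
    have f0 : s'.reg rZero = 0 := by rw [hF.reg rZero rfl]; simpa using h0
    have fb : s'.reg rBase = b := by rw [hF.reg rBase rfl]; simpa using hb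
    have fk : s'.reg rSize = k := by rw [hF.reg rSize rfl]; simpa using hk
    have fv : s'.reg rVec = v := by rw [hF.reg rVec rfl]; simpa using hv
    have fz : s'.reg rId = z := by rw [hF.reg rId rfl]; simpa using hz
    have pv : s'.pau v = s.pau v := hI.out v hvo
    have pz : s'.pau z = 0 := by rw [hI.out z hzo, hz0]
    simp only [Prog.spec_seq, Prog.spec_instr, Prog.spec_ite, f0]
    rcases hI.piv with ⟨hp1, hp2⟩ | ⟨p, hp1, hp2, hp3, hp4, hp5⟩
    · rw [if_neg (by rw [hp1]; norm_num)]
      have hle : cellSpan s.pau b k ≤ perp {s.pau v} := by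
        rw [← hI.span]
        refine Submodule.span_le.mpr ?_
        rintro _ ⟨i, ⟨hi1, hi2⟩, rfl⟩ a rfl
        rw [Pauli.symp_comm]
        exact hp2 i hi1 hi2
      refine ⟨hI.shots, hI.out, k, ?_, ?_, Or.inl ⟨rfl, hle⟩⟩
      · simpa [Instr.exec, Store.tick, Store.setReg] using fk
      · change cellSpan s'.pau b k = _
        rw [hI.span, inf_eq_left.mpr hle]
    · rw [if_pos (by rw [hp3]; exact Int.natCast_nonneg p)]
      obtain ⟨k', rfl⟩ : ∃ k', k = k' + 1 := ⟨k - 1, by omega⟩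
      have e1 : ((k' + 1 : ℕ) : ℤ) - 1 = (k' : ℕ) := by push_cast; ring
      have e2 : (b : ℤ) + (k' : ℕ) = ((b + k' : ℕ) : ℤ) := by push_cast; ring
      have hvp : v ≠ p := by omega
      have hzp : z ≠ p := by omega
      simp only [Instr.exec, Store.setReg, Store.setPau, Store.tick, Store.nat,
        Function.update_apply, Nat.reduceEqDiff, if_true, if_false, f1, fb, fk, fv, fz, hp3, e1, e2,
        Int.toNat_natCast, pv, pz, hvp, hzp, add_zero]
      refine ⟨hI.shots, fun i hi => ?_, k', by simp, ?_, Or.inr ⟨rfl, by simp⟩⟩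
      · rw [← hI.out i hi]
        change Function.update (Function.update s'.pau p _) (b + k') _ i = s'.pau i
        rw [Function.update_of_ne (by omega), Function.update_of_ne (by omega)]
      · rw [← hI.span]
        refine cellSpan_remove (p := p) ⟨hp1, hp2⟩ (by rwa [Pauli.symp_comm]) ?_ ?_ ?_
        · intro i hi1 hi2 hip
          rw [Pauli.symp_comm]; exact hp5 i hi1 hi2 hip
        · intro hp
          change Function.update (Function.update s'.pau p _) (b + k') _ p = _
          rw [Function.update_of_ne hp, Function.update_self]
        · intro i hi1 hi2 hip
          change Function.update (Function.update s'.pau p _) (b + k') _ i = _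
          rw [Function.update_of_ne (by omega), Function.update_of_ne hip]

/-! ### Initialization -/

/-- Repeated doubling of register `r`. -/
def double (a r : ℕ) : Prog := .loop a (.shot rJunk rId ⨾ .instr (.add r r r))

/-- The machine has no multiplication, so powers of two come from repeated addition. Each round also
measures, to pay for itself, and overwrites `rJunk`. -/
theorem double_spec {a r : ℕ} (hr : r ≠ rJunk) {s : Store n} {k : ℕ} (ha : s.reg a = k) :
    (double a r).Spec ψ s fun s' => s'.reg r = 2 ^ k * s.reg r ∧ s'.shots = s.shots + k := by
  have hk : s.nat a = k := by rw [Store.nat, ha]; rfl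
  refine Prog.spec_loop (fun j s' => s'.reg r = 2 ^ j * s.reg r ∧ s'.shots = s.shots + j) ?_ ?_ ?_
  · simp [Store.tick]
  · rintro j _ s' ⟨h1, h2⟩ _
    simp only [Prog.spec_seq, Prog.spec_shot, Prog.spec_instr]
    intro o _
    simp only [Instr.exec, Store.setReg, Store.tick, Function.update_apply, hr, if_true, if_false,
      h1, h2]
    constructor
    · ring
    · ring
  · rintro s' h _
    rwa [hk] at h

/-- The registers that keep their values throughout the run. -/
structure Consts (t : ℕ) (s : Store n) : Prop where
  qubits : s.reg rN = n
  gates : s.reg rT = t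
  one : s.reg rOne = 1
  zero : s.reg rZero = 0
  twoN : s.reg rTwoN = ((2 * n : ℕ) : ℤ)
  idAddr : s.reg rId = ((4 * n : ℕ) : ℤ)

theorem Consts.of_frame {t : ℕ} {s s' : Store n} (h : Consts t s) {p : Prog} (hF : p.Frame s s')
    (hp : ∀ r < 6, p.writes r = false) : Consts t s' :=
  ⟨(hF.reg 0 (hp 0 (by norm_num))).trans h.qubits, (hF.reg 1 (hp 1 (by norm_num))).trans h.gates,
    (hF.reg 2 (hp 2 (by norm_num))).trans h.one, (hF.reg 3 (hp 3 (by norm_num))).trans h.zero,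
    (hF.reg 4 (hp 4 (by norm_num))).trans h.twoN, (hF.reg 5 (hp 5 (by norm_num))).trans h.idAddr⟩

/-- One round of filling the pool with the standard generators. -/
def fillBody : Prog :=
  .shot rJunk rId ⨾ .instr (.setX rI rI) ⨾ .instr (.setZ rJ rI) ⨾ .instr (.add rI rI rOne) ⨾
    .instr (.add rJ rJ rOne)

/-- The constants of the run and the standard generators of the Pauli group. -/
def initPool : Prog :=
  .instr (.const rOne 1) ⨾ .instr (.const rZero 0) ⨾ .instr (.add rTwoN rN rN) ⨾
  .instr (.add rId rTwoN rTwoN) ⨾ .instr (.add rVec rId rOne) ⨾ .instr (.add rRef rVec rOne) ⨾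
  .instr (.add rI rZero rZero) ⨾ .instr (.add rJ rN rZero) ⨾ .loop rN fillBody

/-- The number of samples, `2^(6+2t) n`, and the extent of the pool. -/
def initSampling : Prog :=
  .instr (.add rCnt rN rZero) ⨾ .instr (.const rJ 6) ⨾ .instr (.add rJ rJ rT) ⨾
  .instr (.add rJ rJ rT) ⨾ double rJ rCnt ⨾ .instr (.add rBase rZero rZero) ⨾
  .instr (.add rSize rTwoN rZero)

theorem span_standard_eq_top {f : ℕ → Pauli n}
    (hX : ∀ i < n, f i = Pauli.at n i (1, 0)) (hZ : ∀ i < n, f (n + i) = Pauli.at n i (0, 1)) :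
    cellSpan f 0 (2 * n) = ⊤ := by
  rw [eq_top_iff]
  intro P _
  have h : P = ∑ i : Fin n, ((P i).1 • f i + (P i).2 • f (n + i)) := by
    funext j
    rw [Finset.sum_apply, Finset.sum_eq_single j]
    · rw [hX j j.2, hZ j j.2]
      simp [Pauli.at]
    · intro i _ hij
      rw [hX i i.2, hZ i i.2]
      have : ¬ ((j : ℕ) = i) := fun h => hij (Fin.ext h.symm)
      simp [Pauli.at, this]
    · simp
  rw [h]
  refine Submodule.sum_mem _ fun i _ => add_mem ?_ ?_
  · exact Submodule.smul_mem _ _ (Submodule.subset_span (mem_cells (by omega) (by omega)))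
  · exact Submodule.smul_mem _ _ (Submodule.subset_span (mem_cells (by omega) (by omega)))

/-- The store after initialization of the pool. -/
structure PoolReady (t : ℕ) (s : Store n) : Prop where
  consts : Consts t s
  vec : s.reg rVec = ((4 * n + 1 : ℕ) : ℤ)
  ref : s.reg rRef = ((4 * n + 2 : ℕ) : ℤ)
  span : cellSpan s.pau 0 (2 * n) = ⊤
  id : s.pau (4 * n) = 0
  shots : s.shots = n
  samples : s.samples = 0

theorem initPool_spec (t : ℕ) : initPool.Spec ψ (Store.init n t) (PoolReady t) := by
  simp only [initPool, Prog.spec_seq, Prog.spec_instr]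
  simp only [Instr.exec, Store.setReg, Store.tick, Store.init, Function.update_apply,
    Nat.reduceEqDiff, if_true, if_false, add_zero, OfNat.zero_ne_ofNat,
    OfNat.ofNat_ne_zero, OfNat.ofNat_ne_one]
  refine Prog.spec_loop (fun j s' => s'.reg rI = (j : ℕ) ∧ s'.reg rJ = ((n + j : ℕ) : ℤ) ∧
    (∀ i < j, s'.pau i = Pauli.at n i (1, 0)) ∧ (∀ i < j, s'.pau (n + i) = Pauli.at n i (0, 1)) ∧
    s'.pau (4 * n) = 0 ∧ s'.shots = j) ?_ ?_ ?_
  · simp [Store.tick]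
  · rintro j hj s' ⟨h1, h2, h3, h4, h5, h6⟩ hF
    have hj' : j < n := by simpa [Store.nat] using hj
    have h1' : s'.reg rOne = 1 := by rw [hF.reg rOne rfl]; simp
    simp only [fillBody, Prog.spec_seq, Prog.spec_shot, Prog.spec_instr]
    intro o _
    simp only [Instr.exec, Store.setReg, Store.setPau, Store.tick, Store.nat, Function.update_apply,
      Nat.reduceEqDiff, if_true, if_false, h1, h2, h1', h6, Int.toNat_natCast]
    refine ⟨by simp, by push_cast; ring, fun i hi => ?_, fun i hi => ?_, ?_, trivial⟩
    · rw [if_neg (by omega)]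
      split_ifs with h
      · rw [h]
      · exact h3 i (by omega)
    · by_cases h : i = j
      · rw [if_pos (by omega), h]
      · rw [if_neg (by omega), if_neg (by omega)]
        exact h4 i (by omega)
    · rw [if_neg (by omega), if_neg (by omega), h5]
  · rintro s' ⟨h1, h2, h3, h4, h5, h6⟩ hF
    simp only [Store.nat, if_true, Int.toNat_natCast, Function.update_apply, Nat.reduceEqDiff,
      if_false, OfNat.zero_ne_ofNat] at h3 h4 h6
    refine ⟨⟨?_, ?_, ?_, ?_, ?_, ?_⟩, ?_, ?_, span_standard_eq_top h3 h4, h5, h6, ?_⟩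
    · rw [hF.reg rN rfl]; simp
    · rw [hF.reg rT rfl]; simp
    · rw [hF.reg rOne rfl]; simp
    · rw [hF.reg rZero rfl]; simp
    · rw [hF.reg rTwoN rfl]; simp; ring
    · rw [hF.reg rId rfl]; simp; ring
    · rw [hF.reg rVec rfl]; simp; ring
    · rw [hF.reg rRef rfl]; simp; ring
    · exact hF.samples rfl

/-- The store before sampling. -/
structure SamplingReady (t : ℕ) (s : Store n) : Prop where
  consts : Consts t s
  vec : s.reg rVec = ((4 * n + 1 : ℕ) : ℤ)
  ref : s.reg rRef = ((4 * n + 2 : ℕ) : ℤ)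
  span : cellSpan s.pau 0 (2 * n) = ⊤
  id : s.pau (4 * n) = 0
  shots : s.shots = n + (6 + 2 * t)
  samples : s.samples = 0
  cnt : s.reg rCnt = ((2 ^ (6 + 2 * t) * n : ℕ) : ℤ)
  base : s.reg rBase = (0 : ℕ)
  size : s.reg rSize = ((2 * n : ℕ) : ℤ)

theorem initSampling_spec {t : ℕ} {s : Store n} (h : PoolReady t s) :
    initSampling.Spec ψ s (SamplingReady t) := by
  simp only [initSampling, Prog.spec_seq, Prog.spec_instr]
  simp only [Instr.exec, Store.setReg, Store.tick, Function.update_apply, Nat.reduceEqDiff,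
    if_true, if_false, OfNat.one_ne_ofNat, h.consts.qubits, h.consts.gates,
    h.consts.zero, add_zero]
  refine ((double_spec (k := 6 + 2 * t) (by decide) (by simp; ring)).and
    (Prog.spec_frame _ _ _)).mono fun s' ⟨⟨h1, h2⟩, hF⟩ => ?_
  have hc : Consts t s' := by
    refine Consts.of_frame ?_ hF (by decide)
    exact ⟨by simpa using h.consts.qubits, by simpa using h.consts.gates,
      by simpa using h.consts.one, by simpa using h.consts.zero, by simpa using h.consts.twoN,
      by simpa using h.consts.idAddr⟩
  refine ⟨⟨hc.qubits, hc.gates, hc.one, hc.zero, hc.twoN, hc.idAddr⟩, ?_, ?_, ?_, ?_, ?_,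
    ?_, ?_, ?_, ?_⟩
  · have := hF.reg rVec rfl
    simpa [h.vec] using this
  · have := hF.reg rRef rfl
    simpa [h.ref] using this
  · have := hF.pau rfl
    simpa [this] using h.span
  · have := hF.pau rfl
    simpa [this] using h.id
  · simp [h2, h.shots]
  · have := hF.samples rfl
    simpa [h.samples] using this
  · simp at h1
    simpa using h1
  · simpa using hc.zero
  · simpa [hc.zero] using hc.twoN

/-! ### Sampling -/

/-- One round of sampling. -/
def samplingBody : Prog := .sample rVec ⨾ .instr (.mul rVec rVec rRef) ⨾ elim

/-- Elimination with the differences of Bell samples. -/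
def sampling : Prog := .sample rRef ⨾ .loop rCnt samplingBody

/-- The pool is the commutant of the recorded vectors and contains the stabilizer group. -/
structure PoolInv (ψ : PureState n) (s : Store n) (m : ℕ) : Prop where
  size : s.reg rSize = m
  le : m ≤ 2 * n
  span : cellSpan s.pau 0 m = perp (cells s.pau m (2 * n - m))
  stab : stabSubmodule ψ.vec ≤ cellSpan s.pau 0 m

/-- The invariant of sampling, with reference sample `R`. -/
structure SamplingInv (ψ : PureState n) (t : ℕ) (R : Pauli n) (j : ℕ) (s : Store n) : Prop where
  consts : Consts t s
  vec : s.reg rVec = ((4 * n + 1 : ℕ) : ℤ)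
  ref : s.reg rRef = ((4 * n + 2 : ℕ) : ℤ)
  base : s.reg rBase = (0 : ℕ)
  pool : ∃ m, PoolInv ψ s m
  id : s.pau (4 * n) = 0
  pauRef : s.pau (4 * n + 2) = R
  shots : s.shots ≤ n + (6 + 2 * t) + j * (2 * n)
  samples : s.samples = j + 1

/-- The store after a sample `P` has been shifted by the reference sample. -/
def shifted (s : Store n) (P : Pauli n) : Store n :=
  { s with
    pau := Function.update (Function.update s.pau (s.nat rVec) P) (s.nat rVec)
      (Function.update s.pau (s.nat rVec) P (s.nat rVec) +
        Function.update s.pau (s.nat rVec) P (s.nat rRef))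
    samples := s.samples + 1
    steps := s.steps + 1 + 1 + 1 }

/-- Isolates the random choice of the sample from the elimination that follows, so that the
expectation over the sample can be taken by itself. -/
theorem run_samplingBody (s : Store n) :
    samplingBody.run ψ s.tick = ψ.bell.bind fun P => elim.run ψ (shifted s P) := by
  simp only [samplingBody, Prog.run]
  rw [← PMF.bind_pure_comp, PMF.bind_bind]
  refine congrArg _ (funext fun P => ?_)
  rw [Function.comp_apply, PMF.pure_bind, PMF.pure_bind]
  rfl

/-- One round for a given sample. Besides the invariant it yields the exact new pool, the old one
cut with the commutant of P + R, which the estimate of the excess needs. -/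
theorem SamplingInv.elim {t : ℕ} {R : Pauli n} {j : ℕ} {s : Store n} (h : SamplingInv ψ t R j s)
    (hR : R ∈ ψ.bell.support) {m : ℕ} (hm : PoolInv ψ s m) {P : Pauli n}
    (hP : P ∈ ψ.bell.support) :
    TDoped.elim.Spec ψ (shifted s P) fun s' => SamplingInv ψ t R (j + 1) s' ∧
      ∃ m', PoolInv ψ s' m' ∧ cellSpan s'.pau 0 m' = cellSpan s.pau 0 m ⊓ perp {P + R} := by
  have hvec : s.nat rVec = 4 * n + 1 := by rw [Store.nat, h.vec]; rfl
  have href : s.nat rRef = 4 * n + 2 := by rw [Store.nat, h.ref]; rfl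
  have hpau : ∀ i, i ≠ 4 * n + 1 → (shifted s P).pau i = s.pau i := by
    intro i hi
    simp [shifted, hvec, hi]
  have hx : (shifted s P).pau (4 * n + 1) = P + R := by
    simp [shifted, hvec, href, h.pauRef]
  have hcell : ∀ b k, b + k ≤ 4 * n + 1 → cells (shifted s P).pau b k = cells s.pau b k :=
    fun b k hbk => cells_congr fun i _ hi => hpau i (by omega)
  have hcs : ∀ b k, b + k ≤ 4 * n + 1 → cellSpan (shifted s P).pau b k = cellSpan s.pau b k :=
    fun b k hbk => by rw [cellSpan, hcell b k hbk, cellSpan]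
  have hle := hm.le
  have hspec := elim_spec (ψ := ψ) (s := shifted s P) (b := 0) (k := m) (v := 4 * n + 1)
    (z := 4 * n) h.consts.one h.consts.zero h.base hm.size h.vec h.consts.idAddr (by omega)
    (by omega) ((hpau _ (by omega)).trans h.id)
  refine (hspec.and (TDoped.elim.spec_frame ψ _)).mono fun s' ⟨hE, hF⟩ => ?_
  obtain ⟨m', hsz, hsp, hcase⟩ := hE.size
  rw [hx, hcs 0 m (by omega)] at hsp
  -- P and R are both Bell samples, so their commutation bits with a stabilizer element agree and
  -- cancel.
  have hstab : stabSubmodule ψ.vec ≤ perp {P + R} := by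
    intro Q hQ a ha
    rw [Set.mem_singleton_iff.mp ha, Pauli.symp_add_left,
      ψ.symp_eq_of_mem_bell_support hP hR hQ]
    exact CharTwo.add_self_eq_zero _
  have hpool : PoolInv ψ s' m' := by
    refine ⟨hsz, by omega, ?_, ?_⟩
    · rw [hsp, hm.span]
      rcases hcase with ⟨rfl, hc⟩ | ⟨rfl, hrec⟩
      · have e : cells s'.pau m' (2 * n - m') = cells s.pau m' (2 * n - m') := by
          rw [← hcell _ _ (by omega)]
          exact cells_congr fun i h1 h2 => hE.out i (by omega)
        rw [hx, hcs 0 m' (by omega)] at hc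
        rw [e, inf_eq_left, ← hm.span]
        exact hc
      · have e : cells s'.pau (m' + 1) (2 * n - (m' + 1)) =
            cells s.pau (m' + 1) (2 * n - (m' + 1)) := by
          rw [← hcell _ _ (by omega)]
          exact cells_congr fun i h1 h2 => hE.out i (by omega)
        rw [show 2 * n - m' = 2 * n - (m' + 1) + 1 by omega, cells_succ_left, perp_insert, e]
        rw [zero_add] at hrec
        rw [hrec, hx]
    · rw [hsp]
      exact le_inf hm.stab hstab
  refine ⟨⟨?_, ?_, ?_, ?_, ⟨m', hpool⟩, ?_, ?_, ?_, ?_⟩, m', hpool, hsp⟩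
  · exact Consts.of_frame (s := shifted s P) ⟨h.consts.qubits, h.consts.gates,
      h.consts.one, h.consts.zero, h.consts.twoN, h.consts.idAddr⟩ hF (by decide)
  · exact (hF.reg rVec rfl).trans h.vec
  · exact (hF.reg rRef rfl).trans h.ref
  · exact (hF.reg rBase rfl).trans h.base
  · rw [hE.out _ (by omega), hpau _ (by omega), h.id]
  · rw [hE.out _ (by omega), hpau _ (by omega), h.pauRef]
  · rw [hE.shots]
    have := h.shots
    change s.shots + m ≤ _
    rw [add_mul]
    omega
  · rw [hF.samples rfl]
    change s.samples + 1 = _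
    rw [h.samples]

theorem samplingBody_spec {t : ℕ} {R : Pauli n} (hR : R ∈ ψ.bell.support) {j : ℕ} {s : Store n}
    (h : SamplingInv ψ t R j s) :
    samplingBody.Spec ψ s.tick (SamplingInv ψ t R (j + 1)) := by
  intro s' hs'
  rw [run_samplingBody, PMF.mem_support_bind_iff] at hs'
  obtain ⟨P, hP, hs'⟩ := hs'
  obtain ⟨m, hm⟩ := h.pool
  exact (h.elim hR hm hP s' hs').1

theorem sample_ref_spec {t : ℕ} {s : Store n} (h : SamplingReady t s) :
    (Prog.sample rRef).Spec ψ s fun s' => ∃ R ∈ ψ.bell.support, SamplingInv ψ t R 0 s'.tick := by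
  refine Prog.spec_sample.mpr fun R hR => ⟨R, hR, ?_⟩
  have href : s.nat rRef = 4 * n + 2 := by rw [Store.nat, h.ref]; rfl
  have hpau : ∀ i, i ≠ 4 * n + 2 → Function.update s.pau (s.nat rRef) R i = s.pau i := by
    intro i hi
    rw [href, Function.update_of_ne hi]
  have hspan : cellSpan (Function.update s.pau (s.nat rRef) R) 0 (2 * n) = ⊤ := by
    rw [← h.span, cellSpan, cellSpan, cells_congr fun i _ hi => hpau i (by omega)]
  refine ⟨⟨h.consts.qubits, h.consts.gates, h.consts.one, h.consts.zero, h.consts.twoN,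
    h.consts.idAddr⟩, h.vec, h.ref, h.base, ⟨2 * n, h.size, le_rfl, ?_, ?_⟩, ?_, ?_, ?_, ?_⟩
  -- There are no records yet, so their commutant is the whole group.
  · refine hspan.trans (Eq.symm (eq_top_iff.mpr ?_))
    rintro y - a ⟨i, ⟨h1, h2⟩, -⟩
    omega
  · exact le_top.trans hspan.ge
  · exact (hpau _ (by omega)).trans h.id
  · change Function.update s.pau (s.nat rRef) R _ = R
    rw [href, Function.update_self]
  · change s.shots ≤ _
    rw [h.shots]; omega
  · change s.samples + 1 = _
    rw [h.samples]

theorem sampling_spec {t : ℕ} {s : Store n} (h : SamplingReady t s) :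
    sampling.Spec ψ s fun s' =>
      ∃ R ∈ ψ.bell.support, SamplingInv ψ t R (2 ^ (6 + 2 * t) * n) s' := by
  refine Prog.spec_seq_frame (sample_ref_spec h) fun s₁ ⟨R, hR, hs₁⟩ hF => ?_
  have hcnt : s₁.nat rCnt = 2 ^ (6 + 2 * t) * n := by
    rw [Store.nat, hF.reg rCnt rfl, h.cnt]; exact Int.toNat_natCast _
  refine Prog.spec_loop (SamplingInv ψ t R) hs₁ (fun j _ s' hs' _ => samplingBody_spec hR hs')
    fun s' hs' _ => ⟨R, hR, ?_⟩
  rwa [hcnt] at hs'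

/-! ### Decay of the part of the pool outside the stabilizer group -/

open Classical in
/-- The number of pool elements outside the stabilizer group. -/
noncomputable def excess (ψ : PureState n) (s : Store n) : ℝ≥0∞ :=
  ∑ Q : Pauli n, if Q ∉ ψ.stab ∧ Q ∈ cellSpan s.pau 0 (s.nat rSize) then 1 else 0

/-- The gap 1/(5·4^t) of ⟨Q⟩² below 1 is halved in (1 + ⟨Q⟩²)/2. -/
theorem IsDopedState.sum_bell_commuting_le {t : ℕ} (hψ : IsDopedState t ψ) (R : Pauli n)
    {Q : Pauli n} (hQ : Q ∉ ψ.stab) :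
    ∑ P, ψ.bell P * (if (P + R).symp Q = 0 then 1 else 0) ≤
      ENNReal.ofReal (1 - 1 / (10 * 4 ^ t)) := by
  have h1 : ∀ P : Pauli n, ψ.bell P * (if (P + R).symp Q = 0 then 1 else 0) =
      ENNReal.ofReal (ψ.xiTilde P * (if (P + R).symp Q = 0 then 1 else 0)) := by
    intro P
    rw [ψ.bell_apply, ENNReal.ofReal_mul (ψ.xiTilde_nonneg P)]
    split_ifs <;> simp
  simp only [h1]
  rw [← ENNReal.ofReal_sum_of_nonneg fun P _ => mul_nonneg (ψ.xiTilde_nonneg P) (by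
    split_ifs <;> norm_num)]
  refine ENNReal.ofReal_le_ofReal ((ψ.sum_xiTilde_commuting_le R Q).trans ?_)
  have h2 := hψ.expect_sq_le hQ
  have h3 : (1 : ℝ) / (10 * 4 ^ t) = 1 / (5 * 4 ^ t) / 2 := by field_simp; norm_num
  rw [h3]
  linarith

/-- Linearity of expectation: an element outside the stabilizer group stays in the pool only if the
shifted sample commutes with it, and this bound holds for each element separately. -/
theorem pmfE_excess_le {t : ℕ} (hψ : IsDopedState t ψ) {R : Pauli n}
    (hR : R ∈ ψ.bell.support) {j : ℕ} {s : Store n} (h : SamplingInv ψ t R j s) :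
    pmfE (samplingBody.run ψ s.tick) (excess ψ) ≤
      ENNReal.ofReal (1 - 1 / (10 * 4 ^ t)) * excess ψ s := by
  classical
  obtain ⟨m, hm⟩ := h.pool
  have hsz : s.nat rSize = m := by rw [Store.nat, hm.size]; rfl
  rw [run_samplingBody, pmfE_bind]
  have h1 : ∀ P ∈ ψ.bell.support, pmfE (elim.run ψ (shifted s P)) (excess ψ) ≤
      ∑ Q : Pauli n, (if Q ∉ ψ.stab ∧ Q ∈ cellSpan s.pau 0 m then 1 else 0) *
        (if (P + R).symp Q = 0 then 1 else 0) := by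
    intro P hP
    rw [← pmfE_const (elim.run ψ (shifted s P)) (∑ Q : Pauli n, _)]
    refine pmfE_mono fun s' hs' => ?_
    obtain ⟨-, m', hm', hsp⟩ := h.elim hR hm hP s' hs'
    have hsz' : s'.nat rSize = m' := by rw [Store.nat, hm'.size]; rfl
    rw [excess, hsz', hsp]
    refine Finset.sum_le_sum fun Q _ => ?_
    by_cases hQ : Q ∉ ψ.stab ∧ Q ∈ cellSpan s.pau 0 m ⊓ perp {P + R}
    · rw [if_pos hQ, if_pos ⟨hQ.1, hQ.2.1⟩, if_pos (hQ.2.2 _ rfl), one_mul]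
    · rw [if_neg hQ]
      exact zero_le
  refine (pmfE_mono h1).trans ?_
  rw [pmfE_fintype, excess, hsz, Finset.mul_sum]
  simp only [Finset.mul_sum]
  rw [Finset.sum_comm]
  refine Finset.sum_le_sum fun Q _ => ?_
  by_cases hQ : Q ∉ ψ.stab ∧ Q ∈ cellSpan s.pau 0 m
  · simp only [if_pos hQ, one_mul, mul_one]
    exact hψ.sum_bell_commuting_le R hQ.1
  · simp only [if_neg hQ, zero_mul, mul_zero, Finset.sum_const_zero, le_refl]

theorem excess_le (s : Store n) : excess ψ s ≤ 4 ^ n := by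
  classical
  calc excess ψ s ≤ ∑ _Q : Pauli n, (1 : ℝ≥0∞) :=
        Finset.sum_le_sum fun Q _ => by split_ifs <;> simp
    _ = 4 ^ n := by
      rw [Finset.sum_const, Finset.card_univ]
      simp

/-- The exponent 2^(6+2t)/(10·4^t) is 32/5, and exp(-32/5) ≤ 1/8; so each of the n blocks of samples
contributes 1/8, and 4^n·8^{-n} = 2^{-n}. -/
theorem sampling_rate (n t : ℕ) :
    ENNReal.ofReal (1 - 1 / (10 * 4 ^ t)) ^ (2 ^ (6 + 2 * t) * n) * 4 ^ n ≤ 2⁻¹ ^ n := by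
  have h0 : (0 : ℝ) ≤ 1 - 1 / (10 * 4 ^ t) := by
    have : (1 : ℝ) / (10 * 4 ^ t) ≤ 1 := by
      rw [div_le_one (by positivity)]
      have : (1 : ℝ) ≤ 4 ^ t := one_le_pow₀ (by norm_num)
      linarith
    linarith
  have h1 : (1 - 1 / (10 * 4 ^ t) : ℝ) ^ (2 ^ (6 + 2 * t)) ≤ 1 / 8 := by
    have e1 : (1 - 1 / (10 * 4 ^ t) : ℝ) ≤ Real.exp (-(1 / (10 * 4 ^ t))) :=
      Real.one_sub_le_exp_neg _
    have e2 : ((2 ^ (6 + 2 * t) : ℕ) : ℝ) * -(1 / (10 * 4 ^ t)) = -(16 / 5 + 16 / 5) := by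
      push_cast
      rw [pow_add, pow_mul]
      field_simp
      norm_num
      ring
    have e3 : (3 : ℝ) ≤ Real.exp (16 / 5) := by
      have := Real.add_one_le_exp (16 / 5 : ℝ)
      linarith
    calc (1 - 1 / (10 * 4 ^ t) : ℝ) ^ (2 ^ (6 + 2 * t))
        ≤ Real.exp (-(1 / (10 * 4 ^ t))) ^ (2 ^ (6 + 2 * t)) := pow_le_pow_left₀ h0 e1 _
      _ = (Real.exp (16 / 5) * Real.exp (16 / 5))⁻¹ := by
        rw [← Real.exp_nat_mul, e2, Real.exp_neg, Real.exp_add]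
      _ ≤ (8 : ℝ)⁻¹ := by
        apply inv_anti₀ (by norm_num)
        nlinarith
      _ = 1 / 8 := by norm_num
  have h2 : ENNReal.ofReal (1 - 1 / (10 * 4 ^ t)) ^ (2 ^ (6 + 2 * t)) ≤ 8⁻¹ := by
    rw [← ENNReal.ofReal_pow h0]
    refine (ENNReal.ofReal_le_ofReal h1).trans (le_of_eq ?_)
    rw [one_div, ENNReal.ofReal_inv_of_pos (by norm_num)]
    norm_num
  rw [pow_mul, ← mul_pow]
  refine pow_le_pow_left₀ zero_le ?_ n
  refine (mul_le_mul_left h2 4).trans (le_of_eq ?_)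
  rw [show (8 : ℝ≥0∞) = 2 * 4 by norm_num, ENNReal.mul_inv (Or.inl (by norm_num))
    (Or.inl (by norm_num)), mul_assoc, ENNReal.inv_mul_cancel (by norm_num) (by norm_num), mul_one]

/-- Sampling leaves a pool that spans the stabilizer group, with high probability. -/
theorem sampling_failProb {t : ℕ} (hψ : IsDopedState t ψ) {s : Store n} (h : SamplingReady t s) :
    failProb (sampling.run ψ s) (fun s' => cellSpan s'.pau 0 (s'.nat rSize) =
      stabSubmodule ψ.vec) ≤ 2⁻¹ ^ n := by
  classical
  refine Prog.failProb_seq_of_spec (sample_ref_spec h) fun s₁ ⟨R, hR, hs₁⟩ hF => ?_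
  have hcnt : s₁.nat rCnt = 2 ^ (6 + 2 * t) * n := by
    rw [Store.nat, hF.reg rCnt rfl, h.cnt]; exact Int.toNat_natCast _
  have hsup := Prog.rounds_support (ψ := ψ) (p := samplingBody) (k := s₁.nat rCnt)
    (SamplingInv ψ t R) hs₁ fun j _ s' hs' => samplingBody_spec hR hs'
  have hexp := Prog.pmfE_rounds_le (ψ := ψ) (p := samplingBody) (k := s₁.nat rCnt)
    (SamplingInv ψ t R) (fun _ => excess ψ) hs₁ (fun j _ s' hs' => samplingBody_spec hR hs')
    fun j _ s' hs' => pmfE_excess_le hψ hR hs'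
  rw [Prog.run_loop]
  -- Markov's inequality: the excess is at least 1 whenever the pool is strictly larger than the
  -- stabilizer group.
  refine (failProb_le_pmfE fun s' hs' hne => ?_).trans (hexp.trans ?_)
  · obtain ⟨m, hm⟩ := (hsup s' hs').pool
    have hsz : s'.nat rSize = m := by rw [Store.nat, hm.size]; rfl
    rw [hsz] at hne
    obtain ⟨Q, hQ1, hQ2⟩ : ∃ Q, Q ∈ cellSpan s'.pau 0 m ∧ Q ∉ stabSubmodule ψ.vec := by
      by_contra hcon
      push Not at hcon
      exact hne (le_antisymm hcon hm.stab)
    rw [excess, hsz]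
    refine le_trans ?_ (Finset.single_le_sum (fun _ _ => zero_le) (Finset.mem_univ Q))
    rw [if_pos ⟨hQ2, hQ1⟩]
  · rw [hcnt]
    exact (mul_le_mul_right (excess_le _) _).trans (sampling_rate n t)

/-! ### Representatives of the commutant modulo the stabilizer group -/

/-- One round of copying the recorded vectors. -/
def copyBody : Prog :=
  .shot rJunk rId ⨾ .instr (.mul rJ rI rId) ⨾ .instr (.add rI rI rOne) ⨾ .instr (.add rJ rJ rOne)

/-- Copies the recorded vectors to the cells from `2n` on. -/
def copyRecords : Prog :=
  .instr (.add rM rSize rZero) ⨾ .instr (.sub rCnt rTwoN rM) ⨾ .instr (.add rI rM rZero) ⨾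
  .instr (.add rJ rTwoN rZero) ⨾ .loop rCnt copyBody

/-- One round of the second elimination. -/
def complementBody : Prog := .shot rJunk rId ⨾ elim ⨾ .instr (.add rVec rVec rOne)

/-- Second elimination: the copies are the pool, the recorded vectors are processed. -/
def complement : Prog :=
  .instr (.add rBase rTwoN rZero) ⨾ .instr (.add rSize rCnt rZero) ⨾
  .instr (.add rVec rM rZero) ⨾ .loop rCnt complementBody

/-- The store after the records have been copied. -/
structure Copied (s₀ : Store n) (t m : ℕ) (s : Store n) : Prop where
  consts : Consts t s
  num : s.reg rM = m
  cnt : s.reg rCnt = ((2 * n - m : ℕ) : ℤ)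
  out : ∀ i, ¬ (2 * n ≤ i ∧ i < 2 * n + (2 * n - m)) → s.pau i = s₀.pau i
  copy : ∀ i < 2 * n - m, s.pau (2 * n + i) = s₀.pau (m + i)
  shots : s.shots = s₀.shots + (2 * n - m)
  samples : s.samples = s₀.samples

theorem copyRecords_spec {t m : ℕ} {s : Store n} (hc : Consts t s) (hm : s.reg rSize = m)
    (hle : m ≤ 2 * n) (hid : s.pau (4 * n) = 0) : copyRecords.Spec ψ s (Copied s t m) := by
  have e : ((2 * n : ℕ) : ℤ) - m = ((2 * n - m : ℕ) : ℤ) := by omega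
  simp only [copyRecords, Prog.spec_seq, Prog.spec_instr]
  simp only [Instr.exec, Store.setReg, Store.tick, Function.update_apply, Nat.reduceEqDiff,
    if_true, if_false, hm, hc.zero, hc.twoN, add_zero, e]
  have hcnt : (Function.update (Function.update (Function.update (Function.update s.reg rM (m : ℤ))
      rCnt ((2 * n - m : ℕ) : ℤ)) rI (m : ℤ)) rJ ((2 * n : ℕ) : ℤ) rCnt).toNat = 2 * n - m := by
    simp only [Function.update_apply, Nat.reduceEqDiff, if_true, if_false]
    exact Int.toNat_natCast _
  refine Prog.spec_loop (fun j s' => s'.reg rI = ((m + j : ℕ) : ℤ) ∧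
    s'.reg rJ = ((2 * n + j : ℕ) : ℤ) ∧ (∀ i < j, s'.pau (2 * n + i) = s.pau (m + i)) ∧
    (∀ i, ¬ (2 * n ≤ i ∧ i < 2 * n + (2 * n - m)) → s'.pau i = s.pau i) ∧
    s'.shots = s.shots + j) ?_ ?_ ?_
  · simp [Store.tick]
  · rintro j hj s' ⟨h1, h2, h3, h4, h5⟩ hF
    have hj' : j < 2 * n - m := by simpa [Store.nat] using hj
    have f1 : s'.reg rOne = 1 := by rw [hF.reg rOne rfl]; simpa using hc.one
    have fz : s'.reg rId = ((4 * n : ℕ) : ℤ) := by rw [hF.reg rId rfl]; simpa using hc.idAddr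
    have pz : s'.pau (4 * n) = 0 := by rw [h4 _ (by omega), hid]
    have pm : s'.pau (m + j) = s.pau (m + j) := h4 _ (by omega)
    simp only [copyBody, Prog.spec_seq, Prog.spec_shot, Prog.spec_instr]
    intro o _
    simp only [Instr.exec, Store.setReg, Store.setPau, Store.tick, Store.nat, Function.update_apply,
      Nat.reduceEqDiff, if_true, if_false, h1, h2, f1, fz, pz, pm, h5, Int.toNat_natCast, add_zero]
    refine ⟨by push_cast; ring, by push_cast; ring, fun i hi => ?_, fun i hi => ?_, by ring⟩
    · by_cases h : i = j
      · rw [if_pos (by omega), h]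
      · rw [if_neg (by omega)]
        exact h3 i (by omega)
    · rw [if_neg (by omega)]
      exact h4 i hi
  · rintro s' ⟨h1, h2, h3, h4, h5⟩ hF
    rw [Store.nat, hcnt] at h3 h5
    refine ⟨?_, ?_, ?_, h4, h3, h5, hF.samples rfl⟩
    · refine Consts.of_frame ?_ hF (by decide)
      exact ⟨by simpa using hc.qubits, by simpa using hc.gates, by simpa using hc.one,
        by simpa using hc.zero, by simpa using hc.twoN, by simpa using hc.idAddr⟩
    · rw [hF.reg rM rfl]; simp
    · rw [hF.reg rCnt rfl]; simp

/-- The invariant of the second elimination: `f` is the Pauli array at the start, with the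
records in the cells from `m` to `2n`. -/
structure ComplementInv (f : ℕ → Pauli n) (t m N : ℕ) (j : ℕ) (s : Store n) : Prop where
  vec : s.reg rVec = ((m + j : ℕ) : ℤ)
  out : ∀ i, ¬ (2 * n ≤ i ∧ i < 2 * n + (2 * n - m)) → s.pau i = f i
  shots : s.shots ≤ N + j * (1 + 2 * n)
  pool : ∃ k c : ℕ, s.reg rSize = k ∧ k + c = 2 * n - m ∧
    cellSpan s.pau (2 * n) k = cellSpan f m (2 * n - m) ⊓ perp (cells s.pau (2 * n + k) c) ∧
    cells s.pau (2 * n + k) c ⊆ cells f m (2 * n - m) ∧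
    cellSpan s.pau (2 * n) k ≤ perp (cells f m j)

theorem cells_succ_right (f : ℕ → Pauli n) (b k : ℕ) :
    cells f b (k + 1) = insert (f (b + k)) (cells f b k) := by
  ext x
  constructor
  · rintro ⟨i, ⟨h1, h2⟩, rfl⟩
    rcases Nat.lt_or_ge i (b + k) with h | h
    · exact Or.inr ⟨i, ⟨h1, h⟩, rfl⟩
    · exact Or.inl (by rw [show i = b + k by omega])
  · rintro (rfl | ⟨i, ⟨h1, h2⟩, rfl⟩)
    · exact mem_cells (by omega) (by omega)
    · exact mem_cells h1 (by omega)

/-- The vectors being processed are never altered, since the copied pool lies in other cells. Those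
that shrink the pool collect behind it and form the set C of `complement_of_cells`. -/
theorem complementBody_spec {f : ℕ → Pauli n} {t m N j : ℕ} {s : Store n} (hc : Consts t s)
    (hb : s.reg rBase = ((2 * n : ℕ) : ℤ)) (hj : j < 2 * n - m)
    (hid : f (4 * n) = 0) (h : ComplementInv f t m N j s) :
    complementBody.Spec ψ s.tick (ComplementInv f t m N (j + 1)) := by
  obtain ⟨k, c, hk, hkc, hspan, hrec, hperp⟩ := h.pool
  simp only [complementBody, Prog.spec_seq, Prog.spec_shot]
  intro o _
  generalize (if o = true then (1 : ℤ) else -1) = w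
  set s₁ : Store n := { (s.tick.setReg rJunk w).tick with shots := s.tick.shots + 1 } with hs₁
  have hpau : s₁.pau = s.pau := rfl
  have hreg : ∀ r, r ≠ rJunk → s₁.reg r = s.reg r := fun r hr => Function.update_of_ne hr _ _
  have hspec := elim_spec (ψ := ψ) (s := s₁) (b := 2 * n) (k := k) (v := m + j)
    (z := 4 * n) ((hreg rOne (by decide)).trans hc.one) ((hreg rZero (by decide)).trans hc.zero)
    ((hreg rBase (by decide)).trans hb) ((hreg rSize (by decide)).trans hk)
    ((hreg rVec (by decide)).trans h.vec) ((hreg rId (by decide)).trans hc.idAddr) (by omega)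
    (by omega) ((h.out _ (by omega)).trans hid)
  have hx : s₁.pau (m + j) = f (m + j) := h.out _ (by omega)
  rw [hx] at hspec
  refine (hspec.and (elim.spec_frame ψ _)).mono fun s₂ ⟨hE, hF⟩ => ?_
  rw [Prog.spec_instr]
  have h1 : s₂.reg rOne = 1 := by rw [hF.reg rOne rfl, hreg rOne (by decide), hc.one]
  have h2 : s₂.reg rVec = ((m + j : ℕ) : ℤ) := by rw [hF.reg rVec rfl, hreg rVec (by decide), h.vec]
  simp only [Instr.exec, Store.setReg, Store.tick, h1, h2]
  obtain ⟨k', hsz, hsp, hcase⟩ := hE.size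
  rw [hpau] at hsp
  refine ⟨by simp; ring, ?_, ?_, ?_⟩
  · intro i hi
    have := hE.out i (by omega)
    exact this.trans (h.out i hi)
  · have e1 := hE.shots
    have e2 := h.shots
    change s₂.shots ≤ _
    have e3 : s₁.shots = s.shots + 1 := rfl
    rw [add_mul]
    omega
  · have hperp' : cellSpan s₂.pau (2 * n) k' ≤ perp (cells f m (j + 1)) := by
      rw [hsp, cells_succ_right, perp_insert]
      exact inf_le_inf_right _ hperp
    rcases hcase with ⟨rfl, hc'⟩ | ⟨rfl, hnew⟩
    · have e : cells s₂.pau (2 * n + k') c = cells s.pau (2 * n + k') c :=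
        cells_congr fun i h1 h2 => hE.out i (by omega)
      refine ⟨k', c, by simpa using hsz, hkc, ?_, ?_, hperp'⟩
      · change cellSpan s₂.pau _ _ = _ ⊓ perp (cells s₂.pau _ _)
        rw [hsp, e, ← hspan, inf_eq_left]
        exact hc'
      · change cells s₂.pau _ _ ⊆ _
        rwa [e]
    · have e : cells s₂.pau (2 * n + (k' + 1)) c = cells s.pau (2 * n + (k' + 1)) c :=
        cells_congr fun i h1 h2 => hE.out i (by omega)
      refine ⟨k', c + 1, by simpa using hsz, by omega, ?_, ?_, hperp'⟩
      · change cellSpan s₂.pau _ _ = _ ⊓ perp (cells s₂.pau _ _)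
        rw [cells_succ_left, add_assoc, e, hnew, perp_insert, hsp, hspan, inf_assoc]
      · change cells s₂.pau _ _ ⊆ _
        rw [cells_succ_left, add_assoc, e, hnew]
        exact Set.insert_subset (mem_cells (by omega) (by omega)) hrec

/-- The store after the second elimination. The `k` remaining pool cells and the `c` cells after
them take up the cells from `2n` on. -/
structure Complemented (ψ : PureState n) (t m k c : ℕ) (s : Store n) : Prop where
  consts : Consts t s
  num : s.reg rM = m
  cnt : s.reg rCnt = ((k + c : ℕ) : ℤ)
  size : s.reg rSize = k
  base : s.reg rBase = ((2 * n : ℕ) : ℤ)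
  total : m + (k + c) = 2 * n
  span : cellSpan s.pau 0 m = perp (cells s.pau m (k + c))
  id : s.pau (4 * n) = 0
  pool : cellSpan s.pau (2 * n) k = cellSpan s.pau m (k + c) ⊓ perp (cells s.pau (2 * n + k) c)
  records : cells s.pau (2 * n + k) c ⊆ cells s.pau m (k + c)
  commutes : cellSpan s.pau (2 * n) k ≤ perp (cells s.pau m (k + c))

/-- Once all records R have been processed, the remaining pool is the part of span R that commutes
with R. This holds whether or not sampling has succeeded; if it has, that part is the stabilizer
group and the vectors collected in C generate the rest of the commutant. -/
theorem copyRecords_complement_spec {t m : ℕ} {s : Store n} (hc : Consts t s)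
    (hm : PoolInv ψ s m) (hid : s.pau (4 * n) = 0) :
    (copyRecords ⨾ complement).Spec ψ s fun s' => ∃ k c, Complemented ψ t m k c s' ∧
      (∀ i < m, s'.pau i = s.pau i) ∧ s'.shots ≤ s.shots + 2 * n * (2 * n + 2) ∧
      s'.samples = s.samples := by
  have hle := hm.le
  refine Prog.spec_seq.mpr ((copyRecords_spec hc hm.size hle hid).mono fun s₁ h₁ => ?_)
  simp only [complement, Prog.spec_seq, Prog.spec_instr]
  simp only [Instr.exec, Store.setReg, Store.tick, Function.update_apply, Nat.reduceEqDiff,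
    if_false, h₁.consts.zero, h₁.consts.twoN, h₁.num, h₁.cnt, add_zero]
  have hid₁ : s₁.pau (4 * n) = 0 := (h₁.out _ (by omega)).trans hid
  have hcons : ∀ {p : Prog} {s' : Store n} {A B C : ℤ} {st : ℕ}, p.Frame { s₁ with
      reg := Function.update (Function.update (Function.update s₁.reg rBase A) rSize B) rVec C
      steps := st } s' → (∀ r < 6, p.writes r = false) → Consts t s' := by
    intro p s' A B C st hF hp
    refine Consts.of_frame ?_ hF hp
    exact ⟨by simpa using h₁.consts.qubits, by simpa using h₁.consts.gates,
      by simpa using h₁.consts.one, by simpa using h₁.consts.zero, by simpa using h₁.consts.twoN,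
      by simpa using h₁.consts.idAddr⟩
  have hcnt : (Function.update (Function.update (Function.update s₁.reg rBase ((2 * n : ℕ) : ℤ))
      rSize ((2 * n - m : ℕ) : ℤ)) rVec (m : ℤ) rCnt).toNat = 2 * n - m := by
    simp only [Function.update_apply, Nat.reduceEqDiff, if_false, h₁.cnt]
    exact Int.toNat_natCast _
  refine Prog.spec_loop (ComplementInv s₁.pau t m s₁.shots) ?_ ?_ ?_
  · refine ⟨by simp [Store.tick], fun _ _ => rfl, by simp [Store.tick], 2 * n - m, 0,
      by simp [Store.tick], by omega, ?_, ?_, ?_⟩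
    · have e1 : cells s₁.pau (2 * n) (2 * n - m) = cells s₁.pau m (2 * n - m) :=
        cells_shift fun i hi => (h₁.copy i hi).trans (h₁.out _ (by omega)).symm
      change cellSpan s₁.pau _ _ = _ ⊓ TDoped.perp (cells s₁.pau _ _)
      rw [cellSpan, e1, cellSpan, eq_comm, inf_eq_left]
      rintro y - a ⟨i, ⟨h1, h2⟩, -⟩
      omega
    · rintro a ⟨i, ⟨h1, h2⟩, -⟩
      omega
    · rintro y - a ⟨i, ⟨h1, h2⟩, -⟩
      omega
  · intro j hj s' hI hF
    rw [Store.nat, hcnt] at hj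
    refine complementBody_spec (hcons hF (by decide)) ?_ hj hid₁ hI
    rw [hF.reg rBase rfl]; simp
  · intro s' hI hF
    rw [Store.nat, hcnt] at hI
    obtain ⟨k, c, hk, hkc, hspan, hrec, hperp⟩ := hI.pool
    have hsame : ∀ i, i < 2 * n → s'.pau i = s₁.pau i := fun i hi => hI.out i (by omega)
    have e1 : cells s'.pau m (2 * n - m) = cells s₁.pau m (2 * n - m) :=
      cells_congr fun i _ hi => hsame i (by omega)
    have hsame' : ∀ i, i < 2 * n → s'.pau i = s.pau i := fun i hi =>
      (hsame i hi).trans (h₁.out i (by omega))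
    refine ⟨k, c, ⟨hcons hF (by decide), ?_, ?_, hk, ?_, by omega, ?_, ?_, ?_, ?_, ?_⟩,
      fun i hi => hsame' i (by omega), ?_, ?_⟩
    · rw [hF.reg rM rfl]; simpa using h₁.num
    · rw [hF.reg rCnt rfl, hkc]; simpa using h₁.cnt
    · rw [hF.reg rBase rfl]; simp
    · rw [hkc, cellSpan, cells_congr fun i _ hi => hsame' i (by omega), ← cellSpan, hm.span,
        cells_congr (f := s'.pau) fun i _ hi => hsame' i (by omega)]
    · exact (hI.out _ (by omega)).trans hid₁
    · rw [hkc, cellSpan.eq_1 s'.pau m, e1]; exact hspan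
    · rw [hkc, e1]; exact hrec
    · rw [hkc, e1]; exact hperp
    · have h2 := hI.shots
      rw [h₁.shots] at h2
      have h3 : (2 * n - m) * (1 + 2 * n) ≤ 2 * n * (1 + 2 * n) := Nat.mul_le_mul_right _ (by omega)
      nlinarith
    · exact (hF.samples rfl).trans h₁.samples

/-! ### Signs of the generators -/

/-- One measurement of each generator. -/
def signs : Prog :=
  .instr (.add rI rZero rZero) ⨾
  .loop rM (.shot rBit rI ⨾ .instr (.store rI rBit) ⨾ .instr (.add rI rI rOne))

theorem PureState.measure_apply (ψ : PureState n) (P : Pauli n) (b : Bool) :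
    ψ.measure P b = ENNReal.ofReal ((1 + (if b then 1 else -1) * ψ.expect P) / 2) := rfl

/-- The outcome of a measurement of a stabilizer element is its sign. -/
theorem PureState.eq_expect_of_mem_measure_support (ψ : PureState n) {P : Pauli n}
    (hP : P ∈ ψ.stab) {b : Bool} (hb : b ∈ (ψ.measure P).support) :
    ((if b then 1 else -1 : ℤ) : ℝ) = ψ.expect P := by
  rw [PMF.mem_support_iff, ψ.measure_apply] at hb
  rcases (ψ.mem_stab_iff P).mp hP with h | h <;> rw [h] at hb ⊢ <;> cases b <;> simp_all

/-- A measurement of a stabilizer element has a certain outcome, so one shot suffices. Nothing is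
claimed about generators outside the stabilizer group, which occur only if sampling has failed. -/
theorem signs_spec {t m : ℕ} {s : Store n} (hc : Consts t s) (hm : s.reg rM = m) :
    signs.Spec ψ s fun s' => s'.shots = s.shots + m ∧
      ∀ j < m, s.pau j ∈ ψ.stab → ((s'.arr j : ℤ) : ℝ) = ψ.expect (s.pau j) := by
  simp only [signs, Prog.spec_seq, Prog.spec_instr]
  simp only [Instr.exec, Store.setReg, Store.tick, hc.zero, add_zero]
  have hk : (Function.update s.reg rI 0 rM).toNat = m := by
    rw [Function.update_of_ne (by decide), hm]; rfl
  refine Prog.spec_loop (fun j s' => s'.reg rI = (j : ℕ) ∧ s'.shots = s.shots + j ∧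
    ∀ i < j, s.pau i ∈ ψ.stab → ((s'.arr i : ℤ) : ℝ) = ψ.expect (s.pau i)) ?_ ?_ ?_
  · simp [Store.tick]
  · rintro j hj s' ⟨h1, h2, h3⟩ hF
    have f1 : s'.reg rOne = 1 := by rw [hF.reg rOne rfl]; simpa using hc.one
    have fp : s'.pau = s.pau := hF.pau rfl
    simp only [Prog.spec_seq, Prog.spec_shot, Prog.spec_instr]
    intro o ho
    simp only [Instr.exec, Store.setReg, Store.tick, Store.nat, Function.update_apply,
      Nat.reduceEqDiff, if_true, if_false, h1, f1, fp, h2, Int.toNat_natCast] at ho ⊢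
    refine ⟨by simp, by ring, fun i hi hst => ?_⟩
    by_cases hij : i = j
    · subst hij
      rw [if_pos rfl]
      exact ψ.eq_expect_of_mem_measure_support hst ho
    · rw [if_neg hij]
      exact h3 i (by omega) hst
  · rintro s' ⟨_, h2, h3⟩ _
    rw [Store.nat, hk] at h2 h3
    exact ⟨h2, h3⟩

/-! ### Enumeration of the cosets -/

notation "rLen" => (18 : ℕ)

/-- One entry of the doubled list. -/
def enumInner : Prog :=
  .shot rJunk rId ⨾ .instr (.mul rVec rI rBase) ⨾ .instr (.add rI rI rOne) ⨾
  .instr (.add rVec rVec rOne)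

/-- Doubling of the list of products with one more generator. -/
def enumBody : Prog :=
  .shot rJunk rId ⨾ .instr (.add rI rId rZero) ⨾ .instr (.add rVec rId rLen) ⨾
  .loop rLen enumInner ⨾ .instr (.add rLen rLen rLen) ⨾ .instr (.add rBase rBase rOne)

/-- The number of generators modulo the stabilizer group, at most `2t`. -/
def enumInit : Prog :=
  .instr (.sub rJ rCnt rSize) ⨾ .instr (.add rI rT rT) ⨾
  .ite rJ rI (.instr (.const rJunk 0)) (.instr (.add rJ rI rZero)) ⨾
  .instr (.const rLen 1) ⨾ .instr (.add rBase rBase rSize)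

/-- All products of the generators modulo the stabilizer group, in the cells from `4n` on. -/
def enumerate : Prog := enumInit ⨾ .loop rJ enumBody

/-- The list of products of the first `j` generators; `f` is the Pauli array at the start and
the generators are in the cells from `b` on. -/
structure EnumInv (f : ℕ → Pauli n) (N b j : ℕ) (s : Store n) : Prop where
  len : s.reg rLen = ((2 ^ j : ℕ) : ℤ)
  base : s.reg rBase = ((b + j : ℕ) : ℤ)
  same : ∀ i, i ≤ 4 * n → s.pau i = f i
  cover : ∀ x ∈ cellSpan f b j, ∃ i < 2 ^ j, s.pau (4 * n + i) = x
  shots : s.shots ≤ N + 2 * 2 ^ j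

/-- Over 𝔽₂ the span with one more generator is the old list together with its translate by that
generator. -/
theorem enumBody_spec {f : ℕ → Pauli n} {t N b j : ℕ} {s : Store n} (hc : Consts t s)
    (hb : b + j < 4 * n) (h : EnumInv f N b j s) :
    enumBody.Spec ψ s.tick (EnumInv f N b (j + 1)) := by
  simp only [enumBody, Prog.spec_seq, Prog.spec_shot, Prog.spec_instr]
  intro o _
  generalize (if o = true then (1 : ℤ) else -1) = w
  simp only [Instr.exec, Store.setReg, Store.tick, Function.update_apply, Nat.reduceEqDiff,
    if_false, hc.zero, hc.idAddr, h.len, add_zero]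
  have hlen : ∀ A B C : ℤ, (Function.update (Function.update (Function.update s.reg rJunk A) rI B)
      rVec C rLen).toNat = 2 ^ j := by
    intro A B C
    simp only [Function.update_apply, Nat.reduceEqDiff, if_false, h.len]
    exact Int.toNat_natCast _
  refine Prog.spec_loop (fun l s' => s'.reg rI = ((4 * n + l : ℕ) : ℤ) ∧
    s'.reg rVec = ((4 * n + 2 ^ j + l : ℕ) : ℤ) ∧
    (∀ i, i < 4 * n + 2 ^ j → s'.pau i = s.pau i) ∧
    (∀ i < l, s'.pau (4 * n + 2 ^ j + i) = s.pau (4 * n + i) + f (b + j)) ∧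
    s'.shots = s.shots + 1 + l) ?_ ?_ ?_
  · simp [Store.tick]
  · rintro l hl s' ⟨h1, h2, h3, h4, h5⟩ hF
    rw [Store.nat, hlen] at hl
    have f1 : s'.reg rOne = 1 := by rw [hF.reg rOne rfl]; simpa using hc.one
    have fb : s'.reg rBase = ((b + j : ℕ) : ℤ) := by rw [hF.reg rBase rfl]; simpa using h.base
    have p1 : s'.pau (4 * n + l) = s.pau (4 * n + l) := h3 _ (by omega)
    have p2 : s'.pau (b + j) = f (b + j) := (h3 _ (by omega)).trans (h.same _ (by omega))
    simp only [enumInner, Prog.spec_seq, Prog.spec_shot, Prog.spec_instr]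
    intro o _
    simp only [Instr.exec, Store.setReg, Store.setPau, Store.tick, Store.nat, Function.update_apply,
      Nat.reduceEqDiff, if_true, if_false, h1, h2, f1, fb, p1, p2, h5, Int.toNat_natCast]
    refine ⟨by push_cast; ring, by push_cast; ring, fun i hi => ?_, fun i hi => ?_, by ring⟩
    · rw [if_neg (by omega)]
      exact h3 i hi
    · by_cases hil : i = l
      · rw [if_pos (by omega), hil]
      · rw [if_neg (by omega)]
        exact h4 i (by omega)
  · rintro s' ⟨h1, h2, h3, h4, h5⟩ hF
    rw [Store.nat, hlen] at h4 h5
    have f1 : s'.reg rOne = 1 := by rw [hF.reg rOne rfl]; simpa using hc.one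
    have fb : s'.reg rBase = ((b + j : ℕ) : ℤ) := by rw [hF.reg rBase rfl]; simpa using h.base
    have fl : s'.reg rLen = ((2 ^ j : ℕ) : ℤ) := by rw [hF.reg rLen rfl]; simpa using h.len
    have hpos : 0 < 2 ^ j := by positivity
    simp only [fl, fb, f1]
    refine ⟨?_, ?_, ?_, ?_, ?_⟩
    · simp; ring
    · simp; ring
    · intro i hi
      exact (h3 i (by omega)).trans (h.same i hi)
    · intro x hx
      rw [cellSpan, cells_succ_right] at hx
      obtain ⟨a, z, hz, rfl⟩ := Submodule.mem_span_insert.mp hx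
      obtain ⟨i, hi, rfl⟩ := h.cover z hz
      have h01 : ∀ a : ZMod 2, a = 0 ∨ a = 1 := by decide
      rcases h01 a with rfl | rfl
      · refine ⟨i, by rw [pow_succ]; omega, ?_⟩
        rw [zero_smul, zero_add]
        exact h3 _ (by omega)
      · refine ⟨2 ^ j + i, by rw [pow_succ]; omega, ?_⟩
        rw [one_smul, ← add_assoc, add_comm (f (b + j))]
        exact h4 i hi
    · have := h.shots
      change s'.shots ≤ _
      rw [pow_succ]
      omega

/-- The cap 2t keeps the list at 4^t entries or fewer on every run, even if sampling has failed. On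
good runs c ≤ 2t and the cap loses nothing. -/
theorem enumerate_spec {t m k c : ℕ} {s : Store n} (h : Complemented ψ t m k c s) :
    enumerate.Spec ψ s fun s' => EnumInv s.pau s.shots (2 * n + k) (min c (2 * t)) s' := by
  have htot := h.total
  have e1 : ((k + c : ℕ) : ℤ) - k = c := by push_cast; ring
  have e2 : (t : ℤ) + t = ((2 * t : ℕ) : ℤ) := by push_cast; ring
  have e3 : ((2 * n : ℕ) : ℤ) + k = ((2 * n + k : ℕ) : ℤ) := by push_cast; ring
  have hinit : enumInit.Spec ψ s fun s' => s'.reg rJ = ((min c (2 * t) : ℕ) : ℤ) ∧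
      s'.reg rLen = 1 ∧ s'.reg rBase = ((2 * n + k : ℕ) : ℤ) ∧ s'.shots = s.shots := by
    simp only [enumInit, Prog.spec_seq, Prog.spec_instr, Prog.spec_ite]
    simp only [Instr.exec, Store.setReg, Store.tick, Function.update_apply, Nat.reduceEqDiff,
      if_true, if_false, OfNat.one_ne_ofNat, h.cnt, h.size, h.base, h.consts.gates, h.consts.zero,
      add_zero, e1, e2, e3, Nat.cast_le, and_true]
    split_ifs with hct
    · rw [min_eq_left hct]
    · rw [min_eq_right (by omega)]
  refine Prog.spec_seq_frame hinit fun s₁ ⟨h1, h2, h3, h4⟩ hF => ?_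
  have hk : s₁.nat rJ = min c (2 * t) := by rw [Store.nat, h1]; exact Int.toNat_natCast _
  have hpau : s₁.pau = s.pau := hF.pau rfl
  have hc₁ : Consts t s₁ := h.consts.of_frame hF (by decide)
  refine Prog.spec_loop (EnumInv s.pau s.shots (2 * n + k)) ?_ ?_ ?_
  -- The empty product is the identity, which already sits in cell 4n as entry 0 of the list.
  · refine ⟨h2.trans (by simp), h3.trans (by simp), fun i _ => by rw [← hpau]; rfl, ?_, ?_⟩
    · intro x hx
      have e : cells s.pau (2 * n + k) 0 = ∅ := by
        rw [cells, add_zero, Set.Ico_self, Set.image_empty]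
      rw [cellSpan, e, Submodule.span_empty, Submodule.mem_bot] at hx
      refine ⟨0, by simp, ?_⟩
      rw [hx, ← h.id, ← hpau]
      rfl
    · change s₁.shots ≤ _
      omega
  · intro j hj s' hI hF'
    rw [hk] at hj
    have : j < c := lt_of_lt_of_le hj (min_le_left _ _)
    exact enumBody_spec (hc₁.of_frame hF' (by decide)) (by omega) hI
  · intro s' hI _
    rwa [hk] at hI

/-! ### Tables for the search of exact expectation values -/

notation "rQ" => (19 : ℕ)
notation "rP" => (20 : ℕ)
notation "rU" => (21 : ℕ)
notation "rA" => (22 : ℕ)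
notation "rB" => (23 : ℕ)
notation "rD" => (24 : ℕ)
notation "rMeas" => (25 : ℕ)
notation "rMA" => (26 : ℕ)
notation "rMB" => (27 : ℕ)
notation "rTol" => (28 : ℕ)
notation "rLow" => (29 : ℕ)
notation "rWidth" => (30 : ℕ)
notation "rRow" => (31 : ℕ)
notation "rDst" => (32 : ℕ)
notation "rOut" => (33 : ℕ)
notation "rSrc" => (34 : ℕ)
notation "rNum" => (35 : ℕ)
notation "rAcc" => (36 : ℕ)
notation "rCur" => (37 : ℕ)
notation "rLine" => (38 : ℕ)
notation "rValA" => (39 : ℕ)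
notation "rValB" => (40 : ℕ)
notation "rSolA" => (41 : ℕ)
notation "rSolB" => (42 : ℕ)

/-- A continued fraction approximation `rP / rQ` of `√2`. -/
def pell : Prog :=
  .instr (.const rQ 1) ⨾ .instr (.const rP 1) ⨾ .instr (.const rCnt 4) ⨾
  .instr (.add rCnt rCnt rT) ⨾ .instr (.add rCnt rCnt rT) ⨾
  .loop rCnt (.shot rJunk rId ⨾ .instr (.add rU rP rQ) ⨾ .instr (.add rP rU rQ) ⨾
    .instr (.add rQ rU rZero))

/-- The map (p, q) ↦ (p+2q, p+q) changes the sign of p²-2q² and, as q ≤ p, at least doubles q. After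
4+2t rounds q² ≥ 256·16^t, more than the decoding asks for. -/
theorem pell_spec {t : ℕ} {s : Store n} (hc : Consts t s) :
    pell.Spec ψ s fun s' => 0 < s'.reg rQ ∧ 0 < s'.reg rP ∧
      |s'.reg rP ^ 2 - 2 * s'.reg rQ ^ 2| = 1 ∧ 128 * 8 ^ t ≤ s'.reg rQ ^ 2 ∧
      s'.shots = s.shots + (4 + 2 * t) := by
  have e : (4 : ℤ) + t + t = ((4 + 2 * t : ℕ) : ℤ) := by push_cast; ring
  simp only [pell, Prog.spec_seq, Prog.spec_instr]
  simp only [Instr.exec, Store.setReg, Store.tick, Function.update_apply, Nat.reduceEqDiff,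
    if_true, if_false, OfNat.one_ne_ofNat, hc.gates, e, Function.update_idem]
  have hcnt : ∀ f : ℕ → ℤ,
      (Function.update f rCnt ((4 + 2 * t : ℕ) : ℤ) rCnt).toNat = 4 + 2 * t := by
    intro f
    rw [Function.update_self]; exact Int.toNat_natCast _
  refine Prog.spec_loop (fun j s' => 2 ^ j ≤ s'.reg rQ ∧ s'.reg rQ ≤ s'.reg rP ∧
      |s'.reg rP ^ 2 - 2 * s'.reg rQ ^ 2| = 1 ∧ s'.shots = s.shots + j) ?_ ?_ ?_
  · simp [Store.tick]
  · rintro j - s' ⟨h1, h2, h3, h4⟩ hF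
    have fz : s'.reg rZero = 0 := by rw [hF.reg rZero rfl]; simpa using hc.zero
    simp only [Prog.spec_seq, Prog.spec_shot, Prog.spec_instr]
    intro o _
    simp only [Instr.exec, Store.setReg, Store.tick, Function.update_apply,
      Nat.reduceEqDiff, if_true, if_false, fz, h4, add_zero]
    have hp : (0 : ℤ) < 2 ^ j := by positivity
    refine ⟨by rw [pow_succ]; linarith, by linarith, ?_, by ring⟩
    rw [← h3, ← abs_neg]
    congr 1
    ring
  · rintro s' ⟨h1, h2, h3, h4⟩ -
    rw [Store.nat, hcnt] at h1 h4
    have hp : (0 : ℤ) < 2 ^ (4 + 2 * t) := by positivity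
    refine ⟨by linarith, by linarith, h3, ?_, h4⟩
    calc (128 * 8 ^ t : ℤ) ≤ 256 * 16 ^ t := by gcongr <;> norm_num
      _ = (2 ^ (4 + 2 * t)) ^ 2 := by
        rw [← pow_mul, show (4 + 2 * t) * 2 = 8 + 4 * t by ring, pow_add, pow_mul]
        norm_num
      _ ≤ s'.reg rQ ^ 2 := pow_le_pow_left₀ hp.le h1 2

/-- Integer weights in which the possible expectation values are told apart. -/
def Scale (t : ℕ) (q A B D : ℤ) : Prop :=
  0 < q ∧ ∃ p α β : ℤ, 0 < p ∧ |p ^ 2 - 2 * q ^ 2| = 1 ∧ 128 * 8 ^ t ≤ q ^ 2 ∧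
    0 ≤ α ∧ α ≤ 2 ^ t ∧ 0 ≤ β ∧ β ≤ 2 ^ t ∧ Real.sqrt 2 ^ t = α + β * Real.sqrt 2 ∧
    A = 32 * 2 ^ t * (α * q + β * p) ∧ B = 32 * 2 ^ t * (2 * β * q + α * p) ∧ D = 32 * 4 ^ t * q

theorem Scale.pos {t : ℕ} {q A B D : ℤ} (h : Scale t q A B D) : 0 < D := by
  obtain ⟨hq, p, α, β, -, -, -, -, -, -, -, -, -, -, rfl⟩ := h
  positivity

theorem Scale.decode {t : ℕ} {q A B D M acc a₀ b₀ : ℤ} {x : ℝ} (h : Scale t q A B D) (hM : 0 < M)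
    (ha₀ : |a₀| ≤ 2 ^ t) (hb₀ : |b₀| ≤ 2 ^ t)
    (hx : x = (a₀ + b₀ * Real.sqrt 2) / Real.sqrt 2 ^ t)
    (hacc : |(acc : ℝ) / D - M * x| ≤ M / (64 * 4 ^ t)) {a b : ℤ} (ha : |a| ≤ 2 ^ t)
    (hb : |b| ≤ 2 ^ t) :
    |a * (M * A) + b * (M * B) - acc| ≤ M * q ↔ a = a₀ ∧ b = b₀ := by
  obtain ⟨hq, p, α, β, h1, h2, h3, h4, h5, h6, h7, h8, h9, h10, h11⟩ := h
  exact TDoped.decode hq h1 hM h2 h3 h4 h5 h6 h7 h8 h9 h10 h11 ha₀ hb₀ hx hacc ha hb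

/-- The weights `rA`, `rB`, `rD`. -/
def weights : Prog :=
  .instr (.const rCnt 5) ⨾ .instr (.add rA rQ rZero) ⨾ .instr (.add rB rP rZero) ⨾
  double rCnt rA ⨾ double rCnt rB ⨾ .instr (.add rD rA rZero) ⨾
  .loop rT (.shot rJunk rId ⨾ .instr (.add rU rA rA) ⨾ .instr (.add rA rB rB) ⨾
    .instr (.add rB rU rU) ⨾ .instr (.add rD rD rD) ⨾ .instr (.add rD rD rD))

/-- Five doublings supply the factor 32. Each further round replaces (A, B, D) by (2B, 4A, 4D):
multiplication of α + β√2 by √2 turns (α, β) into (2β, α), and the prefactor 2^t doubles. -/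
theorem weights_spec {t : ℕ} {s : Store n} (hc : Consts t s) {q p : ℤ} (hrq : s.reg rQ = q)
    (hrp : s.reg rP = p) (hq : 0 < q) (hp : 0 < p) (hpell : |p ^ 2 - 2 * q ^ 2| = 1)
    (hqt : 128 * 8 ^ t ≤ q ^ 2) :
    weights.Spec ψ s fun s' => Scale t q (s'.reg rA) (s'.reg rB) (s'.reg rD) ∧
      s'.shots = s.shots + (10 + t) := by
  have hs2 : Real.sqrt 2 * Real.sqrt 2 = 2 := Real.mul_self_sqrt (by norm_num)
  simp only [weights, Prog.spec_seq, Prog.spec_instr]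
  simp only [Instr.exec, Store.setReg, Store.tick, Function.update_apply, Nat.reduceEqDiff,
    if_false, hc.zero, hrq, hrp, add_zero]
  refine (((double_spec (by decide) (k := 5) (by simp)).and ((double rCnt rA).spec_frame ψ _))).mono
    fun s₁ ⟨⟨h1, h2⟩, hF₁⟩ => ?_
  have c1 : s₁.reg rCnt = (5 : ℕ) := by rw [hF₁.reg rCnt rfl]; simp
  have b1 : s₁.reg rB = p := by rw [hF₁.reg rB rfl]; simp
  have a1 : s₁.reg rA = 32 * q := by rw [h1]; simp
  refine ((double_spec (by decide) c1).and ((double rCnt rB).spec_frame ψ _)).mono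
    fun s₂ ⟨⟨h3, h4⟩, hF₂⟩ => ?_
  have a2 : s₂.reg rA = 32 * q := by rw [hF₂.reg rA rfl, a1]
  have b2 : s₂.reg rB = 32 * p := by rw [h3, b1]; norm_num
  have z2 : s₂.reg rZero = 0 := by
    rw [hF₂.reg rZero rfl, hF₁.reg rZero rfl]; simpa using hc.zero
  have t2 : s₂.reg rT = t := by
    rw [hF₂.reg rT rfl, hF₁.reg rT rfl]; simpa using hc.gates
  simp only [a2, z2, add_zero]
  have hcnt : (Function.update s₂.reg rD (32 * q) rT).toNat = t := by
    simp [t2]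
  refine Prog.spec_loop (fun j s' => s'.shots = s.shots + (10 + j) ∧ ∃ α β : ℤ,
    0 ≤ α ∧ α ≤ 2 ^ j ∧ 0 ≤ β ∧ β ≤ 2 ^ j ∧ Real.sqrt 2 ^ j = α + β * Real.sqrt 2 ∧
    s'.reg rA = 32 * 2 ^ j * (α * q + β * p) ∧ s'.reg rB = 32 * 2 ^ j * (2 * β * q + α * p) ∧
    s'.reg rD = 32 * 4 ^ j * q) ?_ ?_ ?_
  · refine ⟨?_, 1, 0, by norm_num, by norm_num, by norm_num, by norm_num, by norm_num, ?_, ?_, ?_⟩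
    · change s₂.shots = _
      rw [h4, h2]
    · simp [Store.tick, a2]
    · simp [Store.tick, b2]
    · simp [Store.tick]
  · rintro j - s' ⟨h0, α, β, g1, g2, g3, g4, g5, g6, g7, g8⟩ -
    simp only [Prog.spec_seq, Prog.spec_shot, Prog.spec_instr]
    intro o _
    simp only [Instr.exec, Store.setReg, Store.tick, Function.update_apply,
      Nat.reduceEqDiff, if_true, if_false, g6, g7, g8, h0]
    have hpow : (0 : ℤ) < 2 ^ j := by positivity
    refine ⟨by ring, 2 * β, α, by linarith, by rw [pow_succ]; linarith, g1,
      by rw [pow_succ]; linarith, ?_, by ring, by ring, by ring⟩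
    rw [pow_succ, g5]
    push_cast
    linear_combination (β : ℝ) * hs2
  · rintro s' ⟨h0, α, β, g1, g2, g3, g4, g5, g6, g7, g8⟩ -
    rw [Store.nat, hcnt] at *
    exact ⟨⟨hq, p, α, β, hp, hpell, hqt, g1, g2, g3, g4, g5, g6, g7, g8⟩, h0⟩

/-- The number of shots per expectation value, `2^(14+4t) (n+2t)`, and the weights times it. -/
def totals : Prog :=
  .instr (.add rMeas rN rT) ⨾ .instr (.add rMeas rMeas rT) ⨾ .instr (.const rCnt 14) ⨾
  .instr (.add rU rT rT) ⨾ .instr (.add rU rU rU) ⨾ .instr (.add rCnt rCnt rU) ⨾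
  double rCnt rMeas ⨾ .instr (.const rMA 0) ⨾ .instr (.const rMB 0) ⨾ .instr (.const rTol 0) ⨾
  .loop rMeas (.shot rJunk rId ⨾ .instr (.add rMA rMA rA) ⨾ .instr (.add rMB rMB rB) ⨾
    .instr (.add rTol rTol rQ))

/-- Products with the number of shots M are formed by M additions, each paid by a shot. Carrying M
along as a factor spares the search any division. -/
theorem totals_spec {t : ℕ} {s : Store n} (hc : Consts t s) :
    totals.Spec ψ s fun s' => s'.reg rMeas = ((2 ^ (14 + 4 * t) * (n + 2 * t) : ℕ) : ℤ) ∧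
      s'.reg rMA = ((2 ^ (14 + 4 * t) * (n + 2 * t) : ℕ) : ℤ) * s.reg rA ∧
      s'.reg rMB = ((2 ^ (14 + 4 * t) * (n + 2 * t) : ℕ) : ℤ) * s.reg rB ∧
      s'.reg rTol = ((2 ^ (14 + 4 * t) * (n + 2 * t) : ℕ) : ℤ) * s.reg rQ ∧
      s'.shots = s.shots + (14 + 4 * t) + 2 ^ (14 + 4 * t) * (n + 2 * t) := by
  have e : (14 : ℤ) + (t + t + (t + t)) = ((14 + 4 * t : ℕ) : ℤ) := by push_cast; ring
  simp only [totals, Prog.spec_seq, Prog.spec_instr]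
  simp only [Instr.exec, Store.setReg, Store.tick, Function.update_apply, Nat.reduceEqDiff,
    if_true, if_false, OfNat.one_ne_ofNat, hc.gates, hc.qubits, e]
  refine (((double_spec (by decide) (k := 14 + 4 * t) (by simp)).and
    ((double rCnt rMeas).spec_frame ψ _))).mono fun s₁ ⟨⟨h1, h2⟩, hF₁⟩ => ?_
  have m1 : s₁.reg rMeas = ((2 ^ (14 + 4 * t) * (n + 2 * t) : ℕ) : ℤ) := by
    rw [h1]
    simp only [Function.update_apply, Nat.reduceEqDiff, if_true, if_false]
    push_cast
    ring
  have a1 : s₁.reg rA = s.reg rA := by rw [hF₁.reg rA rfl]; simp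
  have b1 : s₁.reg rB = s.reg rB := by rw [hF₁.reg rB rfl]; simp
  have q1 : s₁.reg rQ = s.reg rQ := by rw [hF₁.reg rQ rfl]; simp
  have hcnt : (Function.update (Function.update (Function.update s₁.reg rMA 0) rMB 0) rTol 0
      rMeas).toNat = 2 ^ (14 + 4 * t) * (n + 2 * t) := by
    simp only [Function.update_apply, Nat.reduceEqDiff, if_false, m1]
    exact Int.toNat_natCast _
  refine Prog.spec_loop (fun j s' => s'.reg rMA = j * s.reg rA ∧ s'.reg rMB = j * s.reg rB ∧
    s'.reg rTol = j * s.reg rQ ∧ s'.shots = s.shots + (14 + 4 * t) + j) ?_ ?_ ?_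
  · simp [Store.tick, h2]
  · rintro j - s' ⟨g1, g2, g3, g4⟩ hF
    have fa : s'.reg rA = s.reg rA := by rw [hF.reg rA rfl]; simpa using a1
    have fb : s'.reg rB = s.reg rB := by rw [hF.reg rB rfl]; simpa using b1
    have fq : s'.reg rQ = s.reg rQ := by rw [hF.reg rQ rfl]; simpa using q1
    simp only [Prog.spec_seq, Prog.spec_shot, Prog.spec_instr]
    intro o _
    simp only [Instr.exec, Store.setReg, Store.tick, Function.update_apply,
      Nat.reduceEqDiff, if_true, if_false, fa, fb, fq, g1, g2, g3, g4]
    refine ⟨?_, ?_, ?_, by ring⟩ <;> push_cast <;> ring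
  · rintro s' ⟨g1, g2, g3, g4⟩ hF
    rw [Store.nat, hcnt] at *
    refine ⟨?_, g1, g2, g3, g4⟩
    rw [hF.reg rMeas rfl]; simpa using m1

/-- The range of the numerators and the value at its corner. -/
def ranges : Prog :=
  .instr (.const rU 1) ⨾ double rT rU ⨾ .instr (.sub rLow rZero rU) ⨾
  .instr (.add rWidth rU rU) ⨾ .instr (.add rWidth rWidth rOne) ⨾ .instr (.const rRow 0) ⨾
  .loop rU (.shot rJunk rId ⨾ .instr (.sub rRow rRow rMA) ⨾ .instr (.sub rRow rRow rMB))

theorem ranges_spec {t : ℕ} {s : Store n} (hc : Consts t s) :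
    ranges.Spec ψ s fun s' => s'.reg rLow = -2 ^ t ∧
      s'.reg rWidth = ((2 * 2 ^ t + 1 : ℕ) : ℤ) ∧
      s'.reg rRow = -2 ^ t * s.reg rMA + -2 ^ t * s.reg rMB ∧
      s'.shots = s.shots + t + 2 ^ t := by
  simp only [ranges, Prog.spec_seq, Prog.spec_instr]
  simp only [Instr.exec, Store.setReg, Store.tick]
  refine (((double_spec (by decide) (k := t) (by simpa using hc.gates)).and
    ((double rT rU).spec_frame ψ _))).mono fun s₁ ⟨⟨h1, h2⟩, hF₁⟩ => ?_
  have u1 : s₁.reg rU = 2 ^ t := by rw [h1]; simp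
  have z1 : s₁.reg rZero = 0 := by rw [hF₁.reg rZero rfl]; simpa using hc.zero
  have o1 : s₁.reg rOne = 1 := by rw [hF₁.reg rOne rfl]; simpa using hc.one
  have a1 : s₁.reg rMA = s.reg rMA := by rw [hF₁.reg rMA rfl]; simp
  have b1 : s₁.reg rMB = s.reg rMB := by rw [hF₁.reg rMB rfl]; simp
  simp only [Function.update_apply, Nat.reduceEqDiff, if_true, if_false, u1, z1, o1, zero_sub]
  have hcnt : ∀ x y z w : ℤ, (Function.update (Function.update (Function.update (Function.update
      s₁.reg rLow x) rWidth y) rWidth z) rRow w rU).toNat = 2 ^ t := by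
    intro x y z w
    simp only [Function.update_apply, Nat.reduceEqDiff, if_false, u1]
    exact Int.toNat_natCast (2 ^ t)
  refine Prog.spec_loop (fun j s' => s'.reg rRow = -j * s.reg rMA + -j * s.reg rMB ∧
    s'.shots = s.shots + t + j) ?_ ?_ ?_
  · simp [Store.tick, h2]
  · rintro j - s' ⟨g1, g2⟩ hF
    have fa : s'.reg rMA = s.reg rMA := by rw [hF.reg rMA rfl]; simpa using a1
    have fb : s'.reg rMB = s.reg rMB := by rw [hF.reg rMB rfl]; simpa using b1
    simp only [Prog.spec_seq, Prog.spec_shot, Prog.spec_instr]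
    intro o _
    simp only [Instr.exec, Store.setReg, Store.tick, Function.update_apply,
      Nat.reduceEqDiff, if_true, if_false, fa, fb, g1, g2]
    exact ⟨by push_cast; ring, by ring⟩
  · rintro s' ⟨g1, g2⟩ hF
    rw [Store.nat, hcnt] at *
    refine ⟨?_, ?_, ?_, g2⟩
    · rw [hF.reg rLow rfl]; simp
    · rw [hF.reg rWidth rfl]; simp; ring
    · rw [g1]; push_cast; ring

/-- The tables of the estimation phase. -/
structure Tables (t : ℕ) (q A B D : ℤ) (M : ℕ) (s : Store n) : Prop where
  weight : s.reg rD = D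
  meas : s.reg rMeas = M
  mulA : s.reg rMA = M * A
  mulB : s.reg rMB = M * B
  tol : s.reg rTol = M * q
  low : s.reg rLow = -2 ^ t
  width : s.reg rWidth = ((2 * 2 ^ t + 1 : ℕ) : ℤ)
  row : s.reg rRow = -2 ^ t * (M * A) + -2 ^ t * (M * B)

theorem Tables.of_frame {t : ℕ} {q A B D : ℤ} {M : ℕ} {s s' : Store n} (h : Tables t q A B D M s)
    {p : Prog} (hF : p.Frame s s') (hp : ∀ r < 32, 24 ≤ r → p.writes r = false) :
    Tables t q A B D M s' :=
  ⟨(hF.reg _ (hp _ (by decide) (by decide))).trans h.weight,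
    (hF.reg _ (hp _ (by decide) (by decide))).trans h.meas,
    (hF.reg _ (hp _ (by decide) (by decide))).trans h.mulA,
    (hF.reg _ (hp _ (by decide) (by decide))).trans h.mulB,
    (hF.reg _ (hp _ (by decide) (by decide))).trans h.tol,
    (hF.reg _ (hp _ (by decide) (by decide))).trans h.low,
    (hF.reg _ (hp _ (by decide) (by decide))).trans h.width,
    (hF.reg _ (hp _ (by decide) (by decide))).trans h.row⟩

/-- All tables of the estimation phase. -/
def tables : Prog := pell ⨾ weights ⨾ totals ⨾ ranges

theorem tables_spec {t : ℕ} {s : Store n} (hc : Consts t s) :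
    tables.Spec ψ s fun s' => (∃ q A B D, Scale t q A B D ∧
      Tables t q A B D (2 ^ (14 + 4 * t) * (n + 2 * t)) s') ∧
      s'.shots = s.shots + (28 + 8 * t + 2 ^ t + 2 ^ (14 + 4 * t) * (n + 2 * t)) := by
  refine Prog.spec_seq_frame (pell_spec hc) fun s₁ ⟨h1, h2, h3, h4, h5⟩ hF₁ => ?_
  have hc₁ := hc.of_frame hF₁ (by decide)
  refine Prog.spec_seq_frame (weights_spec hc₁ rfl rfl h1 h2 h3 h4) fun s₂ ⟨h6, h7⟩ hF₂ => ?_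
  have hc₂ := hc₁.of_frame hF₂ (by decide)
  have hq : s₂.reg rQ = s₁.reg rQ := hF₂.reg rQ rfl
  refine Prog.spec_seq_frame (totals_spec hc₂) fun s₃ ⟨g1, g2, g3, g4, g5⟩ hF₃ => ?_
  have hc₃ := hc₂.of_frame hF₃ (by decide)
  refine ((ranges_spec hc₃).and (ranges.spec_frame ψ _)).mono fun s₄ ⟨⟨k1, k2, k3, k4⟩, hF₄⟩ => ?_
  rw [hq] at g4
  refine ⟨⟨_, _, _, _, h6, ?_, ?_, ?_, ?_, ?_, k1, k2, ?_⟩, by rw [k4, g5, h7, h5]; ring⟩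
  · rw [hF₄.reg rD rfl, hF₃.reg rD rfl]
  · rw [hF₄.reg rMeas rfl, g1]
  · rw [hF₄.reg rMA rfl, g2]
  · rw [hF₄.reg rMB rfl, g3]
  · rw [hF₄.reg rTol rfl, g4]
  · rw [k3, g2, g3]

/-! ### Estimation of an expectation value -/

/-- One measurement of the current Pauli string. -/
def measureBody : Prog :=
  .shot rBit rSrc ⨾
  .ite rZero rBit (.instr (.add rAcc rAcc rD)) (.instr (.sub rAcc rAcc rD))

/-- The sum of the outcomes of `rMeas` measurements, times `rD`. -/
def measureEntry : Prog := .instr (.const rAcc 0) ⨾ .loop rMeas measureBody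

/-! ### Concentration of the measurement outcomes -/

theorem pmfE_measureBody {s : Store n} (hz : s.reg rZero = 0) (F : ℤ → ℝ≥0∞) :
    pmfE (measureBody.run ψ s) (fun s' => F (s'.reg rAcc)) =
      ψ.measure (s.pau (s.nat rSrc)) true * F (s.reg rAcc + s.reg rD) +
        ψ.measure (s.pau (s.nat rSrc)) false * F (s.reg rAcc - s.reg rD) := by
  simp only [measureBody, Prog.run]
  rw [pmfE_bind, pmfE_map, pmfE_fintype, Fintype.sum_bool]
  simp [Store.setReg, Store.tick, hz, pmfE_pure, Instr.exec]

/-- Exponential moment of a centred ±1 outcome. The exponents have modulus at most 1, where exp u ≤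
1 + u + u²; the linear terms average to zero and the quadratic ones to l²(1-x²). -/
theorem two_point_moment_le {x l : ℝ} (hx : |x| ≤ 1) (hl : |l| ≤ 1 / 2) :
    (1 + x) / 2 * Real.exp (l * (1 - x)) + (1 - x) / 2 * Real.exp (l * (-1 - x)) ≤
      Real.exp (l ^ 2) := by
  obtain ⟨h1, h2⟩ := abs_le.mp hx
  have key : ∀ y : ℝ, |y| ≤ 2 → Real.exp (l * y) ≤ 1 + l * y + (l * y) ^ 2 := by
    intro y hy
    have e : |l * y| ≤ 1 := by
      rw [abs_mul]
      nlinarith [abs_nonneg l, abs_nonneg y]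
    have := (abs_le.mp (Real.abs_exp_sub_one_sub_id_le e)).2
    linarith
  have k1 := key (1 - x) (abs_le.mpr ⟨by linarith, by linarith⟩)
  have k2 := key (-1 - x) (abs_le.mpr ⟨by linarith, by linarith⟩)
  calc _ ≤ (1 + x) / 2 * (1 + l * (1 - x) + (l * (1 - x)) ^ 2) +
        (1 - x) / 2 * (1 + l * (-1 - x) + (l * (-1 - x)) ^ 2) :=
        add_le_add (mul_le_mul_of_nonneg_left k1 (by linarith))
          (mul_le_mul_of_nonneg_left k2 (by linarith))
    _ = 1 + l ^ 2 * (1 - x ^ 2) := by ring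
    _ ≤ l ^ 2 + 1 := by nlinarith [mul_nonneg (sq_nonneg l) (sq_nonneg x)]
    _ ≤ Real.exp (l ^ 2) := Real.add_one_le_exp _

/-- The exponential moment of the deviation of the accumulated outcomes. -/
noncomputable def moment (D : ℤ) (x l : ℝ) (j : ℕ) (s : Store n) : ℝ≥0∞ :=
  ENNReal.ofReal (Real.exp (l * ((s.reg rAcc : ℝ) / D - j * x)))

/-- Each shot acts on a fresh copy, so the moment conditioned on the past grows by a factor of at
most exp(l²); iterating this replaces an appeal to independence. -/
theorem pmfE_moment_le {s : Store n} {D : ℤ} (hD : 0 < D) (hz : s.reg rZero = 0)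
    (hd : s.reg rD = D) {l : ℝ} (hl : |l| ≤ 1 / 2) (j : ℕ) :
    pmfE (measureBody.run ψ s) (moment D (ψ.expect (s.pau (s.nat rSrc))) l (j + 1)) ≤
      ENNReal.ofReal (Real.exp (l ^ 2)) *
        moment D (ψ.expect (s.pau (s.nat rSrc))) l j s := by
  set x := ψ.expect (s.pau (s.nat rSrc)) with hxdef
  have hx : |x| ≤ 1 := abs_expect_le ψ _
  obtain ⟨h1, h2⟩ := abs_le.mp hx
  have hD' : (D : ℝ) ≠ 0 := by exact_mod_cast hD.ne'
  have e := pmfE_measureBody (ψ := ψ) hz fun a : ℤ =>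
    ENNReal.ofReal (Real.exp (l * ((a : ℝ) / D - (j + 1 : ℕ) * x)))
  refine (le_of_eq e).trans ?_
  rw [ψ.measure_apply, ψ.measure_apply, ← hxdef, moment, hd,
    ← ENNReal.ofReal_mul (by simp only [if_true]; linarith),
    ← ENNReal.ofReal_mul (by simp only [Bool.false_eq_true, if_false]; linarith),
    ← ENNReal.ofReal_mul (Real.exp_pos _).le, ← ENNReal.ofReal_add (mul_nonneg
      (by simp only [if_true]; linarith) (Real.exp_pos _).le) (mul_nonneg
      (by simp only [Bool.false_eq_true, if_false]; linarith) (Real.exp_pos _).le)]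
  refine ENNReal.ofReal_le_ofReal ?_
  simp only [if_true, Bool.false_eq_true, if_false, one_mul, neg_mul]
  have e1 : l * (((s.reg rAcc + D : ℤ) : ℝ) / D - (j + 1 : ℕ) * x) =
      l * (1 - x) + l * ((s.reg rAcc : ℝ) / D - j * x) := by
    push_cast
    field_simp
    ring
  have e2 : l * (((s.reg rAcc - D : ℤ) : ℝ) / D - (j + 1 : ℕ) * x) =
      l * (-1 - x) + l * ((s.reg rAcc : ℝ) / D - j * x) := by
    push_cast
    field_simp
    ring
  rw [e1, e2, Real.exp_add, Real.exp_add, ← mul_assoc, ← mul_assoc, ← add_mul]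
  exact mul_le_mul_of_nonneg_right (two_point_moment_le hx hl) (Real.exp_pos _).le

theorem measureEntry_spec {s : Store n} {M : ℕ} (hM : s.reg rMeas = M) :
    measureEntry.Spec ψ s fun s' => s'.shots = s.shots + M := by
  simp only [measureEntry, Prog.spec_seq, Prog.spec_instr]
  have hk : ((Instr.const rAcc 0).exec s).tick.nat rMeas = M := by
    simp [Store.nat, Instr.exec, Store.setReg, Store.tick, hM]
  refine Prog.spec_loop (fun j s' => s'.shots = s.shots + j) rfl ?_ ?_
  · rintro j - s' h -
    simp only [measureBody, Prog.spec_seq, Prog.spec_shot, Prog.spec_ite, Prog.spec_instr]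
    intro o _
    simp only [Instr.exec, Store.setReg, Store.tick, h, add_assoc, ite_self]
  · intro s' h _
    rwa [hk] at h

/-- The accumulated outcomes are close to their expectation, with high probability. -/
theorem measureEntry_failProb {s : Store n} {D : ℤ} (hD : 0 < D) (hz : s.reg rZero = 0)
    (hd : s.reg rD = D) {M : ℕ} (hM : s.reg rMeas = M) {η : ℝ} (hη : 0 ≤ η) (hη1 : η ≤ 1) :
    failProb (measureEntry.run ψ s) (fun s' =>
      |(s'.reg rAcc : ℝ) / D - M * ψ.expect (s.pau (s.nat rSrc))| ≤ M * η) ≤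
      2 * ENNReal.ofReal (Real.exp (-(M * η ^ 2 / 4))) := by
  set x := ψ.expect (s.pau (s.nat rSrc)) with hx
  refine Prog.failProb_seq_of_spec (R := fun s' => s'.reg rAcc = 0)
    (Prog.spec_instr.mpr (by simp [Instr.exec, Store.setReg, Store.tick])) fun s₁ h0 hF => ?_
  have hk : s₁.nat rMeas = M := by rw [Store.nat, hF.reg rMeas rfl, hM]; rfl
  have hx₁ : ψ.expect (s₁.pau (s₁.nat rSrc)) = x := by
    rw [hx, hF.pau rfl, Store.nat, hF.reg rSrc rfl, Store.nat]
  rw [Prog.run_loop, hk]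
  have hexp : ∀ l : ℝ, |l| ≤ 1 / 2 → pmfE (measureBody.rounds ψ M s₁.tick) (moment D x l M) ≤
      ENNReal.ofReal (Real.exp (M * l ^ 2)) := by
    intro l hl
    have := Prog.pmfE_rounds_le (ψ := ψ) (p := measureBody) (k := M) (s := s₁.tick)
      (ρ := ENNReal.ofReal (Real.exp (l ^ 2))) (fun _ s' => measureBody.Frame s₁ s')
      (moment D x l) (Prog.Frame.refl_tick _ _)
      (fun j _ s' h => (measureBody.spec_frame ψ s'.tick).mono fun _ h' => h.trans_tick h')
      fun j _ s' h => by
        have e : ψ.expect (s'.tick.pau (s'.tick.nat rSrc)) = x := by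
          change ψ.expect (s'.pau (s'.nat rSrc)) = x
          rw [← hx₁, h.pau rfl, Store.nat, h.reg rSrc rfl, Store.nat]
        have := pmfE_moment_le (ψ := ψ) (s := s'.tick) hD
          ((h.reg rZero rfl).trans ((hF.reg rZero rfl).trans hz))
          ((h.reg rD rfl).trans ((hF.reg rD rfl).trans hd)) hl j
        rw [e] at this
        exact this
    refine this.trans (le_of_eq ?_)
    have e0 : moment D x l 0 s₁.tick = 1 := by
      simp [moment, Store.tick, h0]
    rw [e0, mul_one, ← ENNReal.ofReal_pow (Real.exp_pos _).le, ← Real.exp_nat_mul]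
  have hc : (0 : ℝ) ≤ Real.exp (-(M * η ^ 2 / 2)) := (Real.exp_pos _).le
  have hb : ∀ l : ℝ, l ^ 2 = (η / 2) ^ 2 → ENNReal.ofReal (Real.exp (-(M * η ^ 2 / 2))) *
      ENNReal.ofReal (Real.exp (M * l ^ 2)) = ENNReal.ofReal (Real.exp (-(M * η ^ 2 / 4))) := by
    intro l hl
    rw [← ENNReal.ofReal_mul hc, ← Real.exp_add, hl]
    congr 2
    ring
  have hl1 : |η / 2| ≤ 1 / 2 := by rw [abs_of_nonneg (by linarith)]; linarith
  have hl2 : |-(η / 2)| ≤ 1 / 2 := by rwa [abs_neg]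
  -- Chernoff bound with l = ±η/2, one sign for each direction of deviation: exp(Ml² - Mη²/2) =
  -- exp(-Mη²/4).
  calc failProb (measureBody.rounds ψ M s₁.tick) _
      ≤ pmfE (measureBody.rounds ψ M s₁.tick) fun s' =>
        ENNReal.ofReal (Real.exp (-(M * η ^ 2 / 2))) * moment D x (η / 2) M s' +
        ENNReal.ofReal (Real.exp (-(M * η ^ 2 / 2))) * moment D x (-(η / 2)) M s' := by
        refine failProb_le_pmfE fun s' _ hne => ?_
        rw [moment, moment, ← ENNReal.ofReal_mul hc, ← ENNReal.ofReal_mul hc, ← Real.exp_add,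
          ← Real.exp_add]
        rw [abs_le, not_and_or, not_le, not_le] at hne
        rcases hne with hne | hne
        · refine le_trans ?_ le_add_self
          rw [ENNReal.one_le_ofReal, Real.one_le_exp_iff]
          nlinarith
        · refine le_trans ?_ le_self_add
          rw [ENNReal.one_le_ofReal, Real.one_le_exp_iff]
          nlinarith
    _ ≤ _ := by
        rw [pmfE_add, pmfE_mul_left, pmfE_mul_left, two_mul]
        refine add_le_add ?_ ?_
        · rw [← hb (η / 2) rfl]
          gcongr
          exact hexp _ hl1
        · rw [← hb (-(η / 2)) (by ring)]
          gcongr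
          exact hexp _ hl2

/-! ### Search of the numerators -/

/-- A test of one pair of numerators. -/
def testPair : Prog :=
  .shot rJunk rId ⨾ .instr (.sub rU rCur rAcc) ⨾ .instr (.sub rBit rAcc rCur) ⨾
  .ite rU rTol
    (.ite rBit rTol (.instr (.add rSolA rValA rZero) ⨾ .instr (.add rSolB rValB rZero))
      (.instr (.const rJunk 0)))
    (.instr (.const rJunk 0)) ⨾
  .instr (.add rValB rValB rOne) ⨾ .instr (.add rCur rCur rMB)

/-- The tests for one value of the first numerator. -/
def testLine : Prog :=
  .shot rJunk rId ⨾ .instr (.add rValB rLow rZero) ⨾ .instr (.add rCur rLine rZero) ⨾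
  .loop rWidth testPair ⨾ .instr (.add rValA rValA rOne) ⨾ .instr (.add rLine rLine rMA)

/-- Search of the pair of numerators that matches the accumulated outcomes. -/
def search : Prog :=
  .instr (.add rValA rLow rZero) ⨾ .instr (.add rLine rRow rZero) ⨾ .loop rWidth testLine

/-- The pair of numerators is the only one that passes the test. -/
def Matches (t : ℕ) (X Y T acc a₀ b₀ : ℤ) : Prop :=
  ∀ a b : ℤ, |a| ≤ 2 ^ t → |b| ≤ 2 ^ t → (|a * X + b * Y - acc| ≤ T ↔ a = a₀ ∧ b = b₀)

/-- The pairs are scanned in lexicographic order, and the combination aX + bY is kept up to date by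
additions. As only (a₀, b₀) passes the test, the solution registers are right from the moment the
scan has gone past it. -/
theorem testLine_spec {t : ℕ} {X Y T acc a₀ b₀ a : ℤ} (hb : |b₀| ≤ 2 ^ t) (ha : |a| ≤ 2 ^ t)
    (hm : Matches t X Y T acc a₀ b₀) {s : Store n} (hone : s.reg rOne = 1)
    (hzero : s.reg rZero = 0) (hX : s.reg rMA = X) (hY : s.reg rMB = Y) (hT : s.reg rTol = T)
    (hacc : s.reg rAcc = acc) (hlow : s.reg rLow = -2 ^ t)
    (hwidth : s.reg rWidth = ((2 * 2 ^ t + 1 : ℕ) : ℤ)) (hA : s.reg rValA = a)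
    (hline : s.reg rLine = a * X + -2 ^ t * Y)
    (hsol : a₀ < a → s.reg rSolA = a₀ ∧ s.reg rSolB = b₀) :
    testLine.Spec ψ s.tick fun s' => s'.reg rValA = a + 1 ∧
      s'.reg rLine = (a + 1) * X + -2 ^ t * Y ∧
      (a₀ < a + 1 → s'.reg rSolA = a₀ ∧ s'.reg rSolB = b₀) := by
  simp only [testLine, Prog.spec_seq, Prog.spec_shot, Prog.spec_instr]
  intro o _
  generalize (if o = true then (1 : ℤ) else -1) = w
  simp only [Instr.exec, Store.setReg, Store.tick, Function.update_apply, Nat.reduceEqDiff,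
    if_true, if_false, hzero, hlow, hline, add_zero]
  have hk : ∀ x y z : ℤ, (Function.update (Function.update (Function.update s.reg rJunk x) rValB y)
      rCur z rWidth).toNat = 2 * 2 ^ t + 1 := by
    intro x y z
    simp only [Function.update_apply, Nat.reduceEqDiff, if_false, hwidth]
    exact Int.toNat_natCast _
  obtain ⟨hb1, hb2⟩ := abs_le.mp hb
  refine Prog.spec_loop (fun j s' => s'.reg rValB = -2 ^ t + j ∧
    s'.reg rCur = a * X + (-2 ^ t + j) * Y ∧
    (a₀ < a ∨ (a₀ = a ∧ b₀ < -2 ^ t + j) → s'.reg rSolA = a₀ ∧ s'.reg rSolB = b₀)) ?_ ?_ ?_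
  · refine ⟨by simp [Store.tick], by simp [Store.tick], fun h => ?_⟩
    have : a₀ < a := by
      rcases h with h | ⟨-, h⟩
      · exact h
      · push_cast at h; linarith
    simpa [Store.tick] using hsol this
  · rintro j hj s' ⟨h1, h2, h3⟩ hF
    rw [Store.nat, hk] at hj
    have f1 : s'.reg rOne = 1 := by rw [hF.reg rOne rfl]; simpa using hone
    have f0 : s'.reg rZero = 0 := by rw [hF.reg rZero rfl]; simpa using hzero
    have fY : s'.reg rMB = Y := by rw [hF.reg rMB rfl]; simpa using hY
    have fT : s'.reg rTol = T := by rw [hF.reg rTol rfl]; simpa using hT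
    have fa : s'.reg rAcc = acc := by rw [hF.reg rAcc rfl]; simpa using hacc
    have fA : s'.reg rValA = a := by rw [hF.reg rValA rfl]; simpa using hA
    have hbj : |(-2 ^ t + j : ℤ)| ≤ 2 ^ t := by
      have : (j : ℤ) ≤ 2 * 2 ^ t := by exact_mod_cast Nat.lt_succ_iff.mp hj
      exact abs_le.mpr ⟨by linarith [Int.natCast_nonneg j], by linarith⟩
    have hiff := hm a (-2 ^ t + j) ha hbj
    rw [abs_le'] at hiff
    simp only [testPair, Prog.spec_seq, Prog.spec_shot, Prog.spec_instr, Prog.spec_ite]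
    intro o _
    generalize (if o = true then (1 : ℤ) else -1) = w
    simp only [Instr.exec, Store.setReg, Store.tick, Function.update_apply,
      Nat.reduceEqDiff, if_true, if_false, f1, f0, fY, fT, fa, fA, h1, h2, add_zero]
    have g1 : (-2 ^ t + j + 1 : ℤ) = -2 ^ t + ((j + 1 : ℕ) : ℤ) := by push_cast; ring
    have g2 : a * X + (-2 ^ t + j) * Y + Y = a * X + (-2 ^ t + ((j + 1 : ℕ) : ℤ)) * Y := by
      push_cast; ring
    have hno : ¬ (a = a₀ ∧ (-2 ^ t + j : ℤ) = b₀) → (a₀ < a ∨ (a₀ = a ∧ b₀ < -2 ^ t +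
        ((j + 1 : ℕ) : ℤ))) → s'.reg rSolA = a₀ ∧ s'.reg rSolB = b₀ := by
      intro hne h
      refine h3 (h.imp_right fun ⟨e1, e2⟩ => ⟨e1, ?_⟩)
      push_cast at e2
      have : (-2 ^ t + j : ℤ) ≠ b₀ := fun e => hne ⟨e1.symm, e⟩
      omega
    rw [neg_sub] at hiff
    split_ifs with c1 c2
    · obtain ⟨rfl, rfl⟩ := hiff.mp ⟨c1, c2⟩
      exact ⟨g1, g2, fun _ => ⟨rfl, rfl⟩⟩
    · exact ⟨g1, g2, hno fun h => c2 (hiff.mpr h).2⟩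
    · exact ⟨g1, g2, hno fun h => c1 (hiff.mpr h).1⟩
  · rintro s' ⟨h1, h2, h3⟩ hF
    rw [Store.nat, hk] at h3
    have f1 : s'.reg rOne = 1 := by rw [hF.reg rOne rfl]; simpa using hone
    have fX : s'.reg rMA = X := by rw [hF.reg rMA rfl]; simpa using hX
    have fA : s'.reg rValA = a := by rw [hF.reg rValA rfl]; simpa using hA
    have fL : s'.reg rLine = a * X + -2 ^ t * Y := by rw [hF.reg rLine rfl]; simpa using hline
    simp only [f1, fX, fA, fL]
    refine ⟨by simp, by simp; ring, fun h => ?_⟩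
    refine h3 ?_
    push_cast
    rcases lt_or_eq_of_le (Int.lt_add_one_iff.mp h) with h | h
    · exact Or.inl h
    · exact Or.inr ⟨h, by linarith⟩

theorem search_spec {t : ℕ} {q A B D : ℤ} {M : ℕ} {a₀ b₀ : ℤ} {s : Store n} (hc : Consts t s)
    (htab : Tables t q A B D M s) (ha : |a₀| ≤ 2 ^ t) (hb : |b₀| ≤ 2 ^ t)
    (hm : Matches t (M * A) (M * B) (M * q) (s.reg rAcc) a₀ b₀) :
    search.Spec ψ s fun s' => s'.reg rSolA = a₀ ∧ s'.reg rSolB = b₀ := by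
  simp only [search, Prog.spec_seq, Prog.spec_instr]
  simp only [Instr.exec, Store.setReg, Store.tick, Function.update_apply, Nat.reduceEqDiff,
    if_false, hc.zero, htab.low, htab.row, add_zero]
  have hk : ∀ x y : ℤ, (Function.update (Function.update s.reg rValA x) rLine y rWidth).toNat =
      2 * 2 ^ t + 1 := by
    intro x y
    simp only [Function.update_apply, Nat.reduceEqDiff, if_false, htab.width]
    exact Int.toNat_natCast _
  obtain ⟨ha1, ha2⟩ := abs_le.mp ha
  refine Prog.spec_loop (fun i s' => s'.reg rValA = -2 ^ t + i ∧
    s'.reg rLine = (-2 ^ t + i) * (M * A) + -2 ^ t * (M * B) ∧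
    (a₀ < -2 ^ t + i → s'.reg rSolA = a₀ ∧ s'.reg rSolB = b₀)) ?_ ?_ ?_
  · refine ⟨by simp [Store.tick], by simp [Store.tick], fun h => ?_⟩
    push_cast at h
    linarith
  · rintro i hi s' ⟨h1, h2, h3⟩ hF
    rw [Store.nat, hk] at hi
    have hai : |(-2 ^ t + i : ℤ)| ≤ 2 ^ t := by
      have : (i : ℤ) ≤ 2 * 2 ^ t := by exact_mod_cast Nat.lt_succ_iff.mp hi
      exact abs_le.mpr ⟨by linarith [Int.natCast_nonneg i], by linarith⟩
    refine (testLine_spec hb hai hm ?_ ?_ ?_ ?_ ?_ ?_ ?_ ?_ h1 h2 h3).mono fun s'' h => ?_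
    · rw [hF.reg rOne rfl]; simpa using hc.one
    · rw [hF.reg rZero rfl]; simpa using hc.zero
    · rw [hF.reg rMA rfl]; simpa using htab.mulA
    · rw [hF.reg rMB rfl]; simpa using htab.mulB
    · rw [hF.reg rTol rfl]; simpa using htab.tol
    · rw [hF.reg rAcc rfl]; simp
    · rw [hF.reg rLow rfl]; simpa using htab.low
    · rw [hF.reg rWidth rfl]; simpa using htab.width
    · push_cast
      rw [← add_assoc]
      exact h
  · rintro s' ⟨h1, h2, h3⟩ -
    rw [Store.nat, hk] at h3
    exact h3 (by push_cast; linarith)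

/-- Shots are counted apart from correctness, because the counts must hold on every run, also when
the accumulated outcomes match no pair. -/
theorem testPair_shots (s : Store n) : testPair.Spec ψ s fun s' => s'.shots = s.shots + 1 := by
  simp only [testPair, Prog.spec_seq, Prog.spec_shot, Prog.spec_instr, Prog.spec_ite]
  intro o _
  simp only [Instr.exec, Store.setReg, Store.tick, ite_self]

theorem testLine_shots {s : Store n} {W : ℕ} (hW : s.reg rWidth = W) :
    testLine.Spec ψ s fun s' => s'.shots = s.shots + (1 + W) := by
  simp only [testLine, Prog.spec_seq, Prog.spec_shot, Prog.spec_instr]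
  intro o _
  refine Prog.spec_loop (fun j s' => s'.shots = s.shots + (1 + j)) rfl ?_ ?_
  · rintro j - s' h -
    refine (testPair_shots s'.tick).mono fun s'' h' => ?_
    rw [h']
    change s'.shots + 1 = _
    rw [h]; ring
  · rintro s' h -
    have : (s.reg rWidth).toNat = W := by rw [hW]; rfl
    rw [← this]
    exact h

theorem search_shots {s : Store n} {W : ℕ} (hW : s.reg rWidth = W) :
    search.Spec ψ s fun s' => s'.shots = s.shots + W * (1 + W) := by
  simp only [search, Prog.spec_seq, Prog.spec_instr]
  refine Prog.spec_loop (fun j s' => s'.shots = s.shots + j * (1 + W)) ?_ ?_ ?_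
  · rw [zero_mul]; rfl
  · rintro j - s' h hF
    have hW' : s'.tick.reg rWidth = W := (hF.reg rWidth rfl).trans hW
    refine (testLine_shots hW').mono fun s'' h' => ?_
    rw [h']
    change s'.shots + _ = _
    rw [h]; ring
  · rintro s' h -
    have : (s.reg rWidth).toNat = W := by rw [hW]; rfl
    rw [← this]
    rw [← this] at h
    exact h

/-! ### The list of nontrivial cosets -/

/-- Appends the current Pauli string and its numerators to the output if they are not zero. -/
def record : Prog :=
  .shot rJunk rId ⨾ .instr (.store rOut rSolA) ⨾ .instr (.add rU rOut rOne) ⨾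
  .instr (.store rU rSolB) ⨾ .instr (.setX rDst rN) ⨾ .instr (.mul rDst rDst rSrc) ⨾
  .instr (.const rBit 1) ⨾ .instr (.sub rU rZero rAcc) ⨾
  .ite rAcc rTol
    (.ite rU rTol (.instr (.const rBit 0)) (.instr (.const rJunk 0)))
    (.instr (.const rJunk 0)) ⨾
  .instr (.add rDst rDst rBit) ⨾ .instr (.add rOut rOut rBit) ⨾ .instr (.add rOut rOut rBit) ⨾
  .instr (.add rNum rNum rBit) ⨾ .instr (.add rSrc rSrc rOne)

/-- The output list after `i` entries, for the Pauli strings `f (4n+1), …, f (4n+i)`; `g` is the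
integer array at the start. -/
structure ListInv (ψ : PureState n) (t m : ℕ) (f : ℕ → Pauli n) (g : ℕ → ℤ) (k i : ℕ)
    (idx : ℕ → ℕ) (pau : ℕ → Pauli n) (arr : ℕ → ℤ) : Prop where
  le : k ≤ i
  rest : ∀ j, 4 * n + i < j → pau j = f j
  keepPau : ∀ j < m, pau j = f j
  keepArr : ∀ j < m, arr j = g j
  range : ∀ j < k, 1 ≤ idx j ∧ idx j ≤ i
  mono : ∀ j j', j < j' → j' < k → idx j < idx j'
  entry : ∀ j < k, pau (m + j) = f (4 * n + idx j)
  ne_zero : ∀ j < k, ψ.expect (f (4 * n + idx j)) ≠ 0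
  value : ∀ j < k, ψ.expect (f (4 * n + idx j)) =
    (arr (m + 2 * j) + arr (m + 2 * j + 1) * Real.sqrt 2) / Real.sqrt 2 ^ t
  complete : ∀ l, 1 ≤ l → l ≤ i → ψ.expect (f (4 * n + l)) ≠ 0 → ∃ j < k, idx j = l

/-- The output list after `i` entries, and its pointers. -/
structure EntryInv (ψ : PureState n) (t m : ℕ) (f : ℕ → Pauli n) (g : ℕ → ℤ) (i : ℕ)
    (s : Store n) : Prop where
  src : s.reg rSrc = ((4 * n + 1 + i : ℕ) : ℤ)
  list : ∃ k idx, s.reg rNum = (k : ℕ) ∧ s.reg rDst = ((m + k : ℕ) : ℤ) ∧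
    s.reg rOut = ((m + 2 * k : ℕ) : ℤ) ∧ ListInv ψ t m f g k i idx s.pau s.arr

theorem EntryInv.of_frame {t m : ℕ} {f : ℕ → Pauli n} {g : ℕ → ℤ} {i : ℕ} {s s' : Store n}
    (h : EntryInv ψ t m f g i s) {p : Prog} (hF : p.Frame s s')
    (hp : ∀ r < 36, 32 ≤ r → p.writes r = false) (hpau : p.writesPau = false)
    (harr : p.writesArr = false) : EntryInv ψ t m f g i s' := by
  obtain ⟨k, idx, h1, h2, h3, h4⟩ := h.list
  refine ⟨(hF.reg _ (hp _ (by decide) (by decide))).trans h.src, k, idx,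
    (hF.reg _ (hp _ (by decide) (by decide))).trans h1,
    (hF.reg _ (hp _ (by decide) (by decide))).trans h2,
    (hF.reg _ (hp _ (by decide) (by decide))).trans h3, ?_⟩
  rwa [hF.pau hpau, hF.arr harr]

/-- An entry with expectation value zero is passed over. -/
theorem ListInv.skip {t m : ℕ} {f : ℕ → Pauli n} {g : ℕ → ℤ} {k i : ℕ} {idx : ℕ → ℕ}
    {pau pau' : ℕ → Pauli n} {arr arr' : ℕ → ℤ} (hm : m ≤ 2 * n)
    (h : ListInv ψ t m f g k i idx pau arr)
    (hpau : ∀ j, j ≠ m + k → pau' j = pau j)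
    (harr : ∀ j, j ≠ m + 2 * k → j ≠ m + 2 * k + 1 → arr' j = arr j)
    (hx : ψ.expect (f (4 * n + (i + 1))) = 0) :
    ListInv ψ t m f g k (i + 1) idx pau' arr' := by
  have hle := h.le
  refine ⟨by omega, fun j hj => ?_, fun j hj => ?_, fun j hj => ?_, fun j hj => ?_, h.mono,
    fun j hj => ?_, h.ne_zero, fun j hj => ?_, fun l h1 h2 h3 => ?_⟩
  · rw [hpau j (by omega), h.rest j (by omega)]
  · rw [hpau j (by omega), h.keepPau j hj]
  · rw [harr j (by omega) (by omega), h.keepArr j hj]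
  · exact ⟨(h.range j hj).1, (h.range j hj).2.trans (by omega)⟩
  · rw [hpau _ (by omega), h.entry j hj]
  · rw [harr _ (by omega) (by omega), harr _ (by omega) (by omega), h.value j hj]
  · rcases Nat.lt_or_ge i l with hl | hl
    · rw [show l = i + 1 by omega] at h3
      exact absurd hx h3
    · exact h.complete l h1 hl h3

/-- An entry with expectation value different from zero is appended. -/
theorem ListInv.append {t m : ℕ} {f : ℕ → Pauli n} {g : ℕ → ℤ} {k i : ℕ} {idx : ℕ → ℕ}
    {pau pau' : ℕ → Pauli n} {arr arr' : ℕ → ℤ} (hm : m ≤ 2 * n)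
    (h : ListInv ψ t m f g k i idx pau arr)
    (hpau : ∀ j, j ≠ m + k → pau' j = pau j) (hnew : pau' (m + k) = f (4 * n + (i + 1)))
    (harr : ∀ j, j ≠ m + 2 * k → j ≠ m + 2 * k + 1 → arr' j = arr j)
    (hx : ψ.expect (f (4 * n + (i + 1))) ≠ 0)
    (hval : ψ.expect (f (4 * n + (i + 1))) =
      (arr' (m + 2 * k) + arr' (m + 2 * k + 1) * Real.sqrt 2) / Real.sqrt 2 ^ t) :
    ListInv ψ t m f g (k + 1) (i + 1) (Function.update idx k (i + 1)) pau' arr' := by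
  have hle := h.le
  have hidx : ∀ j, j < k → Function.update idx k (i + 1) j = idx j := fun j hj =>
    Function.update_of_ne hj.ne _ _
  refine ⟨by omega, fun j hj => ?_, fun j hj => ?_, fun j hj => ?_, fun j hj => ?_,
    fun j j' hj hj' => ?_, fun j hj => ?_, fun j hj => ?_, fun j hj => ?_, fun l h1 h2 h3 => ?_⟩
  · rw [hpau j (by omega), h.rest j (by omega)]
  · rw [hpau j (by omega), h.keepPau j hj]
  · rw [harr j (by omega) (by omega), h.keepArr j hj]
  · rcases Nat.lt_succ_iff_lt_or_eq.mp hj with hj | rfl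
    · rw [hidx j hj]
      exact ⟨(h.range j hj).1, (h.range j hj).2.trans (by omega)⟩
    · rw [Function.update_self]
      omega
  · rcases Nat.lt_succ_iff_lt_or_eq.mp hj' with hj' | rfl
    · rw [hidx j (hj.trans hj'), hidx j' hj']
      exact h.mono j j' hj hj'
    · rw [hidx j hj, Function.update_self]
      exact Nat.lt_succ_of_le (h.range j hj).2
  · rcases Nat.lt_succ_iff_lt_or_eq.mp hj with hj | rfl
    · rw [hidx j hj, hpau _ (by omega), h.entry j hj]
    · rw [Function.update_self, hnew]
  · rcases Nat.lt_succ_iff_lt_or_eq.mp hj with hj | rfl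
    · rw [hidx j hj]
      exact h.ne_zero j hj
    · rwa [Function.update_self]
  · rcases Nat.lt_succ_iff_lt_or_eq.mp hj with hj | rfl
    · rw [hidx j hj, harr _ (by omega) (by omega), harr _ (by omega) (by omega), h.value j hj]
    · rw [Function.update_self, hval]
  · rcases Nat.lt_or_ge i l with hl | hl
    · exact ⟨k, k.lt_succ_self, by rw [Function.update_self]; omega⟩
    · obtain ⟨j, hj, e⟩ := h.complete l h1 hl h3
      exact ⟨j, hj.trans k.lt_succ_self, by rw [hidx j hj, e]⟩

theorem Pauli.at_of_le {q : ℕ} (h : n ≤ q) (p : ZMod 2 × ZMod 2) : Pauli.at n q p = 0 := by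
  funext i
  have : ¬ ((i : ℕ) = q) := by omega
  simp [Pauli.at, this]

/-- The entry is written in any case and only the pointers move conditionally, so an entry with
value zero is overwritten by the next. The test |acc| ≤ tolerance is the search test for the pair
(0, 0). Addressing the nonexistent qubit n produces the identity, which turns the multiplication
into a copy. The target cell m+k stays below the source cell 4n+1+i, so unread entries are safe. -/
theorem record_spec {t m : ℕ} {f : ℕ → Pauli n} {g : ℕ → ℤ} {i : ℕ} {s : Store n} {a₀ b₀ : ℤ}
    (hc : Consts t s) (hm : m ≤ 2 * n) (hsA : s.reg rSolA = a₀) (hsB : s.reg rSolB = b₀)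
    (hx : ψ.expect (f (4 * n + (i + 1))) = (a₀ + b₀ * Real.sqrt 2) / Real.sqrt 2 ^ t)
    (htest : |s.reg rAcc| ≤ s.reg rTol ↔ ψ.expect (f (4 * n + (i + 1))) = 0)
    (h : EntryInv ψ t m f g i s) : record.Spec ψ s (EntryInv ψ t m f g (i + 1)) := by
  obtain ⟨k, idx, h1, h2, h3, h4⟩ := h.list
  have hle := h4.le
  have hsrc : s.pau (4 * n + 1 + i) = f (4 * n + (i + 1)) := by
    rw [h4.rest _ (by omega)]; congr 1; ring
  have hone : ((m + 2 * k : ℕ) : ℤ) + 1 = ((m + 2 * k + 1 : ℕ) : ℤ) := by push_cast; ring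
  have hne : 4 * n + 1 + i ≠ m + k := by omega
  simp only [record, Prog.spec_seq, Prog.spec_shot, Prog.spec_instr, Prog.spec_ite]
  intro o _
  generalize (if o = true then (1 : ℤ) else -1) = w
  simp only [Instr.exec, Store.setReg, Store.setPau, Store.tick, Store.nat, Function.update_apply,
    Nat.reduceEqDiff, if_true, if_false, OfNat.zero_ne_ofNat, hc.one, hc.zero, hc.qubits, h1, h2,
    h3, h.src, hone, hsA, hsB, Int.toNat_natCast, zero_sub, add_zero, hne, hsrc,
    Pauli.at_of_le le_rfl, zero_add]
  have hpau : ∀ j, j ≠ m + k → Function.update (Function.update s.pau (m + k) 0) (m + k)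
      (f (4 * n + (i + 1))) j = s.pau j := fun j hj => by
    rw [Function.update_of_ne hj, Function.update_of_ne hj]
  have hnew : Function.update (Function.update s.pau (m + k) 0) (m + k)
      (f (4 * n + (i + 1))) (m + k) = f (4 * n + (i + 1)) := Function.update_self ..
  have harr : ∀ j, j ≠ m + 2 * k → j ≠ m + 2 * k + 1 → Function.update
      (Function.update s.arr (m + 2 * k) a₀) (m + 2 * k + 1) b₀ j = s.arr j := fun j hj hj' => by
    rw [Function.update_of_ne hj', Function.update_of_ne hj]
  have hA : Function.update (Function.update s.arr (m + 2 * k) a₀) (m + 2 * k + 1) b₀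
      (m + 2 * k) = a₀ := by
    rw [Function.update_of_ne (by omega), Function.update_self]
  have hB : Function.update (Function.update s.arr (m + 2 * k) a₀) (m + 2 * k + 1) b₀
      (m + 2 * k + 1) = b₀ := Function.update_self ..
  generalize Function.update (Function.update s.pau (m + k) 0) (m + k) _ = pau' at *
  generalize Function.update (Function.update s.arr (m + 2 * k) a₀) (m + 2 * k + 1) b₀ = arr' at *
  have hskip : |s.reg rAcc| ≤ s.reg rTol → ListInv ψ t m f g k (i + 1) idx pau' arr' := fun e =>
    h4.skip hm hpau harr (htest.mp e)
  have happ : ¬ |s.reg rAcc| ≤ s.reg rTol →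
      ListInv ψ t m f g (k + 1) (i + 1) (Function.update idx k (i + 1)) pau' arr' := fun e =>
    h4.append hm hpau hnew harr (mt htest.mpr e) (by rw [hA, hB, hx])
  rw [abs_le'] at hskip happ
  split_ifs with c1 c2
  · exact ⟨by simp; ring, k, idx, by simp, by simp, by simp, hskip ⟨c1, c2⟩⟩
  · exact ⟨by simp; ring, k + 1, _, by simp, by simp; ring, by simp; ring, happ fun e => c2 e.2⟩
  · exact ⟨by simp; ring, k + 1, _, by simp, by simp; ring, by simp; ring, happ fun e => c1 e.1⟩

theorem record_shots (s : Store n) : record.Spec ψ s fun s' => s'.shots = s.shots + 1 := by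
  simp only [record, Prog.spec_seq, Prog.spec_shot, Prog.spec_instr, Prog.spec_ite]
  intro o _
  simp only [Instr.exec, Store.setReg, Store.setPau, Store.tick, ite_self]

/-- Irrationality of √2: a value is zero only if both numerators are. -/
theorem add_mul_sqrt_two_eq_zero {a b : ℤ} (h : (a : ℝ) + b * Real.sqrt 2 = 0) :
    a = 0 ∧ b = 0 := by
  by_cases hb : b = 0
  · subst hb
    exact ⟨by simpa using h, rfl⟩
  · have hb' : (b : ℝ) ≠ 0 := by exact_mod_cast hb
    refine absurd irrational_sqrt_two (not_not.mpr ⟨-a / b, ?_⟩)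
    push_cast
    field_simp
    linarith

/-- Estimation of one expectation value. -/
def estimateBody : Prog := measureEntry ⨾ search ⨾ record

theorem estimateBody_shots {t : ℕ} {q A B D : ℤ} {M : ℕ} {s : Store n}
    (htab : Tables t q A B D M s) : estimateBody.Spec ψ s fun s' =>
      s'.shots = s.shots + (M + (2 * 2 ^ t + 1) * (1 + (2 * 2 ^ t + 1)) + 1) := by
  refine Prog.spec_seq_frame (measureEntry_spec htab.meas) fun s₁ h₁ hF₁ => ?_
  refine Prog.spec_seq_frame (search_shots ((hF₁.reg rWidth rfl).trans htab.width))
    fun s₂ h₂ _ => ?_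
  refine (record_shots s₂).mono fun s₃ h₃ => ?_
  rw [h₃, h₂, h₁]
  ring

/-- Only the measurement can fail. Once the accumulated outcomes are within the accuracy 1/(64·4^t)
that decoding requires, search and recording give the right result with certainty. -/
theorem estimateBody_failProb {t m : ℕ} (hψ : IsDopedState t ψ) {q A B D : ℤ} {M : ℕ}
    (hM : 0 < M) (hscale : Scale t q A B D) (hm : m ≤ 2 * n) {f : ℕ → Pauli n} {g : ℕ → ℤ}
    {i : ℕ} {s : Store n} (hc : Consts t s) (htab : Tables t q A B D M s)
    (h : EntryInv ψ t m f g i s) :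
    failProb (estimateBody.run ψ s) (EntryInv ψ t m f g (i + 1)) ≤
      2 * ENNReal.ofReal (Real.exp (-(M * (1 / (64 * 4 ^ t)) ^ 2 / 4))) := by
  obtain ⟨a₀, b₀, ha, hb, hx⟩ := hψ.expect_eq (f (4 * n + (i + 1)))
  have hη1 : (1 : ℝ) / (64 * 4 ^ t) ≤ 1 := by
    rw [div_le_one (by positivity)]
    have : (1 : ℝ) ≤ 4 ^ t := one_le_pow₀ (by norm_num)
    linarith
  have hsrc : s.pau (s.nat rSrc) = f (4 * n + (i + 1)) := by
    obtain ⟨k, idx, -, -, -, h4⟩ := h.list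
    have : s.nat rSrc = 4 * n + (i + 1) := by
      rw [Store.nat, h.src, Int.toNat_natCast]; ring
    rw [this, h4.rest _ (by omega)]
  have hmeas := measureEntry_failProb (ψ := ψ) hscale.pos hc.zero htab.weight htab.meas
    (η := 1 / (64 * 4 ^ t)) (by positivity) hη1
  rw [hsrc] at hmeas
  rw [← add_zero (2 * ENNReal.ofReal _)]
  refine Prog.failProb_seq_le hmeas fun s₁ hs₁ hclose => (failProb_eq_zero ?_).le
  have hF₁ := measureEntry.spec_frame ψ s s₁ hs₁
  have hc₁ := hc.of_frame hF₁ (by decide)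
  have htab₁ := htab.of_frame hF₁ (by decide)
  have h₁ := h.of_frame hF₁ (by decide) rfl rfl
  have hmatch : Matches t (M * A) (M * B) (M * q) (s₁.reg rAcc) a₀ b₀ := fun a b ha' hb' =>
    hscale.decode (M := (M : ℤ)) (by exact_mod_cast hM) ha hb hx
      (by rw [Int.cast_natCast, div_eq_mul_one_div (M : ℝ)]; exact hclose) ha' hb'
  refine Prog.spec_seq_frame (search_spec hc₁ htab₁ ha hb hmatch) fun s₂ ⟨hA, hB⟩ hF₂ => ?_
  have hc₂ := hc₁.of_frame hF₂ (by decide)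
  have htab₂ := htab₁.of_frame hF₂ (by decide)
  refine record_spec hc₂ hm hA hB hx ?_ (h₁.of_frame hF₂ (by decide) rfl rfl)
  have h0 := hmatch 0 0 (by simp) (by simp)
  rw [zero_mul, zero_mul, zero_add, zero_sub, abs_neg] at h0
  rw [hF₂.reg rAcc rfl, htab₂.tol, h0, hx, div_eq_zero_iff,
    or_iff_left (pow_ne_zero _ (Real.sqrt_ne_zero'.mpr (by norm_num)))]
  constructor
  · rintro ⟨rfl, rfl⟩
    simp
  · intro e
    obtain ⟨h1, h2⟩ := add_mul_sqrt_two_eq_zero e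
    exact ⟨h1.symm, h2.symm⟩

/-- The pointers of the output list. -/
def initList : Prog :=
  .instr (.add rDst rM rZero) ⨾ .instr (.add rOut rM rZero) ⨾ .instr (.add rSrc rId rOne) ⨾
  .instr (.const rNum 0) ⨾ .instr (.sub rLen rLen rOne)

/-- Entry 0 is the identity, which represents the trivial coset; so the loop starts at cell 4n+1 and
has one round less than the list has entries. -/
theorem initList_spec {t m c : ℕ} {s : Store n} (hc : Consts t s) (hm : s.reg rM = m)
    (hlen : s.reg rLen = ((2 ^ c : ℕ) : ℤ)) :
    initList.Spec ψ s fun s' => EntryInv ψ t m s.pau s.arr 0 s' ∧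
      s'.nat rLen = 2 ^ c - 1 ∧ s'.shots = s.shots := by
  have e : ((2 ^ c : ℕ) : ℤ) - 1 = ((2 ^ c - 1 : ℕ) : ℤ) := by
    rw [Nat.cast_sub Nat.one_le_two_pow, Nat.cast_one]
  simp only [initList, Prog.spec_seq, Prog.spec_instr]
  simp only [Instr.exec, Store.setReg, Store.tick, Function.update_apply, Nat.reduceEqDiff,
    if_false, hc.one, hc.zero, hc.idAddr, hm, hlen, add_zero, e]
  refine ⟨⟨by simp, 0, fun _ => 0, by simp, by simp, by simp, ?_⟩, ?_, trivial⟩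
  · refine ⟨le_rfl, fun _ _ => rfl, fun _ _ => rfl, fun _ _ => rfl, ?_, ?_, ?_, ?_, ?_, ?_⟩
    all_goals intros; omega
  · simp only [Store.nat, Function.update_self]
    exact Int.toNat_natCast _

/-- The numbers of generators and of list entries, in the output registers. -/
def finish : Prog := .instr (.add rN rM rZero) ⨾ .instr (.add rT rNum rZero)

/-- Estimation of the expectation values of all coset representatives. -/
def estimate : Prog := tables ⨾ initList ⨾ .loop rLen estimateBody ⨾ finish

theorem estimate_shots {t m c : ℕ} {s : Store n} (hc : Consts t s) (hm : s.reg rM = m)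
    (hlen : s.reg rLen = ((2 ^ c : ℕ) : ℤ)) : estimate.Spec ψ s fun s' =>
      s'.shots ≤ s.shots + (28 + 8 * t + 2 ^ t + 2 ^ (14 + 4 * t) * (n + 2 * t)) +
        2 ^ c * (2 ^ (14 + 4 * t) * (n + 2 * t) + (2 * 2 ^ t + 1) * (1 + (2 * 2 ^ t + 1)) + 1) := by
  refine Prog.spec_seq_frame (tables_spec hc) fun s₁ ⟨⟨q, A, B, D, hscale, htab⟩, h₁⟩ hF₁ => ?_
  have hc₁ := hc.of_frame hF₁ (by decide)
  refine Prog.spec_seq_frame (initList_spec hc₁ ((hF₁.reg rM rfl).trans hm)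
    ((hF₁.reg rLen rfl).trans hlen)) fun s₂ ⟨_, hlen₂, h₂⟩ hF₂ => ?_
  have htab₂ := htab.of_frame hF₂ (by decide)
  rw [Prog.spec_seq]
  refine Prog.spec_loop (fun j s' => s'.shots = s₂.shots +
    j * (2 ^ (14 + 4 * t) * (n + 2 * t) + (2 * 2 ^ t + 1) * (1 + (2 * 2 ^ t + 1)) + 1)) ?_ ?_ ?_
  · rw [zero_mul]; rfl
  · rintro j - s' hj hF
    have htab' := (htab₂.of_frame hF (by decide)).of_frame (Prog.Frame.refl_tick estimateBody s')
      (by decide)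
    refine (estimateBody_shots htab').mono fun s'' h'' => ?_
    rw [h'']
    change s'.shots + _ = _
    rw [hj, add_assoc, ← Nat.succ_mul]
  · intro s' hj _
    simp only [finish, Prog.spec_seq, Prog.spec_instr]
    change s'.shots ≤ _
    rw [hj, hlen₂, h₂, h₁]
    gcongr
    exact Nat.sub_le _ _

/-- The result of the estimation phase. -/
def Estimated (ψ : PureState n) (t m c : ℕ) (s s' : Store n) : Prop :=
  s'.nat 0 = m ∧ ∃ idx, ListInv ψ t m s.pau s.arr (s'.nat 1) (2 ^ c - 1) idx s'.pau s'.arr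

theorem estimate_failProb {t m c : ℕ} (hn : 0 < n) (hψ : IsDopedState t ψ) {s : Store n}
    (hc : Consts t s) (hm : s.reg rM = m) (hle : m ≤ 2 * n)
    (hlen : s.reg rLen = ((2 ^ c : ℕ) : ℤ)) :
    failProb (estimate.run ψ s) (Estimated ψ t m c s) ≤
      ((2 ^ c - 1 : ℕ) : ℝ≥0∞) * (2 * ENNReal.ofReal (Real.exp (-((n + 2 * t : ℕ) : ℝ)))) := by
  refine Prog.failProb_seq_of_spec (tables_spec hc)
    fun s₁ ⟨⟨q, A, B, D, hscale, htab⟩, _⟩ hF₁ => ?_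
  have hc₁ := hc.of_frame hF₁ (by decide)
  refine Prog.failProb_seq_of_spec (initList_spec hc₁ ((hF₁.reg rM rfl).trans hm)
    ((hF₁.reg rLen rfl).trans hlen)) fun s₂ ⟨h₂, hlen₂, _⟩ hF₂ => ?_
  rw [hF₁.pau rfl, hF₁.arr rfl] at h₂
  have hc₂ := hc₁.of_frame hF₂ (by decide)
  have htab₂ := htab.of_frame hF₂ (by decide)
  have hm₂ : s₂.reg rM = m := (hF₂.reg rM rfl).trans ((hF₁.reg rM rfl).trans hm)
  -- With M = 2^(14+4t)(n+2t) and η = 1/(64·4^t) one has Mη²/4 = n+2t, because 64²·4 = 2^14. The 2t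
  -- beyond n pays for the union bound over 4^t cosets.
  have hrate : ((2 ^ (14 + 4 * t) * (n + 2 * t) : ℕ) : ℝ) * (1 / (64 * 4 ^ t)) ^ 2 / 4 =
      ((n + 2 * t : ℕ) : ℝ) := by
    rw [Nat.cast_mul, pow_add 2 14, pow_mul]
    have e : ((16 : ℝ)) ^ t = 4 ^ t * 4 ^ t := by rw [← mul_pow]; norm_num
    push_cast
    norm_num
    rw [e]
    field_simp
    ring
  have hloop := Prog.failProb_loop_le (ψ := ψ) (a := rLen) (p := estimateBody) (s := s₂)
    (δ := 2 * ENNReal.ofReal (Real.exp (-((n + 2 * t : ℕ) : ℝ))))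
    (EntryInv ψ t m s.pau s.arr) ⟨h₂.src, h₂.list⟩ fun j _ s' hj hF => by
      have hF' := Prog.Frame.refl_tick estimateBody s'
      rw [← hrate]
      exact estimateBody_failProb hψ (by positivity) hscale hle
        ((hc₂.of_frame hF (by decide)).of_frame hF' (by decide))
        ((htab₂.of_frame hF (by decide)).of_frame hF' (by decide)) ⟨hj.src, hj.list⟩
  rw [hlen₂] at hloop
  rw [← add_zero (_ * (2 * ENNReal.ofReal _))]
  refine Prog.failProb_seq_le hloop fun s₃ _ ⟨hI, hF₃⟩ => (failProb_eq_zero ?_).le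
  obtain ⟨k, idx, h1, -, -, h4⟩ := hI.list
  have hc₃ := hc₂.of_frame hF₃ (by decide)
  have hm₃ : s₃.reg rM = m := (hF₃.reg rM rfl).trans hm₂
  change finish.Spec ψ s₃ _
  simp only [finish, Prog.spec_seq, Prog.spec_instr]
  simp only [Instr.exec, Store.setReg, Store.tick, Function.update_apply, OfNat.ofNat_ne_zero,
    if_false, hc₃.zero, hm₃, h1, add_zero]
  refine ⟨by simp [Store.nat], idx, ?_⟩
  have e : Store.nat (n := n) ⟨Function.update (Function.update s₃.reg rN (m : ℤ)) rT (k : ℤ),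
      s₃.arr, s₃.pau, s₃.samples, s₃.shots, s₃.steps + 1 + 1⟩ 1 = k := by
    simp [Store.nat]
  rw [e]
  exact h4

/-! ### The learner -/

/-- From the stabilizer group to signs of its generators and representatives of its cosets. -/
def prepare : Prog := (copyRecords ⨾ complement) ⨾ signs ⨾ enumerate

/-- The store after preparation; `s₀` is the store after the second elimination. -/
structure Prepared (ψ : PureState n) (t m k c : ℕ) (s₀ s : Store n) : Prop where
  consts : Consts t s
  num : s.reg rM = m
  len : s.reg rLen = ((2 ^ min c (2 * t) : ℕ) : ℤ)
  same : ∀ i, i ≤ 4 * n → s.pau i = s₀.pau i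
  cover : ∀ x ∈ cellSpan s₀.pau (2 * n + k) (min c (2 * t)),
    ∃ i < 2 ^ min c (2 * t), s.pau (4 * n + i) = x
  sign : ∀ j < m, s₀.pau j ∈ ψ.stab → ((s.arr j : ℤ) : ℝ) = ψ.expect (s₀.pau j)

theorem prepare_spec {t m : ℕ} {s : Store n} (hc : Consts t s) (hm : PoolInv ψ s m)
    (hid : s.pau (4 * n) = 0) : prepare.Spec ψ s fun s' => ∃ k c s₀, Complemented ψ t m k c s₀ ∧
      (∀ i < m, s₀.pau i = s.pau i) ∧ Prepared ψ t m k c s₀ s' ∧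
      s'.shots ≤ s.shots + 2 * n * (2 * n + 2) + m + 2 * 2 ^ min c (2 * t) := by
  refine Prog.spec_seq.mpr ((copyRecords_complement_spec hc hm hid).mono
    fun s₀ ⟨k, c, h₀, hsame, hshots, _⟩ => ?_)
  refine Prog.spec_seq_frame (signs_spec h₀.consts h₀.num) fun s₁ ⟨h₁, hsign⟩ hF₁ => ?_
  have hpau : s₁.pau = s₀.pau := hF₁.pau rfl
  have hC : Complemented ψ t m k c s₁ := by
    refine ⟨h₀.consts.of_frame hF₁ (by decide), (hF₁.reg rM rfl).trans h₀.num,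
      (hF₁.reg rCnt rfl).trans h₀.cnt, (hF₁.reg rSize rfl).trans h₀.size,
      (hF₁.reg rBase rfl).trans h₀.base, h₀.total, ?_, ?_, ?_, ?_, ?_⟩
    all_goals rw [hpau]
    · exact h₀.span
    · exact h₀.id
    · exact h₀.pool
    · exact h₀.records
    · exact h₀.commutes
  refine ((enumerate_spec hC).and (enumerate.spec_frame ψ _)).mono fun s₂ ⟨h₂, hF₂⟩ => ?_
  refine ⟨k, c, s₀, h₀, hsame, ⟨hC.consts.of_frame hF₂ (by decide), (hF₂.reg rM rfl).trans hC.num,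
    h₂.len, fun i hi => ?_, fun x hx => ?_, fun j hj hst => ?_⟩, ?_⟩
  · rw [h₂.same i hi, hpau]
  · rw [← hpau] at hx
    exact h₂.cover x hx
  · rw [hF₂.arr rfl]
    exact hsign j hj hst
  · have := h₂.shots
    omega

/-- If the pool spans the stabilizer group, the second elimination finds generators of the
commutant modulo the stabilizer group, at most `2t` in number. -/
theorem Complemented.commutant {t m k c : ℕ} {s : Store n} (hψ : IsDopedState t ψ)
    (h : Complemented ψ t m k c s) (hG : cellSpan s.pau 0 m = stabSubmodule ψ.vec) :
    perp (stabSubmodule ψ.vec : Set (Pauli n)) =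
      stabSubmodule ψ.vec ⊔ cellSpan s.pau (2 * n + k) c ∧
    Module.finrank (ZMod 2) (perp (stabSubmodule ψ.vec : Set (Pauli n))) =
      Module.finrank (ZMod 2) (stabSubmodule ψ.vec) + c ∧ c ≤ 2 * t := by
  obtain ⟨hW, hU⟩ := complement_of_cells (G := stabSubmodule ψ.vec) (C := cells s.pau (2 * n + k) c)
    ψ.stab_le_perp (h.span.symm.trans hG) (h.records.trans Submodule.subset_span) h.pool h.commutes
  have h1 := finrank_eq_of_cellSpan_eq_perp h.total h.span
  have h2 := finrank_cellSpan_le s.pau (2 * n) k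
  have h3 := finrank_perp_add (stabSubmodule ψ.vec)
  have h4 := hψ.le_finrank_stab
  have h5 := Submodule.finrank_add_le_finrank_add_finrank (stabSubmodule ψ.vec)
    (cellSpan s.pau (2 * n + k) c)
  have h6 := finrank_cellSpan_le s.pau (2 * n + k) c
  have h7 := h.total
  have h8 : Module.finrank (ZMod 2) (perp (stabSubmodule ψ.vec : Set (Pauli n))) ≤
      Module.finrank (ZMod 2) (stabSubmodule ψ.vec) + c := by
    rw [hU]
    exact h5.trans (Nat.add_le_add_left h6 _)
  rw [hW] at h2
  rw [hG] at h1
  -- With m = dim G, the k remaining pool cells span G, so k ≥ m and c ≤ 2n-2m. The commutant has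
  -- dimension 2n-m ≤ m+c, which gives the reverse inequality. Finally m ≥ n-t.
  exact ⟨hU, by omega, by omega⟩

/-- The output is the exact description if sampling and estimation succeed. -/
theorem Estimated.describes {t m k c : ℕ} (hψ : IsDopedState t ψ) {s₀ s s' : Store n}
    (h₀ : Complemented ψ t m k c s₀) (hG : cellSpan s₀.pau 0 m = stabSubmodule ψ.vec)
    (h : Prepared ψ t m k c s₀ s) (h' : Estimated ψ t m (min c (2 * t)) s s') :
    s'.output.Describes t ψ := by
  obtain ⟨rfl, idx, hl⟩ := h'
  obtain ⟨hU, hdim, hct⟩ := h₀.commutant hψ hG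
  have hcov₀ := h.cover
  rw [min_eq_left hct] at hl hcov₀
  have htot := h₀.total
  have hcov : ∀ P ∈ perp (stabSubmodule ψ.vec : Set (Pauli n)),
      ∃ i < 2 ^ c, P - s.pau (4 * n + i) ∈ stabSubmodule ψ.vec := by
    intro P hP
    rw [hU] at hP
    obtain ⟨g, hg, x, hx, rfl⟩ := Submodule.mem_sup.mp hP
    obtain ⟨i, hi, rfl⟩ := hcov₀ x hx
    exact ⟨i, hi, by rwa [add_sub_cancel_right]⟩
  -- The list covers G^⊥ modulo G and has exactly as many entries as there are classes, so it has no
  -- repetitions.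
  have hinj : ∀ {i j : ℕ}, i < 2 ^ c → j < 2 ^ c →
      s.pau (4 * n + i) - s.pau (4 * n + j) ∈ stabSubmodule ψ.vec → i = j := fun hi hj =>
    eq_of_sub_mem_of_cover (E := fun i => s.pau (4 * n + i)) hdim hcov hi hj
  have hzero : s.pau (4 * n + 0) = 0 := (h.same _ (by omega)).trans h₀.id
  have hpow : 0 < 2 ^ c := by positivity
  have hgen : ∀ j < s'.nat 0, s'.pau j = s₀.pau j := fun j hj =>
    (hl.keepPau j hj).trans (h.same j (by omega))
  have hg : s'.output.g = fun i : Fin (s'.nat 0) => s₀.pau i := funext fun i => hgen i i.2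
  have hlist : ∀ i : Fin s'.output.k, s'.output.h i = s.pau (4 * n + idx i) := fun i =>
    hl.entry i i.2
  have hlt : ∀ i : Fin s'.output.k, idx i < 2 ^ c := fun i => by
    have := (hl.range i i.2).2
    omega
  refine Description.describes_of ?_ ?_ ?_ ?_ ?_ ?_ ?_
  · rw [← hG, cellSpan, cells_eq_range, hg]
    simp only [zero_add]
    rfl
  · rw [hg]
    exact linearIndependent_cells htot h₀.span
  · intro j
    have hj : s₀.pau j ∈ ψ.stab := by
      rw [← mem_stabSubmodule_iff, ← hG]
      exact Submodule.subset_span (mem_cells (by omega) (by rw [zero_add]; exact j.2))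
    rw [hg, ← h.sign j j.2 hj]
    exact congrArg _ (hl.keepArr j j.2).symm
  · intro P
    constructor
    · intro hP
      obtain ⟨i, hi, hPi⟩ := hcov P fun g hg => ψ.symp_eq_zero hP hg
      rcases Nat.eq_zero_or_pos i with rfl | hpos
      · rw [hzero, sub_zero] at hPi
        exact Or.inl hPi
      -- Whether an expectation vanishes depends only on the class modulo G, so the representative
      -- of a nonzero P has been recorded.
      · have hne : ψ.expect (s.pau (4 * n + i)) ≠ 0 :=
          ψ.expect_add_ne_zero (g := P - s.pau (4 * n + i)) hPi (by rwa [add_sub_cancel])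
        obtain ⟨j, hj, rfl⟩ := hl.complete i hpos (by omega) hne
        refine Or.inr ⟨⟨j, hj⟩, ?_⟩
        have e := hlist ⟨j, hj⟩
        rw [e]
        exact hPi
    · rintro (hP | ⟨i, hP⟩)
      · rcases (ψ.mem_stab_iff P).mp hP with e | e <;> rw [e] <;> norm_num
      · refine ψ.expect_add_ne_zero (g := s'.output.h i - P) ?_ ?_
        · rw [← mem_stabSubmodule_iff, ← neg_sub]
          exact neg_mem hP
        · rw [add_sub_cancel, hlist]
          exact hl.ne_zero i i.2
  -- An entry inside G would share the class of entry 0, but recorded indices start at 1.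
  · intro i hi
    have := hinj (hlt i) hpow (by rw [hzero, sub_zero, ← hlist]; exact hi)
    have := (hl.range i i.2).1
    omega
  · intro i j hij
    rw [hlist, hlist] at hij
    have e := hinj (hlt i) (hlt j) hij
    rcases lt_trichotomy (i : ℕ) j with hlt' | heq | hlt'
    · exact absurd e (hl.mono _ _ hlt' j.2).ne
    · exact Fin.ext heq
    · exact absurd e (hl.mono _ _ hlt' i.2).ne'
  · intro i
    rw [hlist]
    exact hl.value i i.2

/-- The learner of doped stabilizer states. -/
def learner : Prog := initPool ⨾ initSampling ⨾ sampling ⨾ prepare ⨾ estimate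

/-- Counts that hold on every run: the pool never exceeds 2n cells, and the cap in the enumeration
bounds the list by 4^t. The extra sample is the reference. -/
theorem learner_resources {t : ℕ} : learner.Spec ψ (Store.init n t) fun s =>
    s.samples = 2 ^ (6 + 2 * t) * n + 1 ∧
    s.shots ≤ n + (6 + 2 * t) + 2 ^ (6 + 2 * t) * n * (2 * n) + 2 * n * (2 * n + 2) + 2 * n +
      2 * 2 ^ (2 * t) + (28 + 8 * t + 2 ^ t + 2 ^ (14 + 4 * t) * (n + 2 * t)) +
      2 ^ (2 * t) * (2 ^ (14 + 4 * t) * (n + 2 * t) +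
        (2 * 2 ^ t + 1) * (1 + (2 * 2 ^ t + 1)) + 1) := by
  refine Prog.spec_seq.mpr ((initPool_spec t).mono fun s₁ h₁ => ?_)
  refine Prog.spec_seq.mpr ((initSampling_spec h₁).mono fun s₂ h₂ => ?_)
  refine Prog.spec_seq.mpr ((sampling_spec h₂).mono fun s₃ ⟨R, _, h₃⟩ => ?_)
  obtain ⟨m, hm⟩ := h₃.pool
  refine Prog.spec_seq_frame (prepare_spec h₃.consts hm h₃.id)
    fun s₄ ⟨k, c, s₀, _, _, h₄, hshots⟩ hF₄ => ?_
  refine ((estimate_shots h₄.consts h₄.num h₄.len).and (estimate.spec_frame ψ _)).mono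
    fun s₅ ⟨h₅, hF₅⟩ => ⟨?_, ?_⟩
  · rw [hF₅.samples rfl, hF₄.samples rfl, h₃.samples]
  · have h6 := h₃.shots
    have h7 := hm.le
    have h8 : 2 ^ min c (2 * t) ≤ 2 ^ (2 * t) :=
      Nat.pow_le_pow_right (by norm_num) (min_le_right _ _)
    have h9 := Nat.mul_le_mul_right (2 ^ (14 + 4 * t) * (n + 2 * t) +
      (2 * 2 ^ t + 1) * (1 + (2 * 2 ^ t + 1)) + 1) h8
    omega

/-- Sampling costs 2^{-n}. Given its success, preparation is certain, and estimation costs at most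
4^t·2·exp(-(n+2t)) ≤ 2·2^{-n}, where e ≥ 2 is used. -/
theorem learner_failProb {t : ℕ} (hn : 0 < n) (hψ : IsDopedState t ψ) :
    failProb (learner.run ψ (Store.init n t)) (fun s => s.output.Describes t ψ) ≤
      3 * 2⁻¹ ^ n := by
  refine Prog.failProb_seq_of_spec (initPool_spec t) fun s₁ h₁ _ => ?_
  refine Prog.failProb_seq_of_spec (initSampling_spec h₁) fun s₂ h₂ _ => ?_
  rw [show (3 : ℝ≥0∞) * 2⁻¹ ^ n = 2⁻¹ ^ n + 2 * 2⁻¹ ^ n by ring]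
  refine Prog.failProb_seq_le (sampling_failProb hψ h₂) fun s₃ hs₃ hgood => ?_
  obtain ⟨R, _, h₃⟩ := sampling_spec h₂ s₃ hs₃
  obtain ⟨m, hm⟩ := h₃.pool
  have hsz : s₃.nat rSize = m := by rw [Store.nat, hm.size]; rfl
  rw [hsz] at hgood
  refine Prog.failProb_seq_of_spec (prepare_spec h₃.consts hm h₃.id)
    fun s₄ ⟨k, c, s₀, h₀, hsame, h₄, _⟩ _ => ?_
  have hG : cellSpan s₀.pau 0 m = stabSubmodule ψ.vec := by
    rw [← hgood, cellSpan, cellSpan, cells_congr fun i _ hi => hsame i (by omega)]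
  refine (failProb_mono fun s₅ _ h₅ => h₅.describes hψ h₀ hG h₄).trans
    ((estimate_failProb hn hψ h₄.consts h₄.num hm.le h₄.len).trans ?_)
  have hexp : Real.exp (-((n + 2 * t : ℕ) : ℝ)) ≤ (2⁻¹ : ℝ) ^ (n + 2 * t) := by
    rw [Real.exp_neg, ← mul_one ((n + 2 * t : ℕ) : ℝ), Real.exp_nat_mul, inv_pow]
    refine inv_anti₀ (by positivity) (pow_le_pow_left₀ (by norm_num) ?_ _)
    have := Real.add_one_le_exp (1 : ℝ)
    linarith
  have hexp' : ENNReal.ofReal (Real.exp (-((n + 2 * t : ℕ) : ℝ))) ≤ 2⁻¹ ^ (n + 2 * t) := by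
    refine (ENNReal.ofReal_le_ofReal hexp).trans (le_of_eq ?_)
    rw [ENNReal.ofReal_pow (by norm_num), ENNReal.ofReal_inv_of_pos (by norm_num)]
    norm_num
  have hcard : ((2 ^ min c (2 * t) - 1 : ℕ) : ℝ≥0∞) ≤ 2 ^ (2 * t) := by
    have : 2 ^ min c (2 * t) - 1 ≤ 2 ^ (2 * t) :=
      (Nat.sub_le _ _).trans (Nat.pow_le_pow_right (by norm_num) (min_le_right _ _))
    exact_mod_cast this
  calc _ ≤ (2 : ℝ≥0∞) ^ (2 * t) * (2 * 2⁻¹ ^ (n + 2 * t)) := by gcongr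
    _ = 2 * 2⁻¹ ^ n * (2 * 2⁻¹) ^ (2 * t) := by rw [pow_add, mul_pow]; ring
    _ = 2 * 2⁻¹ ^ n := by
      rw [ENNReal.mul_inv_cancel (by norm_num) (by norm_num), one_pow, mul_one]

/-! ### Arithmetic of the resource bounds -/

theorem samples_bound {n t : ℕ} (hn : 0 < n) :
    2 ^ (6 + 2 * t) * n + 1 ≤ 65 * (2 ^ (6 * t) * n) := by
  have h1 : 2 ^ (2 * t) ≤ 2 ^ (6 * t) := Nat.pow_le_pow_right (by norm_num) (by omega)
  have h2 : 0 < 2 ^ (6 * t) * n := by positivity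
  have h3 := Nat.mul_le_mul_right n h1
  rw [pow_add, mul_assoc]
  omega

/-- Up to constants every summand is at most 2^(at)·b with a ≤ 9 and b ≤ n(n+6t), hence at most Y.
The leading terms are 2^(6t)(n+2t), from the estimation, and 2^(2t)n², from the elimination. -/
theorem shots_bound {n t : ℕ} (hn : 0 < n) :
    n + (6 + 2 * t) + 2 ^ (6 + 2 * t) * n * (2 * n) + 2 * n * (2 * n + 2) + 2 * n +
      2 * 2 ^ (2 * t) + (28 + 8 * t + 2 ^ t + 2 ^ (14 + 4 * t) * (n + 2 * t)) +
      2 ^ (2 * t) * (2 ^ (14 + 4 * t) * (n + 2 * t) +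
        (2 * 2 ^ t + 1) * (1 + (2 * 2 ^ t + 1)) + 1) ≤
      40000 * (2 ^ (9 * t) * (n * (n + 6 * t))) := by
  set Y := 2 ^ (9 * t) * (n * (n + 6 * t)) with hY
  have hp : ∀ a, a ≤ 9 → 2 ^ (a * t) ≤ 2 ^ (9 * t) := fun a ha =>
    Nat.pow_le_pow_right (by norm_num) (Nat.mul_le_mul_right t ha)
  have hN1 : n + 6 * t ≤ n * (n + 6 * t) := Nat.le_mul_of_pos_left _ hn
  have hN2 : n * n ≤ n * (n + 6 * t) := Nat.mul_le_mul_left n (by omega)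
  have hN0 : 1 ≤ n * (n + 6 * t) := by omega
  have key : ∀ a b, a ≤ 9 → b ≤ n * (n + 6 * t) → 2 ^ (a * t) * b ≤ Y := fun a b ha hb =>
    Nat.mul_le_mul (hp a ha) hb
  have k1 := key 0 (n + 6 * t) (by norm_num) hN1
  have k2 := key 2 (n * n) (by norm_num) hN2
  have k3 := key 0 (n * n) (by norm_num) hN2
  have k4 := key 2 1 (by norm_num) hN0
  have k5 := key 1 1 (by norm_num) hN0
  have k6 := key 4 (n + 2 * t) (by norm_num) (by omega)
  have k7 := key 6 (n + 2 * t) (by norm_num) (by omega)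
  have k8 := key 4 1 (by norm_num) hN0
  have k9 := key 3 1 (by norm_num) hN0
  have k10 := key 0 1 (by norm_num) hN0
  have e : ∀ a, 2 ^ (a * t) = (2 ^ t) ^ a := fun a => by rw [mul_comm, pow_mul]
  rw [pow_add, pow_add, e 2, e 4]
  rw [e] at k1 k2 k3 k4 k5 k6 k7 k8 k9 k10
  generalize 2 ^ t = X at *
  nlinarith

end TDoped

theorem mainTheorem2 :
    ∃ (prog : TDoped.Prog) (C : ℕ), ∀ (n t : ℕ), 0 < n →
      ∀ ψ : TDoped.PureState n, TDoped.IsDopedState t ψ →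
        (∀ s ∈ (prog.run ψ (TDoped.Store.init n t)).support,
          s.samples ≤ C * (2 ^ (6 * t) * n) ∧
          s.shots ≤ C * (2 ^ (9 * t) * (n * (n + 6 * t))) ∧
          s.steps ≤ C * (s.samples + s.shots) + C * n ^ 2) ∧
        (prog.run ψ (TDoped.Store.init n t)).toOuterMeasure
            {s | ¬ s.output.Describes t ψ} ≤ (C : ENNReal) * n * (2⁻¹ : ENNReal) ^ n := by
  -- The check that every round of every loop takes a sample or a shot is a finite computation on
  -- the program text.
  obtain ⟨C, c, hsteps⟩ := TDoped.learner.steps_le (by decide)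
  refine ⟨TDoped.learner, 40000 + C + c, fun n t hn ψ hψ => ⟨fun s hs => ?_, ?_⟩⟩
  · obtain ⟨h1, h2⟩ := TDoped.learner_resources s hs
    -- The initial store has all counters at zero. The remaining additive constant c is absorbed
    -- into the term with n², as n ≥ 1.
    have h3 : s.steps + C * 0 ≤ 0 + C * (s.samples + s.shots) + c := (hsteps n ψ _ s hs).2.2
    have h4 : c * 1 ≤ c * n ^ 2 := Nat.mul_le_mul_left c (Nat.one_le_pow _ _ hn)
    refine ⟨?_, ?_, ?_⟩
    · rw [h1]
      exact (TDoped.samples_bound hn).trans (Nat.mul_le_mul_right _ (by omega))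
    · exact h2.trans ((TDoped.shots_bound hn).trans (Nat.mul_le_mul_right _ (by omega)))
    · have h5 : C * (s.samples + s.shots) ≤ (40000 + C + c) * (s.samples + s.shots) :=
        Nat.mul_le_mul_right _ (by omega)
      have h6 : c * n ^ 2 ≤ (40000 + C + c) * n ^ 2 := Nat.mul_le_mul_right _ (by omega)
      omega
  · rw [← TDoped.failProb_eq_toOuterMeasure]
    refine (TDoped.learner_failProb hn hψ).trans ?_
    gcongr
    have : 3 ≤ (40000 + C + c) * n := by nlinarith
    exact_mod_cast this
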